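/- **Setting.** Let $A$ be an alphabet, $\mathcal W$ the set of words over $A$ (with the empty word $\emptyset$), $d\ge 0$, and $\nu_{j,\ell}\in\mathbb C$ for $1\le j\le d$, $\ell\in A$. On $\mathbb C^{\mathcal W}$ consider the convolution product $(\delta\star\delta')_{w}=\sum_{w=w'w''}\delta_{w'}\delta'_{w''}$, whose unit is denoted by $1\!\!1$. Let $\mathcal G$ be the group (for $\star$) of all $\gamma\in\mathbb C^{\mathcal W}$ with $\gamma_\emptyset=1$ and $\gamma_w\gamma_{w'}=\sum_j\gamma_{w_j}$ whenever the shuffle product of $w$ and $w'$ is $\sum_j w_j$. Let $\mathfrak g$ be the set of all $\beta\in\mathbb C^{\mathcal W}$ with $\beta_\emptyset=0$ and $\sum_j\beta_{w_j}=0$ whenever $w,w'$ are nonempty with shuffle product $\sum_j w_j$. Write $\exp_\star(\beta)=\sum_{n\ge 0}\beta^{\star n}/n!$. For $v\in\mathbb C^d$ and $w=\ell_1\cdots\ell_n$ put $\nu^v_w=\sum_{i=1}^n\sum_{j=1}^d v_j\nu_{j,\ell_i}$, $(\xi_v\delta)_w=\nu^v_w\delta_w$, $(\Xi_v\delta)_w=e^{\nu^v_w}\delta_w$,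 and let $\mathcal V(v)$ be the set of all $u\in\mathbb C^d$ such that, for every word $w$, $\nu^v_w=0$ implies $\nu^u_w=0$. Put $\overline{\mathfrak g}=\mathbb C^d\times\mathfrak g$ with the bracket $[(v,\beta),(u,\eta)]=(0,\xi_v\eta-\xi_u\beta+\beta\star\eta-\eta\star\beta)$, and $(u,\gamma)\bigstar(v,\delta)=(v+\delta_\emptyset u,\gamma\star\Xi_u\delta)$. Let $g_1,\dots,g_d$ and $f_\ell$ ($\ell\in A$) be smooth (that is, holomorphic) vector fields on $\mathbb C^D$ with $[g_j,g_k]=0$ and $[g_j,f_\ell]=\nu_{j,\ell}f_\ell$, where $[g,f]=f'g-g'f$. Put $g^v=\sum_j v_jg_j$ and assume that the flows of all the fields $g^v$ are globally defined smooth maps, $\varphi_{tv}$ being the flow of $g^v$ at the real time $t$. Put $f_\emptyset(x)=x$, $f_{\ell_1\cdots\ell_n}(x)=f_{\ell_2\cdots\ell_n}'(x)f_{\ell_1}(x)$, and let $W_\delta(x)=\sum_w\delta_wf_w(x)$ and $\overline W_{(v,\delta)}(x)=\varphi_v(W_\delta(x))$ be the word series and the extended word series. All series are formal: one commuting formal parameter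 $\varepsilon_\ell$ is attached to each letter, the words containing each letter $\ell$ exactly $m_\ell$ times form the term of degree $m$, and formal series of points are substituted into series of smooth maps by Taylor expansion. Points, initial values and solutions may be formal series in these parameters. **Theorem.** Given $(v,\beta)\in\overline{\mathfrak g}$, there is $\kappa\in\mathcal G$, depending only on $v$, $\beta$ and the $\nu_{j,\ell}$, such that the element $$\widehat\beta=\kappa\star\beta\star\kappa^{-1}-(\xi_v\kappa)\star\kappa^{-1}$$ belongs to $\mathfrak g$ and satisfies $[(v,0),(0,\widehat\beta)]=(0,\xi_v\widehat\beta)=0$. In addition, $(0,\widehat\beta)$ commutes with all $(u,0)$, $u\in\mathcal V(v)$. Moreover, for all fields $g_j$, $f_\ell$ as above: 1. $x=W_\kappa(X)$ is an invertible formal change of variables, and it transforms the system $\frac{d}{dt}x=g^v(x)+W_\beta(x)$ into the normal form $\frac{d}{dt}X=g^v(X)+W_{\widehat\beta}(X)$, that is, $W_\kappa'(X)\,(g^v(X)+W_{\widehat\beta}(X))=g^v(W_\kappa(X))+W_\beta(W_\kappa(X))$. 2. The vector fields $g^v$ and $W_{\widehat\beta}$ commute, and $W_{\widehat\beta}$ commutes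 with $g^u$ for all $u\in\mathcal V(v)$. 3. The formal system $\frac{d}{dt}X=W_{\widehat\beta}(X)$ has a solution flow $\widehat\varphi_t$, and every solution of the normal form, on any open interval containing $0$, satisfies $X(t)=\varphi_{tv}(\widehat\varphi_t(X(0)))=\widehat\varphi_t(\varphi_{tv}(X(0)))$. 4. The solutions of the normal form on an open interval containing $0$ are exactly the curves with $X(t)=\overline W_{(tv,\exp_\star(t\widehat\beta))}(X(0))$, where, for each real $t$, $\exp_\star(t\widehat\beta)\in\mathcal G$ and $$(tv,\exp_\star(t\widehat\beta))=(0,\exp_\star(t\widehat\beta))\bigstar(tv,1\!\!1)=(tv,1\!\!1)\bigstar(0,\exp_\star(t\widehat\beta)).$$ -/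

import Mathlib

noncomputable section

namespace WordSeries

/-! ### Families of coefficients indexed by words, and the convolution product -/

/-- Families `δ = (δ_w)` of complex numbers indexed by the words with letters in `A`
(a word is a list of letters, `[]` is the empty word). -/
def Coeff (A : Type*) : Type _ := List A → ℂ

namespace Coeff

variable {A : Type*}

instance : AddCommGroup (Coeff A) := inferInstanceAs (AddCommGroup (List A → ℂ))
instance : Module ℂ (Coeff A) := inferInstanceAs (Module ℂ (List A → ℂ))

@[ext] theorem ext {δ δ' : Coeff A} (h : ∀ w : List A, δ w = δ' w) : δ = δ' := funext h

@[simp] theorem add_apply (δ δ' : Coeff A) (w : List A) : (δ + δ') w = δ w + δ' w := rfl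
@[simp] theorem sub_apply (δ δ' : Coeff A) (w : List A) : (δ - δ') w = δ w - δ' w := rfl
@[simp] theorem neg_apply (δ : Coeff A) (w : List A) : (-δ) w = -δ w := rfl
@[simp] theorem zero_apply (w : List A) : (0 : Coeff A) w = 0 := rfl
@[simp] theorem smul_apply (c : ℂ) (δ : Coeff A) (w : List A) : (c • δ) w = c * δ w := rfl

/-- The convolution product `⋆`: the sum over all ways of cutting the word in two. -/
instance : Mul (Coeff A) :=
  ⟨fun δ δ' w => ∑ j ∈ Finset.range (w.length + 1), δ (w.take j) * δ' (w.drop j)⟩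

/-- The unit for the convolution product. -/
instance : One (Coeff A) := ⟨fun w => if w.isEmpty then 1 else 0⟩

theorem mul_apply (δ δ' : Coeff A) (w : List A) :
    (δ * δ') w = ∑ j ∈ Finset.range (w.length + 1), δ (w.take j) * δ' (w.drop j) := rfl

@[simp] theorem one_nil : (1 : Coeff A) [] = 1 := rfl
@[simp] theorem one_cons (a : A) (w : List A) : (1 : Coeff A) (a :: w) = 0 := rfl

@[simp] theorem mul_nil (δ δ' : Coeff A) : (δ * δ') [] = δ [] * δ' [] := by
  simp [mul_apply]

/-- The family `w ↦ δ_{aw}`. -/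
def shift (a : A) (δ : Coeff A) : Coeff A := fun w => δ (a :: w)

theorem mul_cons (δ δ' : Coeff A) (a : A) (w : List A) :
    (δ * δ') (a :: w) = δ [] * δ' (a :: w) + (shift a δ * δ') w := by
  rw [mul_apply, List.length_cons, Finset.sum_range_succ', add_comm]
  rfl

protected theorem right_distrib' (δ δ' δ'' : Coeff A) : (δ + δ') * δ'' = δ * δ'' + δ' * δ'' := by
  ext w; simp [mul_apply, add_mul, Finset.sum_add_distrib]

protected theorem left_distrib' (δ δ' δ'' : Coeff A) : δ * (δ' + δ'') = δ * δ' + δ * δ'' := by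
  ext w; simp [mul_apply, mul_add, Finset.sum_add_distrib]

protected theorem smul_mul' (c : ℂ) (δ δ' : Coeff A) : (c • δ) * δ' = c • (δ * δ') := by
  ext w; simp [mul_apply, mul_assoc, Finset.mul_sum]

protected theorem zero_mul' (δ : Coeff A) : 0 * δ = 0 := by
  ext w; simp [mul_apply]

protected theorem mul_zero' (δ : Coeff A) : δ * 0 = 0 := by
  ext w; simp [mul_apply]

theorem shift_mul (a : A) (δ δ' : Coeff A) :
    shift a (δ * δ') = δ [] • shift a δ' + shift a δ * δ' := by
  ext w; exact mul_cons δ δ' a w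

protected theorem mul_assoc' (δ δ' δ'' : Coeff A) : δ * δ' * δ'' = δ * (δ' * δ'') := by
  ext w
  induction w generalizing δ with
  | nil => simp [mul_assoc]
  | cons a w ih =>
    rw [mul_cons, mul_cons, shift_mul, Coeff.right_distrib', add_apply, ih, Coeff.smul_mul',
      smul_apply, mul_cons, mul_nil]
    ring

protected theorem one_mul' (δ : Coeff A) : 1 * δ = δ := by
  ext w
  cases w with
  | nil => simp
  | cons a w =>
    have h : shift a (1 : Coeff A) = 0 := rfl
    rw [mul_cons, h, Coeff.zero_mul']; simp

protected theorem mul_one' (δ : Coeff A) : δ * 1 = δ := by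
  ext w
  induction w generalizing δ with
  | nil => simp
  | cons a w ih => rw [mul_cons, ih]; simp [shift]

instance : Ring (Coeff A) :=
  { (inferInstance : AddCommGroup (Coeff A)) with
    mul := (· * ·)
    one := 1
    mul_assoc := Coeff.mul_assoc'
    one_mul := Coeff.one_mul'
    mul_one := Coeff.mul_one'
    left_distrib := Coeff.left_distrib'
    right_distrib := Coeff.right_distrib'
    zero_mul := Coeff.zero_mul'
    mul_zero := Coeff.mul_zero' }

end Coeff

/-- The exponential `∑ βⁿ / n!` for the convolution product, computed word by word.
(If `β_∅ = 0`, only the terms with `n` at most the length of the word contribute.) -/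
def expStar {A : Type*} (β : Coeff A) : Coeff A :=
  fun w => ∑' n : ℕ, ((n.factorial : ℂ))⁻¹ * (β ^ n) w

/-! ### The shuffle group and its Lie algebra -/

/-- The shuffle product of two words, as a multiset of words. -/
def shuffle {A : Type*} : List A → List A → Multiset (List A)
  | [], w => {w}
  | a :: u, [] => {a :: u}
  | a :: u, b :: w =>
      (shuffle u (b :: w)).map (fun s => a :: s) + (shuffle (a :: u) w).map (fun s => b :: s)
  termination_by u w => u.length + w.length

/-- The group `𝒢` of the families that satisfy the shuffle relations. -/
def groupG (A : Type*) : Set (Coeff A) :=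
  {γ | γ [] = 1 ∧ ∀ w w' : List A, γ w * γ w' = ((shuffle w w').map fun s => γ s).sum}

/-- The Lie algebra `𝔤` of `𝒢`. -/
def lieG (A : Type*) : Set (Coeff A) :=
  {β | β [] = 0 ∧ ∀ w w' : List A, w ≠ [] → w' ≠ [] → ((shuffle w w').map fun s => β s).sum = 0}

/-! ### The operators attached to the eigenvalues `ν` -/

section Eigenvalues

variable {A : Type*} {d : ℕ} (ν : Fin d → A → ℂ)

/-- `ν^v_w = ∑_{ℓ in w} ∑_j v_j ν_{j,ℓ}`. -/
def nuWord (v : Fin d → ℂ) (w : List A) : ℂ :=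
  (w.map fun ℓ => ∑ j, v j * ν j ℓ).sum

/-- The diagonal operator `Ξ_v`. -/
def bigXi (v : Fin d → ℂ) (δ : Coeff A) : Coeff A := fun w => Complex.exp (nuWord ν v w) * δ w

/-- The diagonal operator `ξ_v`. -/
def xi (v : Fin d → ℂ) (δ : Coeff A) : Coeff A := fun w => nuWord ν v w * δ w

/-- The set `𝒱(v)` of the vectors `u` such that `ν^u_w = 0` whenever `ν^v_w = 0`. -/
def resonanceSpace (v : Fin d → ℂ) : Set (Fin d → ℂ) :=
  {u | ∀ w : List A, nuWord ν v w = 0 → nuWord ν u w = 0}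

/-- The product `(u, γ) ★ (v, δ) = (v + δ_∅ u, γ ⋆ Ξ_u δ)`. -/
def bigStar (p q : (Fin d → ℂ) × Coeff A) : (Fin d → ℂ) × Coeff A :=
  (q.1 + q.2 [] • p.1, p.2 * bigXi ν p.1 q.2)

/-- The bracket `[(v, β), (u, η)] = (0, ξ_v η - ξ_u β + [β, η])` of the extended Lie algebra,
whose elements are the pairs `(v, β)` with `v ∈ ℂ^d`, `β ∈ 𝔤`. -/
def extBracket (p q : (Fin d → ℂ) × Coeff A) : (Fin d → ℂ) × Coeff A :=
  (0, xi ν p.1 q.2 - xi ν q.1 p.2 + (p.2 * q.2 - q.2 * p.2))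

end Eigenvalues

/-! ### Formal series of smooth maps

A formal series of maps carries one commuting formal parameter `ε_ℓ` for each letter, which marks
the occurrences of `f_ℓ`. Hence a word series is graded by the number of occurrences of each letter
in a word; each homogeneous component is a finite sum, even for an infinite alphabet. -/

/-- Formal series `∑_m ε^m p_m` of points `p_m` of `ℂ^D`. -/
abbrev FormalPoint (A : Type*) (D : ℕ) := (A →₀ ℕ) → (Fin D → ℂ)

/-- Formal series `∑_m ε^m Φ_m(x)` of maps from `ℂ^D` to itself, with `Φ_m(x) = Φ x m`.
They serve as formal transformations and as formal vector fields. -/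
abbrev FormalMap (A : Type*) (D : ℕ) := (Fin D → ℂ) → FormalPoint A D

section Formal

variable {A : Type*} {D : ℕ}

/-- All the terms of the series are smooth. -/
def IsSmooth (Φ : FormalMap A D) : Prop := ∀ m, ContDiff ℂ (⊤ : ℕ∞) fun x => Φ x m

variable [DecidableEq A]

/-- A point of `ℂ^D`, seen as a formal series (with only the term of degree `0`). -/
def pointSeries (x : Fin D → ℂ) : FormalPoint A D := fun m => if m = 0 then x else 0

/-- A map, seen as a formal series of maps (with only the term of degree `0`). -/
def mapSeries (F : (Fin D → ℂ) → (Fin D → ℂ)) : FormalMap A D := fun x => pointSeries (F x)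

/-- The degree `b` term of the Taylor expansion of `F(p)`, `p = p_0 + ∑_{m ≠ 0} ε^m p_m`,
i.e. of `∑_k F^{(k)}(p_0)[h, …, h] / k!` with `h = ∑_{m ≠ 0} ε^m p_m`. -/
def taylorTerm (F : (Fin D → ℂ) → (Fin D → ℂ)) (p : FormalPoint A D) (b : A →₀ ℕ) : Fin D → ℂ :=
  ∑ k ∈ Finset.range (b.degree + 1), ((k.factorial : ℂ))⁻¹ •
    ∑ r ∈ (Finset.piAntidiag (Finset.univ : Finset (Fin k)) b).filter (fun r => ∀ i, r i ≠ 0),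
      iteratedFDeriv ℂ k F (p 0) (fun i => p (r i))

/-- Substitution of a formal point into a formal series of maps, `Φ(p) = ∑_a ε^a Φ_a(p)`. -/
def subst (Φ : FormalMap A D) (p : FormalPoint A D) : FormalPoint A D := fun m =>
  ∑ ab ∈ Finset.HasAntidiagonal.antidiagonal m, taylorTerm (fun x => Φ x ab.1) p ab.2

/-- The product `Φ'(x) V(x)` of the Jacobian matrix of `Φ` and the formal vector field `V`. -/
def jacobianMul (Φ V : FormalMap A D) : FormalMap A D := fun x m =>
  ∑ ab ∈ Finset.HasAntidiagonal.antidiagonal m, fderiv ℂ (fun y => Φ y ab.1) x (V x ab.2)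

/-- The Lie–Jacobi bracket `[V, W] = W' V - V' W` of formal vector fields. -/
def formalBracket (V W : FormalMap A D) : FormalMap A D := jacobianMul W V - jacobianMul V W

/-- `x = Φ(X)` is a formal change of variables: it is smooth and has a smooth formal inverse. -/
def IsChangeOfVariables (Φ : FormalMap A D) : Prop :=
  IsSmooth Φ ∧ ∃ Ψ : FormalMap A D, IsSmooth Ψ ∧
    ∀ p : FormalPoint A D, subst Ψ (subst Φ p) = p ∧ subst Φ (subst Ψ p) = p

/-- The change of variables `x = Φ(X)` turns the system `dx/dt = F(x)` into `dX/dt = G(X)`: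
`Φ'(X) G(X) = F(Φ(X))`. -/
def TransformsInto (Φ F G : FormalMap A D) : Prop :=
  IsChangeOfVariables Φ ∧ ∀ X, jacobianMul Φ G X = subst F (Φ X)

/-- The curve `X(t)` of formal points satisfies `dX/dt = F(X)` for `t ∈ J`. -/
def IsFormalSolution (F : FormalMap A D) (J : Set ℝ) (X : ℝ → FormalPoint A D) : Prop :=
  ∀ t ∈ J, ∀ m, HasDerivAt (fun s => X s m) (subst F (X t) m) t

/-- `Φ_t` is the solution flow of the formal system `dX/dt = F(X)`. -/
def IsFormalFlow (F : FormalMap A D) (Φ : ℝ → FormalMap A D) : Prop :=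
  (∀ t, IsSmooth (Φ t)) ∧ (∀ x, Φ 0 x = pointSeries x) ∧
    ∀ x, IsFormalSolution F Set.univ fun t => Φ t x

end Formal

/-! ### The perturbed systems, word series and extended word series -/

section Systems

variable {A : Type*} {d D : ℕ}

/-- `g^v = ∑_j v_j g_j`. -/
def gField (g : Fin d → (Fin D → ℂ) → (Fin D → ℂ)) (v : Fin d → ℂ) :
    (Fin D → ℂ) → (Fin D → ℂ) := fun x => ∑ j, v j • g j x

/-- The `g_j` are commuting smooth vector fields in `ℂ^D` and the `f_ℓ` are smooth vector fields
such that `[g_j, f_ℓ] = ν_{j,ℓ} f_ℓ`, where `[g, f] = f' g - g' f`. -/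
structure IsPerturbedSystem (ν : Fin d → A → ℂ) (g : Fin d → (Fin D → ℂ) → (Fin D → ℂ))
    (f : A → (Fin D → ℂ) → (Fin D → ℂ)) : Prop where
  smooth_g : ∀ j, ContDiff ℂ (⊤ : ℕ∞) (g j)
  smooth_f : ∀ ℓ, ContDiff ℂ (⊤ : ℕ∞) (f ℓ)
  commute : ∀ j k x, VectorField.lieBracket ℂ (g j) (g k) x = 0
  eigen : ∀ j ℓ x, VectorField.lieBracket ℂ (g j) (f ℓ) x = ν j ℓ • f ℓ x

/-- For each `v`, the maps `φ_{tv}`, `t` real, are the flow of `g^v`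
(so that `φ_v` is the flow at time `1`); the flows are smooth maps. -/
structure IsFlow (g : Fin d → (Fin D → ℂ) → (Fin D → ℂ))
    (φ : (Fin d → ℂ) → (Fin D → ℂ) → (Fin D → ℂ)) : Prop where
  smooth : ContDiff ℂ (⊤ : ℕ∞) fun p : (Fin d → ℂ) × (Fin D → ℂ) => φ p.1 p.2
  zero : ∀ x, φ 0 x = x
  deriv : ∀ v x (t : ℝ),
    HasDerivAt (fun s : ℝ => φ ((s : ℂ) • v) x) (gField g v (φ ((t : ℂ) • v) x)) t

/-- The word basis functions: `f_∅` is the identity and `f_{ℓw}(x) = f_w'(x) f_ℓ(x)`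
(in particular, `f_w` is the given `f_ℓ` if `w` consists of the single letter `ℓ`). -/
def wordFun (f : A → (Fin D → ℂ) → (Fin D → ℂ)) : List A → (Fin D → ℂ) → (Fin D → ℂ)
  | [] => fun x => x
  | ℓ :: w => fun x => fderiv ℂ (wordFun f w) x (f ℓ x)

variable [DecidableEq A]

/-- The word series `W_δ(x) = ∑_w δ_w f_w(x)`: its term of degree `m` is the sum over the words
in which each letter `ℓ` occurs exactly `m ℓ` times. -/
def wordSeries (f : A → (Fin D → ℂ) → (Fin D → ℂ)) (δ : Coeff A) : FormalMap A D := fun x m =>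
  ∑ w ∈ (Multiset.lists (Finsupp.toMultiset m)).toFinset, δ w • wordFun f w x

/-- The extended word series `φ_v(W_δ(x))`. -/
def extWordSeries (f : A → (Fin D → ℂ) → (Fin D → ℂ))
    (φ : (Fin d → ℂ) → (Fin D → ℂ) → (Fin D → ℂ)) (p : (Fin d → ℂ) × Coeff A) : FormalMap A D :=
  fun x => subst (mapSeries (φ p.1)) (wordSeries f p.2 x)

/-- The formal vector field `g^v(x) + W_β(x)`. -/
def extField (g : Fin d → (Fin D → ℂ) → (Fin D → ℂ)) (f : A → (Fin D → ℂ) → (Fin D → ℂ))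
    (p : (Fin d → ℂ) × Coeff A) : FormalMap A D :=
  mapSeries (gField g p.1) + wordSeries f p.2

end Systems

end WordSeries

end

/-!
Contraction by `δ`, `w ↦ ∑_{w = w' w''} δ_{w''} w'`, represents the convolution product on the
shuffle algebra; the elements of `𝒢` are exactly those that act as algebra homomorphisms and the
elements of `𝔤` those that act as derivations. Hence gauge transforms stay in `𝔤` and `exp_⋆` maps
`𝔤` to `𝒢`. The gauge `κ` is a limit of products of exponentials: if `ξ_v β` vanishes on the words
of length less than `n`, put `η_w = β_w / ν^v_w` on the words of length `n` with `ν^v_w ≠ 0`, and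
`η_w = 0` elsewhere. Then `η` lies in `𝔤`, because `ν^v_w` depends only on the letters of `w` and
not on their order, and the gauge transform by `exp_⋆ η` agrees with `β - ξ_v η` on the words of
length at most `n`, so that `ξ_v` of it vanishes on the words of length `n` as well.

Composing the Lie derivatives along the fields `f_ℓ` turns the elements of `𝒢` and `𝔤` into
algebra homomorphisms and derivations of the algebra of formal series of smooth functions. By
Hadamard's lemma these are determined by their values on the coordinate functions, and these
values are the word series. All assertions about vector fields, substitutions and solutions thus
become identities between operators; since `ξ_v` is the commutator with the Lie derivative along
`g^v`, an element of its kernel yields operators that commute with the flow of `g^v`. The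
solutions of the normal form are then obtained by variation of constants.
-/

noncomputable section

namespace WordSeries

open Finset.HasAntidiagonal (antidiagonal mem_antidiagonal)

section Shuffle

variable {A : Type*}

/-- The convolution algebra. It is an instance only locally, so that elsewhere the scalar action is
found through the module structure that comes with `Coeff`. -/
abbrev coeffAlgebra : Algebra ℂ (Coeff A) :=
  Algebra.ofModule Coeff.smul_mul' fun c δ δ' => by
    ext w
    simp only [Coeff.mul_apply, Coeff.smul_apply, Finset.mul_sum, mul_left_comm]

/-- The shuffle algebra: finite linear combinations of words. -/
abbrev WordPoly (A : Type*) := List A →₀ ℂ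

/-- The shuffle product of words, extended bilinearly. -/
def shuffleMul : WordPoly A →ₗ[ℂ] WordPoly A →ₗ[ℂ] WordPoly A :=
  Finsupp.linearCombination ℂ fun u => Finsupp.linearCombination ℂ fun w =>
    ((shuffle u w).map fun s => Finsupp.single s 1).sum

local notation:70 x:70 " ⧢ " y:71 => shuffleMul x y

/-- Left cancellation of a letter: `c w ↦ w`, and a word that does not start with `c` is sent
to `0`. These operators are derivations of the shuffle product, and they determine an element of
the shuffle algebra up to a multiple of the empty word. -/
def cancelLetter (c : A) : WordPoly A →ₗ[ℂ] WordPoly A :=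
  Finsupp.lcomapDomain (c :: ·) List.cons_injective

@[simp] theorem cancelLetter_apply (c : A) (x : WordPoly A) (w : List A) :
    cancelLetter c x w = x (c :: w) := rfl

/-- The operator `w ↦ c w` that puts a letter in front of a word. -/
def prependLetter (c : A) : WordPoly A →ₗ[ℂ] WordPoly A :=
  Finsupp.lmapDomain ℂ ℂ (c :: ·)

theorem prependLetter_single (c : A) (w : List A) (z : ℂ) :
    prependLetter c (Finsupp.single w z) = Finsupp.single (c :: w) z := by
  simp [prependLetter]

theorem prependLetter_apply_nil (c : A) (x : WordPoly A) : prependLetter c x [] = 0 :=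
  Finsupp.mapDomain_of_notMem_range _ _ (by simp)

theorem cancelLetter_prependLetter [DecidableEq A] (c a : A) (x : WordPoly A) :
    cancelLetter c (prependLetter a x) = if a = c then x else 0 := by
  ext w
  rw [cancelLetter_apply]
  split_ifs with h
  · exact h ▸ Finsupp.mapDomain_apply List.cons_injective x w
  · exact Finsupp.mapDomain_of_notMem_range _ _ (by simp [h])

theorem cancelLetter_single_cons [DecidableEq A] (c a : A) (w : List A) (z : ℂ) :
    cancelLetter c (Finsupp.single (a :: w) z) = if a = c then Finsupp.single w z else 0 := by
  rw [← prependLetter_single, cancelLetter_prependLetter]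

theorem cancelLetter_single_nil (c : A) (z : ℂ) :
    cancelLetter c (Finsupp.single [] z) = 0 := by
  ext w; simp

theorem bilin_ext {M : Type*} [AddCommMonoid M] [Module ℂ M]
    {P Q : WordPoly A →ₗ[ℂ] WordPoly A →ₗ[ℂ] M}
    (h : ∀ u w, P (.single u 1) (.single w 1) = Q (.single u 1) (.single w 1)) : P = Q := by
  ext u w : 4
  exact h u w

theorem shuffleMul_single (u w : List A) :
    (Finsupp.single u 1 : WordPoly A) ⧢ .single w 1 =
      ((shuffle u w).map fun s => Finsupp.single s (1 : ℂ)).sum := by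
  simp [shuffleMul]

theorem single_nil_shuffleMul (w : List A) :
    (Finsupp.single [] 1 : WordPoly A) ⧢ .single w 1 = .single w 1 := by
  simp [shuffleMul_single, shuffle]

theorem shuffleMul_single_nil (w : List A) :
    (Finsupp.single w 1 : WordPoly A) ⧢ .single [] 1 = .single w 1 := by
  cases w <;> simp [shuffleMul_single, shuffle]

theorem shuffleMul_single_cons (a b : A) (u w : List A) :
    (Finsupp.single (a :: u) 1 : WordPoly A) ⧢ .single (b :: w) 1 =
      prependLetter a (.single u 1 ⧢ .single (b :: w) 1) +
        prependLetter b (.single (a :: u) 1 ⧢ .single w 1) := by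
  simp only [shuffleMul_single, shuffle, Multiset.map_add, Multiset.sum_add, map_multiset_sum,
    Multiset.map_map, Function.comp_apply, prependLetter_single]

theorem shuffleMul_apply_nil (x y : WordPoly A) : (x ⧢ y) [] = x [] * y [] := by
  let ε : WordPoly A →ₗ[ℂ] ℂ := Finsupp.lapply []
  suffices h : shuffleMul.compr₂ ε = (LinearMap.mul ℂ ℂ).compl₁₂ ε ε from LinearMap.congr_fun₂ h x y
  refine bilin_ext fun u w => ?_
  rcases u with _ | ⟨a, u⟩ <;> rcases w with _ | ⟨b, w⟩ <;>
    simp [ε, single_nil_shuffleMul, shuffleMul_single_nil, shuffleMul_single_cons,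
      prependLetter_apply_nil]

theorem cancelLetter_shuffleMul (c : A) (x y : WordPoly A) :
    cancelLetter c (x ⧢ y) = cancelLetter c x ⧢ y + x ⧢ cancelLetter c y := by
  classical
  suffices h : shuffleMul.compr₂ (cancelLetter c) =
      shuffleMul ∘ₗ cancelLetter c + shuffleMul.compl₂ (cancelLetter c) from
    LinearMap.congr_fun₂ h x y
  refine bilin_ext fun u w => ?_
  simp only [LinearMap.compr₂_apply, LinearMap.add_apply, LinearMap.comp_apply,
    LinearMap.compl₂_apply]
  rcases u with _ | ⟨a, u⟩ <;> rcases w with _ | ⟨b, w⟩ <;>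
    simp only [shuffleMul_single_cons, single_nil_shuffleMul, shuffleMul_single_nil, map_add,
      cancelLetter_prependLetter, cancelLetter_single_nil, cancelLetter_single_cons] <;>
    (try split_ifs) <;> simp [single_nil_shuffleMul, shuffleMul_single_nil]

/-- The Leibniz rule for the letter cancellations. -/
def IsLeibniz (P : WordPoly A →ₗ[ℂ] WordPoly A →ₗ[ℂ] WordPoly A) : Prop :=
  ∀ c x y, cancelLetter c (P x y) = P (cancelLetter c x) y + P x (cancelLetter c y)

theorem IsLeibniz.eq {P Q : WordPoly A →ₗ[ℂ] WordPoly A →ₗ[ℂ] WordPoly A} (hP : IsLeibniz P)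
    (hQ : IsLeibniz Q) (h : ∀ u w, P (.single u 1) (.single w 1) [] =
      Q (.single u 1) (.single w 1) []) : P = Q := by
  have hε : P.compr₂ (Finsupp.lapply []) = Q.compr₂ (Finsupp.lapply []) := bilin_ext h
  refine LinearMap.ext₂ fun x y => Finsupp.ext fun w => ?_
  induction w generalizing x y with
  | nil => exact LinearMap.congr_fun₂ hε x y
  | cons c w ih =>
    rw [← cancelLetter_apply, ← cancelLetter_apply, hP, hQ, Finsupp.add_apply, ih, ih,
      ← Finsupp.add_apply]

end Shuffle

section Contraction

variable {A : Type*}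

attribute [local instance] coeffAlgebra

local notation:70 x:70 " ⧢ " y:71 => shuffleMul x y

/-- The contraction `w ↦ ∑_{w = w' w''} δ_{w''} w'` of the shuffle algebra by `δ`. It turns the
convolution product into the composition of operators; the elements of `𝒢` become algebra
homomorphisms and the elements of `𝔤` become derivations of the shuffle algebra. -/
def contraction (δ : Coeff A) : WordPoly A →ₗ[ℂ] WordPoly A :=
  Finsupp.linearCombination ℂ fun w =>
    ∑ j ∈ Finset.range (w.length + 1), Finsupp.single (w.take j) (δ (w.drop j))

/-- The pairing `⟨δ, w⟩ = δ_w` of families of coefficients with the shuffle algebra. -/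
def pairing (δ : Coeff A) : WordPoly A →ₗ[ℂ] ℂ := Finsupp.linearCombination ℂ δ

theorem pairing_single (δ : Coeff A) (w : List A) : pairing δ (.single w 1) = δ w :=
  (Finsupp.linearCombination_single ..).trans (one_smul ..)

theorem contraction_single (δ : Coeff A) (w : List A) :
    contraction δ (.single w 1) =
      ∑ j ∈ Finset.range (w.length + 1), Finsupp.single (w.take j) (δ (w.drop j)) := by
  simp [contraction]

theorem contraction_single_cons (δ : Coeff A) (a : A) (w : List A) :
    contraction δ (.single (a :: w) 1) =
      prependLetter a (contraction δ (.single w 1)) + .single [] (δ (a :: w)) := by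
  rw [contraction_single, contraction_single, List.length_cons, Finset.sum_range_succ', map_sum]
  simp [prependLetter_single]

theorem contraction_apply_nil (δ : Coeff A) (x : WordPoly A) :
    contraction δ x [] = pairing δ x := by
  suffices h : Finsupp.lapply [] ∘ₗ contraction δ = pairing δ from LinearMap.congr_fun h x
  ext w
  cases w with
  | nil => simp [contraction, pairing_single]
  | cons a w => simp [contraction_single_cons, prependLetter_apply_nil, pairing_single]

theorem cancelLetter_contraction (δ : Coeff A) (c : A) (x : WordPoly A) :
    cancelLetter c (contraction δ x) = contraction δ (cancelLetter c x) := by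
  classical
  suffices h : cancelLetter c ∘ₗ contraction δ = contraction δ ∘ₗ cancelLetter c from
    LinearMap.congr_fun h x
  ext w : 2
  cases w with
  | nil => simp [contraction_single, cancelLetter_single_nil]
  | cons a w =>
    simp only [LinearMap.comp_apply, Finsupp.lsingle_apply, contraction_single_cons, map_add,
      cancelLetter_prependLetter, cancelLetter_single_nil, cancelLetter_single_cons, add_zero]
    split_ifs <;> simp

theorem eq_contraction {T : WordPoly A →ₗ[ℂ] WordPoly A} {δ : Coeff A}
    (hT : ∀ c x, cancelLetter c (T x) = T (cancelLetter c x)) (h : ∀ w, T (.single w 1) [] = δ w) :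
    T = contraction δ := by
  have hε : Finsupp.lapply [] ∘ₗ T = pairing δ := by
    ext w
    simpa [pairing_single] using h w
  refine LinearMap.ext fun x => Finsupp.ext fun w => ?_
  induction w generalizing x with
  | nil => rw [contraction_apply_nil, ← hε]; rfl
  | cons c w ih => rw [← cancelLetter_apply, ← cancelLetter_apply, hT, ih, cancelLetter_contraction]

theorem contraction_injective : Function.Injective (contraction (A := A)) := fun δ δ' h => by
  ext w
  rw [← pairing_single δ, ← pairing_single δ', ← contraction_apply_nil, h, contraction_apply_nil]

theorem contraction_one : contraction (1 : Coeff A) = 1 :=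
  (eq_contraction (fun _ _ => rfl) fun w => by cases w <;> simp).symm

theorem contraction_mul (δ δ' : Coeff A) :
    contraction (δ * δ') = contraction δ * contraction δ' := by
  refine (eq_contraction (fun c x => ?_) fun w => ?_).symm
  · simp only [Module.End.mul_apply, cancelLetter_contraction]
  · rw [Module.End.mul_apply, contraction_single, map_sum, Finsupp.finsetSum_apply,
      Coeff.mul_apply]
    refine Finset.sum_congr rfl fun j _ => ?_
    rw [contraction_apply_nil, ← mul_one (δ' _), ← smul_eq_mul (δ' _), ← Finsupp.smul_single,
      map_smul, pairing_single, smul_eq_mul, smul_eq_mul, mul_one, mul_comm]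

theorem contraction_add (δ δ' : Coeff A) :
    contraction (δ + δ') = contraction δ + contraction δ' := by
  refine (eq_contraction (fun c x => ?_) fun w => ?_).symm
  · simp only [LinearMap.add_apply, map_add, cancelLetter_contraction]
  · simp only [LinearMap.add_apply, Finsupp.add_apply, contraction_apply_nil, pairing_single,
      Coeff.add_apply]

theorem contraction_smul (c : ℂ) (δ : Coeff A) : contraction (c • δ) = c • contraction δ := by
  refine (eq_contraction (fun c x => ?_) fun w => ?_).symm
  · simp only [LinearMap.smul_apply, map_smul, cancelLetter_contraction]
  · simp only [LinearMap.smul_apply, Finsupp.smul_apply, contraction_apply_nil, pairing_single,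
      Coeff.smul_apply, smul_eq_mul]

/-- The contractions, as an action of the convolution algebra on the shuffle algebra. -/
def contractionHom : Coeff A →ₐ[ℂ] Module.End ℂ (WordPoly A) :=
  AlgHom.ofLinearMap ⟨⟨contraction, contraction_add⟩, contraction_smul⟩ contraction_one
    contraction_mul

theorem contraction_pow (δ : Coeff A) (n : ℕ) : contraction (δ ^ n) = contraction δ ^ n :=
  map_pow contractionHom δ n

theorem pairing_shuffleMul_single (δ : Coeff A) (u w : List A) :
    pairing δ (.single u 1 ⧢ .single w 1) = ((shuffle u w).map fun s => δ s).sum := by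
  simp only [shuffleMul_single, map_multiset_sum, Multiset.map_map, Function.comp_apply,
    pairing_single]

theorem mem_groupG_iff {γ : Coeff A} : γ ∈ groupG A ↔ γ [] = 1 ∧
    ∀ x y, contraction γ (x ⧢ y) = contraction γ x ⧢ contraction γ y := by
  refine and_congr_right fun _ => ⟨fun h x y => ?_, fun h u w => ?_⟩
  · suffices shuffleMul.compr₂ (contraction γ) =
        shuffleMul.compl₁₂ (contraction γ) (contraction γ) from LinearMap.congr_fun₂ this x y
    refine IsLeibniz.eq (fun c x y => ?_) (fun c x y => ?_) fun u w => ?_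
    · simp only [LinearMap.compr₂_apply, cancelLetter_contraction, cancelLetter_shuffleMul, map_add]
    · simp only [LinearMap.compl₁₂_apply, cancelLetter_contraction, cancelLetter_shuffleMul]
    · simp only [LinearMap.compr₂_apply, LinearMap.compl₁₂_apply, contraction_apply_nil,
        shuffleMul_apply_nil, pairing_single, pairing_shuffleMul_single, h]
  · rw [← pairing_shuffleMul_single, ← contraction_apply_nil, h, shuffleMul_apply_nil,
      contraction_apply_nil, contraction_apply_nil, pairing_single, pairing_single]

theorem mem_lieG_iff {β : Coeff A} : β ∈ lieG A ↔
    ∀ x y, contraction β (x ⧢ y) = contraction β x ⧢ y + x ⧢ contraction β y := by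
  have hε (u w : List A) : (contraction β (.single u 1) ⧢ .single w 1 +
      .single u 1 ⧢ contraction β (.single w 1) : WordPoly A) [] =
        β u * Finsupp.single w 1 [] + Finsupp.single u 1 [] * β w := by
    simp only [Finsupp.add_apply, shuffleMul_apply_nil, contraction_apply_nil, pairing_single]
  constructor
  · rintro ⟨h0, h⟩ x y
    suffices shuffleMul.compr₂ (contraction β) = shuffleMul ∘ₗ contraction β +
        shuffleMul.compl₂ (contraction β) from LinearMap.congr_fun₂ this x y
    refine IsLeibniz.eq (fun c x y => ?_) (fun c x y => ?_) fun u w => ?_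
    · simp only [LinearMap.compr₂_apply, cancelLetter_contraction, cancelLetter_shuffleMul, map_add]
    · simp only [LinearMap.add_apply, LinearMap.comp_apply, LinearMap.compl₂_apply,
        cancelLetter_contraction, cancelLetter_shuffleMul, map_add]
      abel
    · refine Eq.trans ?_ (hε u w).symm
      rw [LinearMap.compr₂_apply, contraction_apply_nil]
      rcases u with _ | ⟨a, u⟩
      · simp [single_nil_shuffleMul, pairing_single, h0]
      rcases w with _ | ⟨b, w⟩
      · simp [shuffleMul_single_nil, pairing_single, h0]
      · simp [pairing_shuffleMul_single, h]
  · intro h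
    have key (u w : List A) : ((shuffle u w).map fun s => β s).sum =
        β u * Finsupp.single w 1 [] + Finsupp.single u 1 [] * β w := by
      rw [← hε, ← h, contraction_apply_nil, pairing_shuffleMul_single]
    refine ⟨?_, fun u w hu hw => ?_⟩
    · simpa [shuffle] using key [] []
    · simp [key, hu, hw]

end Contraction

section GroupAndLieAlgebra

variable {A : Type*} {d : ℕ} (ν : Fin d → A → ℂ)

local notation:70 x:70 " ⧢ " y:71 => shuffleMul x y

theorem one_mem_groupG : (1 : Coeff A) ∈ groupG A :=
  mem_groupG_iff.2 ⟨rfl, fun x y => by simp [contraction_one]⟩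

theorem mul_mem_groupG {γ γ' : Coeff A} (h : γ ∈ groupG A) (h' : γ' ∈ groupG A) :
    γ * γ' ∈ groupG A := by
  rw [mem_groupG_iff] at *
  exact ⟨by simp [h.1, h'.1], fun x y => by
    simp only [contraction_mul, Module.End.mul_apply, h.2, h'.2]⟩

theorem perm_of_mem_shuffle : ∀ {w w' s : List A}, s ∈ shuffle w w' → s.Perm (w ++ w')
  | [], w', s, h => by simp_all [shuffle]
  | a :: u, [], s, h => by simp_all [shuffle]
  | a :: u, b :: w, s, h => by
    simp only [shuffle, Multiset.mem_add, Multiset.mem_map] at h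
    rcases h with ⟨s, hs, rfl⟩ | ⟨s, hs, rfl⟩
    · exact (perm_of_mem_shuffle hs).cons a
    · exact ((perm_of_mem_shuffle hs).cons b).trans List.perm_middle.symm
  termination_by w w' => w.length + w'.length

theorem length_of_mem_shuffle {w w' s : List A} (h : s ∈ shuffle w w') :
    s.length = w.length + w'.length :=
  (perm_of_mem_shuffle h).length_eq.trans List.length_append

theorem perm_weight_mul_mem_lieG {c : List A → ℂ} (hc : ∀ {w w'}, w.Perm w' → c w = c w')
    {β : Coeff A} (hβ : β ∈ lieG A) : (fun w => c w * β w : Coeff A) ∈ lieG A := by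
  refine ⟨by simp [hβ.1], fun w w' hw hw' => ?_⟩
  calc ((shuffle w w').map fun s => c s * β s).sum
      = ((shuffle w w').map fun s => c (w ++ w') * β s).sum :=
        congrArg _ (Multiset.map_congr rfl fun s hs => congrArg (· * β s)
          (hc (perm_of_mem_shuffle hs)))
    _ = c (w ++ w') * ((shuffle w w').map fun s => β s).sum := Multiset.sum_map_mul_left
    _ = 0 := by rw [hβ.2 w w' hw hw', mul_zero]

theorem smul_mem_lieG {β : Coeff A} (c : ℂ) (hβ : β ∈ lieG A) : c • β ∈ lieG A :=
  perm_weight_mul_mem_lieG (c := fun _ => c) (fun _ => rfl) hβ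

theorem nuWord_append (v : Fin d → ℂ) (w w' : List A) :
    nuWord ν v (w ++ w') = nuWord ν v w + nuWord ν v w' := by
  simp [nuWord]

theorem nuWord_perm (v : Fin d → ℂ) {w w' : List A} (h : w.Perm w') :
    nuWord ν v w = nuWord ν v w' :=
  (h.map _).sum_eq

/-- The derivation `w ↦ ν^v_w w` of the shuffle algebra; by contraction, `ξ_v` becomes the
commutator with this operator. -/
def nuDerivation (v : Fin d → ℂ) : Module.End ℂ (WordPoly A) :=
  Finsupp.linearCombination ℂ fun w => Finsupp.single w (nuWord ν v w)

theorem nuDerivation_single (v : Fin d → ℂ) (w : List A) (z : ℂ) :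
    nuDerivation ν v (.single w z) = nuWord ν v w • .single w z := by
  simp [nuDerivation, mul_comm]

theorem contraction_xi (v : Fin d → ℂ) (δ : Coeff A) : contraction (xi ν v δ) =
    contraction δ * nuDerivation ν v - nuDerivation ν v * contraction δ := by
  refine Finsupp.lhom_ext' fun w => LinearMap.ext_ring ?_
  simp only [LinearMap.comp_apply, Finsupp.lsingle_apply, LinearMap.sub_apply,
    Module.End.mul_apply, nuDerivation_single, contraction_single, map_smul, map_sum,
    Finset.smul_sum, ← Finset.sum_sub_distrib, ← sub_smul]
  refine Finset.sum_congr rfl fun j _ => ?_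
  have h := nuWord_append ν v (w.take j) (w.drop j)
  rw [List.take_append_drop] at h
  rw [h, add_sub_cancel_left, Finsupp.smul_single, smul_eq_mul, xi]

theorem nuDerivation_shuffleMul (v : Fin d → ℂ) (x y : WordPoly A) :
    nuDerivation ν v (x ⧢ y) = nuDerivation ν v x ⧢ y + x ⧢ nuDerivation ν v y := by
  suffices shuffleMul.compr₂ (nuDerivation ν v) = shuffleMul ∘ₗ nuDerivation ν v +
      shuffleMul.compl₂ (nuDerivation ν v) from LinearMap.congr_fun₂ this x y
  refine bilin_ext fun u w => ?_
  simp only [LinearMap.compr₂_apply, LinearMap.add_apply, LinearMap.comp_apply,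
    LinearMap.compl₂_apply, nuDerivation_single, map_smul, LinearMap.smul_apply, ← add_smul,
    ← nuWord_append, shuffleMul_single, map_multiset_sum, Multiset.map_map, Function.comp_apply]
  rw [Multiset.smul_sum, Multiset.map_map]
  refine congrArg _ (Multiset.map_congr rfl fun s hs => ?_)
  rw [nuWord_perm ν v (perm_of_mem_shuffle hs), Function.comp_apply]

/-- The gauge transform `κ ⋆ β ⋆ κ⁻¹ - (ξ_v κ) ⋆ κ⁻¹` of `β` by `κ`. -/
def gaugeAction (v : Fin d → ℂ) (κ : (Coeff A)ˣ) (β : Coeff A) : Coeff A :=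
  κ * β * (κ⁻¹ : (Coeff A)ˣ) - xi ν v κ * (κ⁻¹ : (Coeff A)ˣ)

theorem gaugeAction_mul_self (v : Fin d → ℂ) (κ : (Coeff A)ˣ) (β : Coeff A) :
    gaugeAction ν v κ β * κ = κ * β - xi ν v κ := by
  simp [gaugeAction, sub_mul, mul_assoc]

theorem gaugeAction_mem_lieG (v : Fin d → ℂ) {κ : (Coeff A)ˣ} {β : Coeff A}
    (hκ : (κ : Coeff A) ∈ groupG A) (hβ : β ∈ lieG A) : gaugeAction ν v κ β ∈ lieG A := by
  rw [mem_groupG_iff] at hκ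
  rw [mem_lieG_iff] at *
  set C := contraction (κ : Coeff A)
  set C' := contraction ((κ⁻¹ : (Coeff A)ˣ) : Coeff A)
  have hCC' (x) : C (C' x) = x := by
    rw [← Module.End.mul_apply, ← contraction_mul, κ.mul_inv, contraction_one, Module.End.one_apply]
  have hgauge (x) : contraction (gaugeAction ν v κ β) (C x) =
      C (contraction β x - nuDerivation ν v x) + nuDerivation ν v (C x) := by
    have h := LinearMap.congr_fun (congrArg contractionHom (gaugeAction_mul_self ν v κ β)) x
    rw [map_sub, map_mul, map_mul] at h
    refine h.trans ?_
    change C (contraction β x) - contraction (xi ν v κ) x = _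
    rw [contraction_xi, map_sub, LinearMap.sub_apply, Module.End.mul_apply, Module.End.mul_apply]
    abel
  intro x y
  rw [← hCC' x, ← hCC' y, ← hκ.2, hgauge]
  simp only [hgauge, hβ, hκ.2, map_sub, map_add, nuDerivation_shuffleMul, LinearMap.add_apply,
    LinearMap.sub_apply]
  abel

end GroupAndLieAlgebra

section DividedPowers

variable {K : Type*} [CommRing K] {M N P : Type*} [AddCommGroup M] [Module K M]
  [AddCommGroup N] [Module K N] [AddCommGroup P] [Module K P]

theorem pow_bilin_eq_sum {μ : M →ₗ[K] N →ₗ[K] P} {D : Module.End K M} {D' : Module.End K N}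
    {E : Module.End K P} (h : ∀ x y, E (μ x y) = μ (D x) y + μ x (D' y)) (n : ℕ) (x : M) (y : N) :
    (E ^ n) (μ x y) = ∑ kl ∈ antidiagonal n,
      n.choose kl.1 • μ ((D ^ kl.1) x) ((D' ^ kl.2) y) := by
  induction n with
  | zero => simp
  | succ n ih =>
    rw [Finset.sum_antidiagonal_choose_succ_nsmul fun k l => μ ((D ^ k) x) ((D' ^ l) y),
      pow_succ', Module.End.mul_apply, ih, map_sum, ← Finset.sum_add_distrib]
    refine Finset.sum_congr rfl fun kl hkl => ?_
    rw [Nat.choose_symm_of_eq_add (mem_antidiagonal.1 hkl).symm, map_nsmul, h, smul_add,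
      add_comm, pow_succ', pow_succ', Module.End.mul_apply, Module.End.mul_apply]

variable [Algebra ℂ K]

/-- The divided power `Dⁿ / n!` of a linear operator. -/
def divPow (D : Module.End K M) (n : ℕ) : Module.End K M :=
  algebraMap ℂ K (n.factorial : ℂ)⁻¹ • D ^ n

theorem divPow_bilin_eq_sum {μ : M →ₗ[K] N →ₗ[K] P} {D : Module.End K M} {D' : Module.End K N}
    {E : Module.End K P} (h : ∀ x y, E (μ x y) = μ (D x) y + μ x (D' y)) (n : ℕ) (x : M) (y : N) :
    divPow E n (μ x y) = ∑ kl ∈ antidiagonal n, μ (divPow D kl.1 x) (divPow D' kl.2 y) := by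
  simp only [divPow, LinearMap.smul_apply, pow_bilin_eq_sum h, Finset.smul_sum, map_smul]
  refine Finset.sum_congr rfl fun kl hkl => ?_
  obtain rfl := mem_antidiagonal.1 hkl
  rw [← Nat.cast_smul_eq_nsmul K, ← map_natCast (algebraMap ℂ K), Nat.cast_add_choose, smul_smul,
    smul_smul, ← map_mul, ← map_mul]
  congr 2
  have := Nat.factorial_ne_zero (kl.1 + kl.2)
  field_simp

end DividedPowers

section Exponential

variable {A : Type*}

attribute [local instance] coeffAlgebra

/-- The families that vanish on the words of length less than `n`. These subspaces form the
decreasing filtration for which the convolution product and the limits below are continuous. -/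
def supportedFrom (A : Type*) (n : ℕ) : Submodule ℂ (Coeff A) where
  carrier := {δ | ∀ w : List A, w.length < n → δ w = 0}
  add_mem' h h' w hw := by rw [Coeff.add_apply, h w hw, h' w hw, add_zero]
  zero_mem' _ _ := rfl
  smul_mem' c δ h w hw := by rw [Coeff.smul_apply, h w hw, mul_zero]

theorem supportedFrom_anti {m n : ℕ} (h : m ≤ n) : supportedFrom A n ≤ supportedFrom A m :=
  fun _ hδ w hw => hδ w (hw.trans_le h)

theorem mem_supportedFrom_zero (δ : Coeff A) : δ ∈ supportedFrom A 0 :=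
  fun _ hw => absurd hw (Nat.not_lt_zero _)

theorem mem_supportedFrom_one {δ : Coeff A} : δ ∈ supportedFrom A 1 ↔ δ [] = 0 :=
  ⟨fun h => h [] Nat.zero_lt_one, fun h w hw => by
    rwa [List.length_eq_zero_iff.1 (Nat.lt_one_iff.1 hw)]⟩

theorem mul_mem_supportedFrom {m n : ℕ} {δ δ' : Coeff A} (h : δ ∈ supportedFrom A m)
    (h' : δ' ∈ supportedFrom A n) : δ * δ' ∈ supportedFrom A (m + n) := fun w hw => by
  rw [Coeff.mul_apply]
  refine Finset.sum_eq_zero fun j _ => ?_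
  rcases lt_or_ge (w.take j).length m with hj | hj
  · rw [h _ hj, zero_mul]
  · rw [h' _ (by simp only [List.length_drop, List.length_take] at *; omega), mul_zero]

theorem mul_mem_supportedFrom_left {n : ℕ} {δ : Coeff A} (δ' : Coeff A)
    (h : δ ∈ supportedFrom A n) : δ * δ' ∈ supportedFrom A n :=
  mul_mem_supportedFrom h (mem_supportedFrom_zero δ')

theorem mul_mem_supportedFrom_right {n : ℕ} (δ : Coeff A) {δ' : Coeff A}
    (h : δ' ∈ supportedFrom A n) : δ * δ' ∈ supportedFrom A n :=
  zero_add n ▸ mul_mem_supportedFrom (mem_supportedFrom_zero δ) h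

theorem pow_mem_supportedFrom {δ : Coeff A} (h : δ [] = 0) (n : ℕ) : δ ^ n ∈ supportedFrom A n := by
  induction n with
  | zero => exact mem_supportedFrom_zero _
  | succ n ih => exact mul_mem_supportedFrom ih (mem_supportedFrom_one.2 h)

theorem apply_eq_of_sub_mem {n : ℕ} {δ δ' : Coeff A} (h : δ - δ' ∈ supportedFrom A n)
    {w : List A} (hw : w.length < n) : δ w = δ' w :=
  sub_eq_zero.1 (h w hw)

theorem eq_of_forall_sub_mem {δ δ' : Coeff A} (h : ∀ n, δ - δ' ∈ supportedFrom A n) : δ = δ' :=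
  Coeff.ext fun w => apply_eq_of_sub_mem (h _) w.length.lt_succ_self

theorem Coeff.sum_apply {ι : Type*} (s : Finset ι) (F : ι → Coeff A) (w : List A) :
    (∑ i ∈ s, F i) w = ∑ i ∈ s, F i w :=
  map_sum (⟨⟨fun δ => δ w, rfl⟩, fun _ _ => rfl⟩ : Coeff A →+ ℂ) F s

open scoped PowerSeries

theorem X_pow_dvd_sub_trunc (n : ℕ) (P : ℂ⟦X⟧) : PowerSeries.X ^ n ∣ P - (P.trunc n : ℂ⟦X⟧) :=
  PowerSeries.X_pow_dvd_iff.2 fun k hk => by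
    rw [map_sub, Polynomial.coeff_coe, PowerSeries.coeff_trunc, if_pos hk, sub_self]

theorem aeval_mem_supportedFrom {β : Coeff A} (hβ : β [] = 0) {n : ℕ} {p : Polynomial ℂ}
    (hp : (PowerSeries.X : ℂ⟦X⟧) ^ n ∣ p) : Polynomial.aeval β p ∈ supportedFrom A n := by
  obtain ⟨q, rfl⟩ : Polynomial.X ^ n ∣ p := Polynomial.X_pow_dvd_iff.2 fun k hk => by
    simpa using PowerSeries.X_pow_dvd_iff.1 hp k hk
  rw [map_mul, map_pow, Polynomial.aeval_X]
  exact mul_mem_supportedFrom_left _ (pow_mem_supportedFrom hβ n)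

/-- The value `∑ cₙ βⁿ` of the power series `∑ cₙ Xⁿ` at a family with `β_∅ = 0`. On a word of
length `n` the powers beyond `n` vanish, so that the series may be truncated. -/
def seriesEval (β : Coeff A) (P : ℂ⟦X⟧) : Coeff A :=
  fun w => Polynomial.aeval β (P.trunc (w.length + 1)) w

theorem seriesEval_apply (β : Coeff A) (P : ℂ⟦X⟧) (w : List A) :
    seriesEval β P w = ∑ n ∈ Finset.range (w.length + 1), P.coeff n * (β ^ n) w := by
  rw [seriesEval, Polynomial.aeval_def, PowerSeries.eval₂_trunc_eq_sum_range, Coeff.sum_apply]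
  simp only [← Algebra.smul_def, Coeff.smul_apply]

theorem seriesEval_sub_aeval_mem {β : Coeff A} (hβ : β [] = 0) {n : ℕ} {P : ℂ⟦X⟧}
    {p : Polynomial ℂ} (h : PowerSeries.X ^ n ∣ P - (p : ℂ⟦X⟧)) :
    seriesEval β P - Polynomial.aeval β p ∈ supportedFrom A n := fun w hw => by
  refine (congrFun (map_sub (Polynomial.aeval β) (P.trunc (w.length + 1)) p).symm w).trans
    (aeval_mem_supportedFrom hβ (n := w.length + 1) ?_ w w.length.lt_succ_self)
  have h' := dvd_sub ((pow_dvd_pow _ hw).trans h) (X_pow_dvd_sub_trunc (w.length + 1) P)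
  rwa [sub_sub_sub_cancel_left, ← Polynomial.coe_sub] at h'

theorem seriesEval_coe {β : Coeff A} (hβ : β [] = 0) (p : Polynomial ℂ) :
    seriesEval β p = Polynomial.aeval β p :=
  eq_of_forall_sub_mem fun n => seriesEval_sub_aeval_mem hβ (by simp)

theorem seriesEval_mul {β : Coeff A} (hβ : β [] = 0) (P Q : ℂ⟦X⟧) :
    seriesEval β (P * Q) = seriesEval β P * seriesEval β Q := by
  refine eq_of_forall_sub_mem fun n => ?_
  set p := P.trunc n
  set q := Q.trunc n
  have hPQ : PowerSeries.X ^ n ∣ P * Q - ((p * q : Polynomial ℂ) : ℂ⟦X⟧) := by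
    rw [show P * Q - ((p * q : Polynomial ℂ) : ℂ⟦X⟧) =
      (P - (p : ℂ⟦X⟧)) * Q + (p : ℂ⟦X⟧) * (Q - (q : ℂ⟦X⟧)) by
      rw [Polynomial.coe_mul]; ring]
    exact dvd_add ((X_pow_dvd_sub_trunc n P).mul_right _) ((X_pow_dvd_sub_trunc n Q).mul_left _)
  have h := sub_mem (seriesEval_sub_aeval_mem hβ hPQ) (add_mem
    (mul_mem_supportedFrom_left (seriesEval β Q)
      (seriesEval_sub_aeval_mem hβ (X_pow_dvd_sub_trunc n P)))
    (mul_mem_supportedFrom_right (Polynomial.aeval β p)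
      (seriesEval_sub_aeval_mem hβ (X_pow_dvd_sub_trunc n Q))))
  convert! h using 1
  rw [map_mul]
  noncomm_ring

theorem isUnit_of_apply_nil_eq_one {δ : Coeff A} (h : δ [] = 1) : IsUnit δ := by
  have hδ : (δ - 1) [] = 0 := by simp [h]
  have h1 : (1 + PowerSeries.X : ℂ⟦X⟧) * (1 + PowerSeries.X)⁻¹ = 1 :=
    PowerSeries.mul_inv_cancel _ (by simp)
  have e1 : seriesEval (δ - 1) 1 = 1 := by simpa using seriesEval_coe hδ 1
  have eδ : seriesEval (δ - 1) (1 + PowerSeries.X) = δ := by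
    have h := seriesEval_coe hδ (1 + Polynomial.X)
    rwa [Polynomial.coe_add, Polynomial.coe_one, Polynomial.coe_X, map_add, map_one,
      Polynomial.aeval_X, add_sub_cancel] at h
  have hr := seriesEval_mul hδ (1 + PowerSeries.X) (1 + PowerSeries.X)⁻¹
  have hl := seriesEval_mul hδ (1 + PowerSeries.X)⁻¹ (1 + PowerSeries.X)
  rw [h1, e1, eδ] at hr
  rw [mul_comm, h1, e1, eδ] at hl
  exact ⟨⟨δ, _, hr.symm, hl.symm⟩, rfl⟩

theorem expStar_smul_eq_seriesEval {β : Coeff A} (hβ : β [] = 0) (c : ℂ) :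
    expStar (c • β) = seriesEval β (PowerSeries.rescale c (PowerSeries.exp ℂ)) := by
  ext w
  rw [seriesEval_apply, expStar, tsum_eq_sum (s := Finset.range (w.length + 1))]
  · refine Finset.sum_congr rfl fun n _ => ?_
    rw [smul_pow, Coeff.smul_apply]
    simp
    ring
  · intro n hn
    rw [pow_mem_supportedFrom (by simp [hβ]) n w (by simpa using hn), mul_zero]

theorem expStar_apply_nil {β : Coeff A} (hβ : β [] = 0) : expStar β [] = 1 := by
  rw [← one_smul ℂ β, expStar_smul_eq_seriesEval hβ, seriesEval_apply]
  simp

theorem expStar_zero : expStar (0 : Coeff A) = 1 := by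
  have h := expStar_smul_eq_seriesEval (β := (0 : Coeff A)) rfl 0
  simpa using h.trans (by simpa using seriesEval_coe (β := (0 : Coeff A)) rfl 1)

theorem expStar_neg_smul_mul {β : Coeff A} (hβ : β [] = 0) (c : ℂ) :
    expStar (-c • β) * expStar (c • β) = 1 := by
  rw [expStar_smul_eq_seriesEval hβ, expStar_smul_eq_seriesEval hβ, ← seriesEval_mul hβ,
    PowerSeries.exp_mul_exp_eq_exp_add, neg_add_cancel]
  simpa using seriesEval_coe hβ 1

theorem commute_expStar_smul {β : Coeff A} (hβ : β [] = 0) (c : ℂ) :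
    Commute β (expStar (c • β)) := by
  have hX : seriesEval β PowerSeries.X = β := by simpa using seriesEval_coe hβ Polynomial.X
  rw [expStar_smul_eq_seriesEval hβ, commute_iff_eq]
  nth_rewrite 1 4 [← hX]
  rw [← seriesEval_mul hβ, ← seriesEval_mul hβ, mul_comm]

theorem hasDerivAt_expStar_smul {β : Coeff A} (hβ : β [] = 0) (w : List A) (t : ℂ) :
    HasDerivAt (fun s : ℂ => expStar (s • β) w) ((β * expStar (t • β)) w) t := by
  have hX : seriesEval β PowerSeries.X = β := by simpa using seriesEval_coe hβ Polynomial.X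
  nth_rewrite 2 [← hX]
  simp only [expStar_smul_eq_seriesEval hβ, ← seriesEval_mul hβ, seriesEval_apply]
  refine HasDerivAt.fun_sum fun n _ => HasDerivAt.mul_const ?_ _
  cases n with
  | zero => simpa using hasDerivAt_const t (1 : ℂ)
  | succ n =>
    simp only [PowerSeries.coeff_succ_X_mul, PowerSeries.coeff_rescale, PowerSeries.coeff_exp]
    convert! (hasDerivAt_pow (n + 1) t).mul_const _ using 1
    simp [Nat.factorial_succ]
    field_simp

end Exponential

section GroupAndExponential

variable {A : Type*}

theorem hasSum_pairing_expStar {β : Coeff A} (hβ : β [] = 0) (x : WordPoly A) :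
    HasSum (fun n => divPow (contraction β) n x []) (pairing (expStar β) x) := by
  have hpow (n : ℕ) : divPow (contraction β) n x [] = (n.factorial : ℂ)⁻¹ * pairing (β ^ n) x := by
    rw [← contraction_apply_nil, contraction_pow, divPow, LinearMap.smul_apply,
      Finsupp.smul_apply, smul_eq_mul, Algebra.algebraMap_self, RingHom.id_apply]
  simp only [hpow]
  clear hpow
  induction x using Finsupp.induction_linear with
  | zero => simp
  | add x y hx hy => simpa only [map_add, mul_add] using hx.add hy
  | single w z =>
    have hw (δ : Coeff A) : pairing δ (.single w z) = z * δ w := Finsupp.linearCombination_single ..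
    simp only [hw, mul_left_comm _ z]
    refine (Summable.hasSum (summable_of_ne_finset_zero (s := Finset.range (w.length + 1))
      fun n hn => ?_)).mul_left z
    rw [pow_mem_supportedFrom hβ n w (by simpa using hn), mul_zero]

theorem expStar_mem_groupG {β : Coeff A} (hβ : β ∈ lieG A) : expStar β ∈ groupG A := by
  have hsum := hasSum_pairing_expStar hβ.1
  refine ⟨expStar_apply_nil hβ.1, fun w w' => ?_⟩
  rw [← pairing_shuffleMul_single, ← pairing_single (expStar β), ← pairing_single (expStar β),
    ← (hsum _).tsum_eq, ← (hsum _).tsum_eq, ← (hsum _).tsum_eq,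
    tsum_mul_tsum_eq_tsum_sum_antidiagonal_of_summable_norm (hsum _).summable.norm
      (hsum _).summable.norm]
  refine tsum_congr fun n => ?_
  rw [divPow_bilin_eq_sum (mem_lieG_iff.1 hβ), Finsupp.finsetSum_apply]
  exact Finset.sum_congr rfl fun kl _ => (shuffleMul_apply_nil _ _).symm

end GroupAndExponential

section Gauge

variable {A : Type*} {d : ℕ} (ν : Fin d → A → ℂ) (v : Fin d → ℂ)

theorem xi_sub (δ δ' : Coeff A) : xi ν v (δ - δ') = xi ν v δ - xi ν v δ' :=
  Coeff.ext fun _ => mul_sub ..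

theorem xi_mul (δ δ' : Coeff A) : xi ν v (δ * δ') = xi ν v δ * δ' + δ * xi ν v δ' := by
  apply contraction_injective
  refine LinearMap.ext fun x => ?_
  simp only [contraction_xi, contraction_mul, contraction_add, LinearMap.add_apply,
    LinearMap.sub_apply, Module.End.mul_apply, map_sub]
  abel

theorem xi_eq_zero_iff_commute {δ : Coeff A} :
    xi ν v δ = 0 ↔ Commute (contraction δ) (nuDerivation ν v) := by
  rw [commute_iff_eq, ← sub_eq_zero (a := contraction δ * _), ← contraction_xi]
  exact (map_eq_zero_iff contractionHom contraction_injective).symm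

theorem xi_one : xi ν v (1 : Coeff A) = 0 :=
  (xi_eq_zero_iff_commute ν v).2 (contraction_one (A := A) ▸ Commute.one_left _)

variable {ν v} in
theorem xi_pow_eq_zero {β : Coeff A} (h : xi ν v β = 0) (n : ℕ) : xi ν v (β ^ n) = 0 :=
  (xi_eq_zero_iff_commute ν v).2 <| contraction_pow β n ▸
    ((xi_eq_zero_iff_commute ν v).1 h).pow_left n

variable {ν v} in
theorem xi_expStar_eq_zero {β : Coeff A} (h : xi ν v β = 0) : xi ν v (expStar β) = 0 := by
  ext w
  refine tsum_mul_left.symm.trans ((tsum_congr fun n => ?_).trans tsum_zero)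
  rw [mul_left_comm]
  exact mul_eq_zero_of_right _ (congrFun (xi_pow_eq_zero h n) w)

theorem xi_mem_supportedFrom {n : ℕ} {δ : Coeff A} (h : δ ∈ supportedFrom A n) :
    xi ν v δ ∈ supportedFrom A n := fun w hw => mul_eq_zero_of_right _ (h w hw)

theorem gaugeAction_mul (e κ : (Coeff A)ˣ) (β : Coeff A) :
    gaugeAction ν v (e * κ) β = gaugeAction ν v e (gaugeAction ν v κ β) := by
  refine (e * κ).isUnit.mul_right_cancel ?_
  rw [gaugeAction_mul_self, Units.val_mul, ← mul_assoc, gaugeAction_mul_self, xi_mul, sub_mul,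
    mul_assoc (e : Coeff A) (gaugeAction ν v κ β), gaugeAction_mul_self]
  noncomm_ring

theorem gaugeAction_sub_mem {n : ℕ} {κ κ' : (Coeff A)ˣ} (β : Coeff A)
    (h : (κ - κ' : Coeff A) ∈ supportedFrom A n) :
    gaugeAction ν v κ β - gaugeAction ν v κ' β ∈ supportedFrom A n := by
  have key : (gaugeAction ν v κ β - gaugeAction ν v κ' β) * κ' =
      (κ - κ' : Coeff A) * β - xi ν v (κ - κ' : Coeff A) - gaugeAction ν v κ β * (κ - κ') := by
    rw [sub_mul, gaugeAction_mul_self, mul_sub, gaugeAction_mul_self, xi_sub]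
    noncomm_ring
  rw [← Units.mul_inv_cancel_right (gaugeAction ν v κ β - gaugeAction ν v κ' β) κ', key]
  exact mul_mem_supportedFrom_left _ (sub_mem (sub_mem (mul_mem_supportedFrom_left _ h)
    (xi_mem_supportedFrom ν v h)) (mul_mem_supportedFrom_right _ h))

theorem expStar_sub_one_sub_mem {n : ℕ} (hn : n ≠ 0) {η : Coeff A} (h : η ∈ supportedFrom A n) :
    expStar η - 1 - η ∈ supportedFrom A (n + 1) := by
  have hsq (k : ℕ) : η ^ (k + 2) ∈ supportedFrom A (n + 1) := by
    rw [pow_add, pow_two]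
    exact mul_mem_supportedFrom_right _
      (supportedFrom_anti (by omega) (mul_mem_supportedFrom h h))
  intro w hw
  have hexp : expStar η w = (1 : Coeff A) w + η w := by
    rw [expStar, tsum_eq_sum (s := Finset.range 2)]
    · simp [Finset.sum_range_succ]
    · intro k hk
      obtain ⟨k, rfl⟩ := Nat.exists_eq_add_of_le' (not_lt.1 (Finset.mem_range.not.1 hk))
      rw [hsq k w hw, mul_zero]
  simp [hexp]

theorem exists_gauge_step {n : ℕ} (hn : n ≠ 0) {β : Coeff A} (hβ : β ∈ lieG A)
    (h : xi ν v β ∈ supportedFrom A n) :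
    ∃ e : (Coeff A)ˣ, (e : Coeff A) ∈ groupG A ∧ (e - 1 : Coeff A) ∈ supportedFrom A n ∧
      xi ν v (gaugeAction ν v e β) ∈ supportedFrom A (n + 1) := by
  let c (w : List A) : ℂ := if w.length = n then (nuWord ν v w)⁻¹ else 0
  let η : Coeff A := fun w => c w * β w
  have hη : η ∈ lieG A := perm_weight_mul_mem_lieG
    (fun h => by simp only [c, h.length_eq, nuWord_perm ν v h]) hβ
  have hηn : η ∈ supportedFrom A n := fun w hw => by simp only [η, c, if_neg hw.ne, zero_mul]
  obtain ⟨e, he⟩ := isUnit_of_apply_nil_eq_one (expStar_apply_nil hη.1)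
  have heη : (e - 1 - η : Coeff A) ∈ supportedFrom A (n + 1) :=
    he ▸ expStar_sub_one_sub_mem hn hηn
  have heG : (e : Coeff A) ∈ groupG A := he ▸ expStar_mem_groupG hη
  have he1 : (e - 1 : Coeff A) ∈ supportedFrom A n := by
    simpa using add_mem (supportedFrom_anti n.le_succ heη) hηn
  refine ⟨e, heG, he1, ?_⟩
  have hgauge : gaugeAction ν v e β - (β - xi ν v η) ∈ supportedFrom A (n + 1) := by
    have hG := mem_supportedFrom_one.2 (gaugeAction_mem_lieG ν v heG hβ).1
    have key : gaugeAction ν v e β - (β - xi ν v η) =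
        (e - 1) * β - xi ν v (e - 1 - η) - gaugeAction ν v e β * (e - 1) := by
      rw [mul_sub, gaugeAction_mul_self, xi_sub, xi_sub, xi_one]
      noncomm_ring
    rw [key]
    exact sub_mem (sub_mem (mul_mem_supportedFrom he1 (mem_supportedFrom_one.2 hβ.1))
      (xi_mem_supportedFrom ν v heη)) (add_comm 1 n ▸ mul_mem_supportedFrom hG he1)
  have hres : xi ν v (β - xi ν v η) ∈ supportedFrom A (n + 1) := fun w hw => by
    change nuWord ν v w * (β w - nuWord ν v w * (c w * β w)) = 0
    rcases (Nat.lt_succ_iff.1 hw).lt_or_eq with hlt | heq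
    · have hw0 : nuWord ν v w * β w = 0 := h w hlt
      simp [c, hlt.ne, hw0]
    · rcases eq_or_ne (nuWord ν v w) 0 with h0 | h0
      · simp [h0]
      · simp [c, heq, h0]
  simpa [xi_sub] using add_mem (xi_mem_supportedFrom ν v hgauge) hres

theorem mem_groupG_of_forall_sub_mem {κ : Coeff A}
    (h : ∀ n, ∃ γ ∈ groupG A, κ - γ ∈ supportedFrom A n) : κ ∈ groupG A := by
  refine ⟨?_, fun w w' => ?_⟩
  · obtain ⟨γ, hγ, hκγ⟩ := h 1
    rw [apply_eq_of_sub_mem hκγ (w := []) Nat.zero_lt_one, hγ.1]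
  · obtain ⟨γ, hγ, hκγ⟩ := h (w.length + w'.length + 1)
    rw [apply_eq_of_sub_mem hκγ (by omega), apply_eq_of_sub_mem hκγ (by omega), hγ.2]
    refine congrArg Multiset.sum (Multiset.map_congr rfl fun s hs => ?_)
    rw [apply_eq_of_sub_mem hκγ (by rw [length_of_mem_shuffle hs]; omega)]

theorem exists_limit_of_sub_mem {K : ℕ → Coeff A}
    (h : ∀ n, K (n + 1) - K n ∈ supportedFrom A (n + 1)) :
    ∃ κ : Coeff A, ∀ n, κ - K n ∈ supportedFrom A (n + 1) := by
  have hK (n k : ℕ) : K (n + k) - K n ∈ supportedFrom A (n + 1) := by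
    induction k with
    | zero => simp
    | succ k ih =>
      simpa [add_assoc] using add_mem (supportedFrom_anti (by omega) (h (n + k))) ih
  refine ⟨fun w => K w.length w, fun n w hw => ?_⟩
  obtain ⟨k, rfl⟩ := Nat.exists_eq_add_of_le (Nat.lt_succ_iff.1 hw)
  exact sub_eq_zero.2 (apply_eq_of_sub_mem (hK w.length k) w.length.lt_succ_self).symm

theorem exists_gauge {β : Coeff A} (hβ : β ∈ lieG A) :
    ∃ κ : (Coeff A)ˣ, (κ : Coeff A) ∈ groupG A ∧ xi ν v (gaugeAction ν v κ β) = 0 := by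
  let P (n : ℕ) (κ : (Coeff A)ˣ) : Prop :=
    (κ : Coeff A) ∈ groupG A ∧ xi ν v (gaugeAction ν v κ β) ∈ supportedFrom A (n + 1)
  have step (n : ℕ) (κ : (Coeff A)ˣ) (h : P n κ) :
      ∃ κ' : (Coeff A)ˣ, P (n + 1) κ' ∧ (κ' - κ : Coeff A) ∈ supportedFrom A (n + 1) := by
    obtain ⟨e, he, he1, he2⟩ :=
      exists_gauge_step ν v n.succ_ne_zero (gaugeAction_mem_lieG ν v h.1 hβ) h.2
    refine ⟨e * κ, ⟨mul_mem_groupG he h.1, by rwa [gaugeAction_mul]⟩, ?_⟩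
    simpa [sub_mul] using mul_mem_supportedFrom_left (κ : Coeff A) he1
  choose! F hPF hF using step
  let K (n : ℕ) : (Coeff A)ˣ := Nat.rec (motive := fun _ => (Coeff A)ˣ) 1 F n
  have hK (n : ℕ) : P n (K n) := by
    induction n with
    | zero => exact ⟨one_mem_groupG, mem_supportedFrom_one.2 (zero_mul _)⟩
    | succ n ih => exact hPF n (K n) ih
  have hKF (n : ℕ) : ((K (n + 1) : (Coeff A)ˣ) : Coeff A) - (K n : Coeff A) ∈
      supportedFrom A (n + 1) := hF n (K n) (hK n)
  obtain ⟨κ, hκ⟩ := exists_limit_of_sub_mem (K := fun n => (K n : Coeff A)) hKF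
  have hκG : κ ∈ groupG A := mem_groupG_of_forall_sub_mem fun n =>
    ⟨K n, (hK n).1, supportedFrom_anti n.le_succ (hκ n)⟩
  obtain ⟨κ, rfl⟩ := isUnit_of_apply_nil_eq_one hκG.1
  refine ⟨κ, hκG, eq_of_forall_sub_mem fun n => ?_⟩
  have h := add_mem (xi_mem_supportedFrom ν v (gaugeAction_sub_mem ν v β (hκ n))) (hK n).2
  rw [xi_sub, sub_add_cancel] at h
  simpa using supportedFrom_anti n.le_succ h

theorem inv_mem_groupG {κ : (Coeff A)ˣ} (h : (κ : Coeff A) ∈ groupG A) :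
    ((κ⁻¹ : (Coeff A)ˣ) : Coeff A) ∈ groupG A := by
  rw [mem_groupG_iff] at *
  have hl (x) : contraction ((κ⁻¹ : (Coeff A)ˣ) : Coeff A) (contraction (κ : Coeff A) x) = x := by
    rw [← Module.End.mul_apply, ← contraction_mul, κ.inv_mul, contraction_one, Module.End.one_apply]
  have hr (x) : contraction (κ : Coeff A) (contraction ((κ⁻¹ : (Coeff A)ˣ) : Coeff A) x) = x := by
    rw [← Module.End.mul_apply, ← contraction_mul, κ.mul_inv, contraction_one, Module.End.one_apply]
  refine ⟨?_, fun x y => ?_⟩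
  · have h0 := congrFun κ.inv_mul []
    rwa [Coeff.mul_nil, h.1, mul_one] at h0
  · rw [← hl (shuffleMul (contraction _ x) (contraction _ y)), h.2, hr, hr]

end Gauge

section SmoothSeries

variable {A : Type*} {D : ℕ}

/-- The algebra of the formal series `∑_m ε^m Φ_m` of smooth functions `Φ_m` on `ℂ^D`, over the
ring of the formal series with constant coefficients. -/
def smoothSeries (A : Type*) (D : ℕ) :
    Subalgebra (MvPowerSeries A ℂ) ((Fin D → ℂ) → MvPowerSeries A ℂ) where
  carrier := {Φ | ∀ m, ContDiff ℂ (⊤ : ℕ∞) fun x => (Φ x).coeff m}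
  mul_mem' hΦ hΨ m := by
    classical
    simp only [Pi.mul_apply, MvPowerSeries.coeff_mul]
    exact ContDiff.sum fun ab _ => (hΦ ab.1).mul (hΨ ab.2)
  add_mem' hΦ hΨ m := (hΦ m).add (hΨ m)
  algebraMap_mem' _ _ := contDiff_const

/-- The value at a point of `ℂ^D`. -/
def evalAt (x : Fin D → ℂ) : smoothSeries A D →ₐ[MvPowerSeries A ℂ] MvPowerSeries A ℂ :=
  (Pi.evalAlgHom _ _ x).comp (smoothSeries A D).val

theorem contDiff_coeff_evalAt (Φ : smoothSeries A D) (m : A →₀ ℕ) :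
    ContDiff ℂ (⊤ : ℕ∞) fun x => (evalAt x Φ).coeff m := Φ.2 m

theorem differentiableAt_coeff_evalAt (Φ : smoothSeries A D) (m : A →₀ ℕ) (x : Fin D → ℂ) :
    DifferentiableAt ℂ (fun x => (evalAt x Φ).coeff m) x :=
  (contDiff_coeff_evalAt Φ m).differentiable (by simp) x

theorem smoothSeries_ext {Φ Ψ : smoothSeries A D} (h : ∀ x, evalAt x Φ = evalAt x Ψ) : Φ = Ψ :=
  Subtype.ext (funext h)

/-- The series whose term of degree `m` is `Φ m`. -/
def ofCoeff (Φ : (A →₀ ℕ) → (Fin D → ℂ) → ℂ) (h : ∀ m, ContDiff ℂ (⊤ : ℕ∞) (Φ m)) :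
    smoothSeries A D :=
  ⟨fun x m => Φ m x, h⟩

@[simp] theorem coeff_evalAt_ofCoeff {Φ : (A →₀ ℕ) → (Fin D → ℂ) → ℂ}
    (h : ∀ m, ContDiff ℂ (⊤ : ℕ∞) (Φ m)) (x : Fin D → ℂ) (m : A →₀ ℕ) :
    (evalAt x (ofCoeff Φ h)).coeff m = Φ m x := rfl

/-- A smooth function, seen as a series (with only the term of degree `0`). -/
def ofSmooth (F : (Fin D → ℂ) → ℂ) (hF : ContDiff ℂ (⊤ : ℕ∞) F) : smoothSeries A D :=
  ⟨fun x => .C (F x), fun m => by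
    classical
    simp only [MvPowerSeries.coeff_C]
    split_ifs
    exacts [hF, contDiff_const]⟩

@[simp] theorem evalAt_ofSmooth {F : (Fin D → ℂ) → ℂ} (hF : ContDiff ℂ (⊤ : ℕ∞) F)
    (x : Fin D → ℂ) : evalAt (A := A) x (ofSmooth F hF) = .C (F x) := rfl

/-- The coordinate functions of `ℂ^D`. -/
def coord (i : Fin D) : smoothSeries A D := ofSmooth (fun x => x i) (contDiff_apply ℂ ℂ i)

@[simp] theorem evalAt_coord (i : Fin D) (x : Fin D → ℂ) :
    evalAt (A := A) x (coord i) = .C (x i) := rfl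

theorem fderiv_coeff_mul [DecidableEq A] (Φ Ψ : smoothSeries A D) (m : A →₀ ℕ)
    (x u : Fin D → ℂ) :
    fderiv ℂ (fun y => (evalAt y (Φ * Ψ)).coeff m) x u = ∑ ab ∈ antidiagonal m,
      ((evalAt x Φ).coeff ab.1 * fderiv ℂ (fun y => (evalAt y Ψ).coeff ab.2) x u +
        (evalAt x Ψ).coeff ab.2 * fderiv ℂ (fun y => (evalAt y Φ).coeff ab.1) x u) := by
  simp only [map_mul, MvPowerSeries.coeff_mul]
  rw [fderiv_fun_sum fun ab _ => (differentiableAt_coeff_evalAt Φ ab.1 x).mul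
    (differentiableAt_coeff_evalAt Ψ ab.2 x), sum_apply]
  refine Finset.sum_congr rfl fun ab _ => ?_
  rw [fderiv_fun_mul (differentiableAt_coeff_evalAt Φ ab.1 x)
    (differentiableAt_coeff_evalAt Ψ ab.2 x)]
  rfl

/-- The partial derivatives. -/
def partialDeriv (i : Fin D) :
    Derivation (MvPowerSeries A ℂ) (smoothSeries A D) (smoothSeries A D) :=
  let T (Φ : smoothSeries A D) : smoothSeries A D :=
    ofCoeff (fun m x => fderiv ℂ (fun y => (evalAt y Φ).coeff m) x (Pi.single i 1)) fun m =>
      ((contDiff_coeff_evalAt Φ m).fderiv_right (m := (⊤ : ℕ∞)) (by simp)).clm_apply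
        contDiff_const
  have hadd (Φ Ψ : smoothSeries A D) : T (Φ + Ψ) = T Φ + T Ψ := smoothSeries_ext fun x =>
    MvPowerSeries.ext fun m => DFunLike.congr_fun (fderiv_add
      (differentiableAt_coeff_evalAt Φ m x) (differentiableAt_coeff_evalAt Ψ m x)) _
  have hmul (Φ Ψ : smoothSeries A D) : T (Φ * Ψ) = Φ • T Ψ + Ψ • T Φ := by
    classical
    refine smoothSeries_ext fun x => MvPowerSeries.ext fun m =>
      (fderiv_coeff_mul Φ Ψ m x _).trans ?_
    rw [Finset.sum_add_distrib, smul_eq_mul, smul_eq_mul, mul_comm Ψ, map_add, map_mul, map_mul,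
      map_add, MvPowerSeries.coeff_mul, MvPowerSeries.coeff_mul]
    exact congrArg _ (Finset.sum_congr rfl fun ab _ => mul_comm _ _)
  have hconst (r : MvPowerSeries A ℂ) : T (algebraMap _ _ r) = 0 := smoothSeries_ext fun x =>
    MvPowerSeries.ext fun m => DFunLike.congr_fun (fderiv_const_apply (r.coeff m)) _
  Derivation.mk' ⟨⟨T, hadd⟩, fun r Φ => by
    simp [Algebra.smul_def r, hmul, hconst]⟩ hmul

theorem coeff_evalAt_partialDeriv (i : Fin D) (Φ : smoothSeries A D) (x : Fin D → ℂ)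
    (m : A →₀ ℕ) : (evalAt x (partialDeriv i Φ)).coeff m =
      fderiv ℂ (fun y => (evalAt y Φ).coeff m) x (Pi.single i 1) := rfl

theorem fderiv_coeff_eq_sum (Φ : smoothSeries A D) (m : A →₀ ℕ) (x u : Fin D → ℂ) :
    fderiv ℂ (fun y => (evalAt y Φ).coeff m) x u =
      ∑ i, u i * (evalAt x (partialDeriv i Φ)).coeff m := by
  conv_lhs => rw [pi_eq_sum_univ' u, map_sum]
  exact Finset.sum_congr rfl fun i _ => map_smul _ _ _

theorem partialDeriv_coord (i j : Fin D) :
    partialDeriv (A := A) i (coord j) = Pi.single (M := fun _ => smoothSeries A D) i 1 j := by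
  classical
  refine smoothSeries_ext fun x => MvPowerSeries.ext fun m => ?_
  have hproj : fderiv ℂ (fun y : Fin D → ℂ => y j) x = ContinuousLinearMap.proj j :=
    (ContinuousLinearMap.proj (R := ℂ) (φ := fun _ : Fin D => ℂ) j).fderiv
  rw [coeff_evalAt_partialDeriv]
  simp only [evalAt_coord, MvPowerSeries.coeff_C]
  split_ifs with hm
  · rw [hproj, ContinuousLinearMap.proj_apply]
    rcases eq_or_ne j i with rfl | hji
    · simp [hm]
    · simp [hji]
  · rcases eq_or_ne j i with rfl | hji
    · simp [MvPowerSeries.coeff_one, hm]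
    · simp [hji]

end SmoothSeries

/-! ### Hadamard's lemma, and maps determined by the coordinates -/

section Hadamard

universe u

variable {E V : Type u} [NormedAddCommGroup E] [NormedSpace ℂ E] [NormedAddCommGroup V]
  [NormedSpace ℂ V]

theorem hasFDerivAt_integral_segment [ProperSpace E] {G : E → V} (hG : ContDiff ℂ 1 G)
    (c : E) (k : ℕ) (x : E) :
    HasFDerivAt (fun x => ∫ s in (0 : ℝ)..1, (s : ℂ) ^ k • G (c + (s : ℂ) • (x - c)))
      (∫ s in (0 : ℝ)..1, (s : ℂ) ^ (k + 1) • fderiv ℂ G (c + (s : ℂ) • (x - c))) x := by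
  have hcont : Continuous fun z : E × ℝ => (z.2 : ℂ) ^ k • G (c + (z.2 : ℂ) • (z.1 - c)) := by
    have := hG.continuous
    fun_prop
  have hcont' : Continuous fun z : E × ℝ =>
      (z.2 : ℂ) ^ (k + 1) • fderiv ℂ G (c + (z.2 : ℂ) • (z.1 - c)) := by
    have := hG.continuous_fderiv one_ne_zero
    fun_prop
  obtain ⟨C, hC⟩ := ((isCompact_closedBall x (1 : ℝ)).prod
    (isCompact_Icc (a := (0 : ℝ)) (b := 1))).exists_bound_of_continuousOn hcont'.continuousOn
  refine intervalIntegral.hasFDerivAt_integral_of_dominated_of_fderiv_le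
    (s := Metric.closedBall x 1) (bound := fun _ => C)
    (F' := fun x s => (s : ℂ) ^ (k + 1) • fderiv ℂ G (c + (s : ℂ) • (x - c)))
    (Metric.closedBall_mem_nhds x one_pos)
    (.of_forall fun y => (hcont.comp (.prodMk_right y)).aestronglyMeasurable)
    ((hcont.comp (.prodMk_right x)).intervalIntegrable _ _)
    (hcont'.comp (.prodMk_right x)).aestronglyMeasurable
    (.of_forall fun s hs y hy => hC (y, s) ⟨hy, ?_⟩) intervalIntegrable_const
    (.of_forall fun s _ y _ => ?_)
  · rw [Set.uIoc_of_le zero_le_one] at hs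
    exact ⟨hs.1.le, hs.2⟩
  · have hseg : HasFDerivAt (fun y => c + (s : ℂ) • (y - c))
        ((s : ℂ) • ContinuousLinearMap.id ℂ E) y :=
      (((hasFDerivAt_id y).sub_const c).const_smul (s : ℂ)).const_add c
    refine (((hG.differentiable one_ne_zero _).hasFDerivAt.comp y hseg).const_smul
      ((s : ℂ) ^ k)).congr_fderiv ?_
    ext1 u
    simp [pow_succ, mul_smul]

theorem contDiff_integral_segment [ProperSpace E] {G : E → V} (hG : ContDiff ℂ (⊤ : ℕ∞) G) (c : E)
    (k n : ℕ) :
    ContDiff ℂ n fun x => ∫ s in (0 : ℝ)..1, (s : ℂ) ^ k • G (c + (s : ℂ) • (x - c)) := by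
  have hderiv (x : E) := hasFDerivAt_integral_segment (hG.of_le (by simp)) c k x
  induction n generalizing V k with
  | zero =>
    exact contDiff_zero.2 (continuous_iff_continuousAt.2 fun x => (hderiv x).continuousAt)
  | succ n ih =>
    have hG' : ContDiff ℂ (⊤ : ℕ∞) (fderiv ℂ G) := hG.fderiv_right (by simp)
    rw [Nat.cast_succ, contDiff_succ_iff_fderiv]
    refine ⟨fun x => (hderiv x).differentiableAt, by simp, ?_⟩
    rw [funext fun x => (hderiv x).fderiv]
    exact ih hG' (k + 1) fun x => hasFDerivAt_integral_segment (hG'.of_le (by simp)) c (k + 1) x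

theorem exists_contDiff_sub_eq_apply [ProperSpace E] [CompleteSpace V] {F : E → V}
    (hF : ContDiff ℂ (⊤ : ℕ∞) F) (c : E) :
    ∃ G : E → E →L[ℂ] V, ContDiff ℂ (⊤ : ℕ∞) G ∧ ∀ x, F x - F c = G x (x - c) := by
  have hF' : ContDiff ℂ (⊤ : ℕ∞) (fderiv ℂ F) := hF.fderiv_right (by simp)
  refine ⟨fun x => ∫ s in (0 : ℝ)..1, (s : ℂ) ^ 0 • fderiv ℂ F (c + (s : ℂ) • (x - c)),
    contDiff_infty.2 (contDiff_integral_segment hF' c 0), fun x => ?_⟩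
  have hcont : Continuous fun s : ℝ => fderiv ℂ F (c + (s : ℂ) • (x - c)) := by
    have := hF'.continuous
    fun_prop
  have hderiv (s : ℝ) : HasDerivAt (fun s : ℝ => F (c + (s : ℂ) • (x - c)))
      (fderiv ℂ F (c + (s : ℂ) • (x - c)) (x - c)) s := by
    have hseg : HasDerivAt (fun s : ℝ => c + (s : ℂ) • (x - c)) (x - c) s := by
      simpa using ((Complex.ofRealCLM.hasDerivAt (x := s)).smul_const (x - c)).const_add c
    exact ((hF.differentiable (by simp) _).hasFDerivAt.restrictScalars ℝ).comp_hasDerivAt s hseg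
  have hftc := intervalIntegral.integral_eq_sub_of_hasDerivAt (a := 0) (b := 1)
    (fun s _ => hderiv s) ((hcont.clm_apply continuous_const).intervalIntegrable _ _)
  simp only [pow_zero, one_smul]
  rw [ContinuousLinearMap.intervalIntegral_apply (hcont.intervalIntegrable _ _), hftc]
  simp

end Hadamard

section Uniqueness

variable {A : Type*} {D : ℕ}

theorem exists_eq_add_sum (c : Fin D → ℂ) (Φ : smoothSeries A D) :
    ∃ G : Fin D → smoothSeries A D, Φ = algebraMap _ _ (evalAt c Φ) +
      ∑ i, (coord i - algebraMap _ _ (MvPowerSeries.C (σ := A) (c i))) * G i := by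
  choose G hG hΦ using fun m => exists_contDiff_sub_eq_apply (contDiff_coeff_evalAt Φ m) c
  refine ⟨fun i => ofCoeff (fun m x => G m x (Pi.single i 1)) fun m =>
    (hG m).clm_apply contDiff_const, smoothSeries_ext fun x => MvPowerSeries.ext fun m => ?_⟩
  have hsplit : G m x (x - c) = ∑ i, (x i - c i) * G m x (Pi.single i 1) := by
    conv_lhs => rw [pi_eq_sum_univ' (x - c), map_sum]
    exact Finset.sum_congr rfl fun i _ => map_smul _ _ _
  simp only [map_add, map_sum, map_mul, map_sub, AlgHom.commutes, Algebra.algebraMap_self,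
    RingHom.id_apply, evalAt_coord]
  simp only [← map_sub MvPowerSeries.C, MvPowerSeries.coeff_C_mul, coeff_evalAt_ofCoeff, ← hsplit,
    ← hΦ, add_sub_cancel]

/-- Hadamard's lemma turns each application of `hT` into one more order of vanishing. -/
theorem eq_zero_of_map_coord_sub_mul {T : smoothSeries A D →ₗ[MvPowerSeries A ℂ] MvPowerSeries A ℂ}
    (c : Fin D → ℂ) {h : Fin D → MvPowerSeries A ℂ} (h1 : T 1 = 0)
    (hh : ∀ i, (h i).constantCoeff = 0)
    (hT : ∀ i Φ, T ((coord i - algebraMap _ _ (MvPowerSeries.C (σ := A) (c i))) * Φ) = h i * T Φ) :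
    T = 0 := by
  have horder (n : ℕ) (Φ : smoothSeries A D) : (n : ℕ∞) ≤ (T Φ).order := by
    induction n generalizing Φ with
    | zero => simp
    | succ n ih =>
      obtain ⟨G, hG⟩ := exists_eq_add_sum c Φ
      rw [hG, map_add, map_sum, Algebra.algebraMap_eq_smul_one, map_smul, h1, smul_zero, zero_add]
      refine Finset.sum_induction _ (fun r : MvPowerSeries A ℂ => ((n + 1 : ℕ) : ℕ∞) ≤ r.order)
        (fun r s hr hs => (le_min hr hs).trans MvPowerSeries.min_order_le_add)
        (by simp) fun i _ => ?_
      rw [hT, Nat.cast_succ, add_comm]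
      exact (add_le_add (MvPowerSeries.one_le_order_iff_constCoeff_eq_zero.2 (hh i))
        (ih (G i))).trans MvPowerSeries.le_order_mul
  ext1 Φ
  exact MvPowerSeries.order_eq_top_iff.1 (ENat.eq_top_iff_forall_ge.2 fun n => horder n Φ)

theorem algHom_ext_coord {S T : smoothSeries A D →ₐ[MvPowerSeries A ℂ] MvPowerSeries A ℂ}
    (h : ∀ i, S (coord i) = T (coord i)) : S = T := by
  refine AlgHom.toLinearMap_injective (sub_eq_zero.1 (eq_zero_of_map_coord_sub_mul
    (fun i => (T (coord i)).constantCoeff)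
    (h := fun i => T (coord i) - MvPowerSeries.C (T (coord i)).constantCoeff)
    (by simp) (by simp) fun i Φ => ?_))
  simp only [LinearMap.sub_apply, AlgHom.toLinearMap_apply, map_mul, map_sub, AlgHom.commutes,
    Algebra.algebraMap_self, RingHom.id_apply, h, mul_sub]

theorem eq_zero_of_leibniz {T : smoothSeries A D →ₗ[MvPowerSeries A ℂ] MvPowerSeries A ℂ}
    {χ : smoothSeries A D →ₐ[MvPowerSeries A ℂ] MvPowerSeries A ℂ}
    (hT : ∀ Φ Ψ, T (Φ * Ψ) = χ Φ * T Ψ + χ Ψ * T Φ) (h : ∀ i, T (coord i) = 0) : T = 0 := by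
  have h1 : T 1 = 0 := by simpa using hT 1 1
  refine eq_zero_of_map_coord_sub_mul (fun i => (χ (coord i)).constantCoeff)
    (h := fun i => χ (coord i) - MvPowerSeries.C (χ (coord i)).constantCoeff)
    h1 (by simp) fun i Φ => ?_
  rw [hT, map_sub T, h, Algebra.algebraMap_eq_smul_one, map_smul T, h1, map_sub χ, map_smul χ]
  simp

theorem apply_eq_sum_of_leibniz {T : smoothSeries A D →ₗ[MvPowerSeries A ℂ] MvPowerSeries A ℂ}
    {χ : smoothSeries A D →ₐ[MvPowerSeries A ℂ] MvPowerSeries A ℂ}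
    (hT : ∀ Φ Ψ, T (Φ * Ψ) = χ Φ * T Ψ + χ Ψ * T Φ) (Φ : smoothSeries A D) :
    T Φ = ∑ i, T (coord i) * χ (partialDeriv i Φ) := by
  let S : smoothSeries A D →ₗ[MvPowerSeries A ℂ] MvPowerSeries A ℂ :=
    ∑ i, T (coord i) • (χ.toLinearMap ∘ₗ (partialDeriv i).toLinearMap)
  have hS (Φ : smoothSeries A D) : S Φ = ∑ i, T (coord i) * χ (partialDeriv i Φ) := by
    simp [S]
  rw [← hS, ← sub_eq_zero]
  refine DFunLike.congr_fun (eq_zero_of_leibniz (T := T - S) (χ := χ) (fun Φ Ψ => ?_)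
    fun i => ?_) Φ
  · simp only [LinearMap.sub_apply, hT, hS, Derivation.leibniz, smul_eq_mul, map_add, map_mul,
      mul_sub, Finset.mul_sum, mul_add, Finset.sum_add_distrib, mul_left_comm]
    ring
  · rw [LinearMap.sub_apply, hS, sub_eq_zero]
    simp [partialDeriv_coord, Pi.single_apply, apply_ite]

theorem derivation_ext_coord
    {S T : Derivation (MvPowerSeries A ℂ) (smoothSeries A D) (smoothSeries A D)}
    (h : ∀ i, S (coord i) = T (coord i)) : S = T := by
  refine Derivation.ext fun Φ => smoothSeries_ext fun x => sub_eq_zero.1 ?_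
  rw [← map_sub, ← Derivation.sub_apply]
  refine DFunLike.congr_fun (eq_zero_of_leibniz (χ := evalAt x)
    (T := (evalAt x).toLinearMap ∘ₗ (S - T).toLinearMap) (fun Φ Ψ => ?_) fun i => ?_) Φ
  · simp only [LinearMap.comp_apply, Derivation.coeFn_coe, Derivation.leibniz,
      AlgHom.toLinearMap_apply, smul_eq_mul, map_add, map_mul]
  · simp [h]

end Uniqueness

section Substitution

variable {A : Type*} {D : ℕ}

/-- The formal vector field `∑_i V_i ∂/∂x_i`, as a derivation. -/
def fieldDeriv (V : Fin D → smoothSeries A D) :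
    Derivation (MvPowerSeries A ℂ) (smoothSeries A D) (smoothSeries A D) :=
  ∑ i, V i • partialDeriv i

theorem fieldDeriv_apply (V : Fin D → smoothSeries A D) (Φ : smoothSeries A D) :
    fieldDeriv V Φ = ∑ i, V i * partialDeriv i Φ := by
  rw [fieldDeriv, ← Derivation.coeFnAddMonoidHom_apply, map_sum, Finset.sum_apply]
  rfl

theorem fieldDeriv_coord (V : Fin D → smoothSeries A D) (i : Fin D) :
    fieldDeriv V (coord i) = V i := by
  simp [fieldDeriv_apply, partialDeriv_coord, Pi.single_apply]

/-- A coordinate of a formal point. -/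
def coordSeries (p : FormalPoint A D) (i : Fin D) : MvPowerSeries A ℂ := fun m => p m i

@[simp] theorem coeff_coordSeries (p : FormalPoint A D) (i : Fin D) (m : A →₀ ℕ) :
    (coordSeries p i).coeff m = p m i := rfl

/-- The coordinates of `h = ∑_{m ≠ 0} ε^m p_m`. -/
def increment (p : FormalPoint A D) (i : Fin D) : MvPowerSeries A ℂ :=
  coordSeries p i - .C (p 0 i)

theorem constantCoeff_increment (p : FormalPoint A D) (i : Fin D) :
    (increment p i).constantCoeff = 0 := by
  rw [increment, map_sub, ← MvPowerSeries.coeff_zero_eq_constantCoeff_apply, coeff_coordSeries,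
    MvPowerSeries.constantCoeff_C, sub_self]

/-- The derivative in the direction of `increment p`. -/
def incrementDeriv (p : FormalPoint A D) :
    Derivation (MvPowerSeries A ℂ) (smoothSeries A D) (smoothSeries A D) :=
  fieldDeriv fun i => algebraMap _ _ (increment p i)

theorem incrementDeriv_pow_succ (p : FormalPoint A D) (k : ℕ) (Φ : smoothSeries A D) :
    ((incrementDeriv p).toLinearMap ^ (k + 1)) Φ =
      ∑ i, increment p i • ((incrementDeriv p).toLinearMap ^ k) (partialDeriv i Φ) := by
  rw [pow_succ, Module.End.mul_apply]
  simp [incrementDeriv, fieldDeriv_apply, ← Algebra.smul_def]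

theorem le_order_incrementDeriv_pow (p : FormalPoint A D) (x : Fin D → ℂ) (k : ℕ)
    (Φ : smoothSeries A D) :
    (k : ℕ∞) ≤ (evalAt x (((incrementDeriv p).toLinearMap ^ k) Φ)).order := by
  induction k generalizing Φ with
  | zero => simp
  | succ k ih =>
    rw [incrementDeriv_pow_succ, map_sum]
    refine Finset.sum_induction _ (fun r : MvPowerSeries A ℂ => ((k + 1 : ℕ) : ℕ∞) ≤ r.order)
      (fun r s hr hs => (le_min hr hs).trans MvPowerSeries.min_order_le_add) (by simp) fun i _ => ?_
    rw [map_smul, smul_eq_mul, Nat.cast_succ, add_comm]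
    exact (add_le_add (MvPowerSeries.one_le_order_iff_constCoeff_eq_zero.2
      (constantCoeff_increment p i)) (ih _)).trans MvPowerSeries.le_order_mul

/-- The Taylor series `∑_k D_h^k Φ(p_0) / k!` with `h = increment p`. Its summand of index `k` has
order at least `k`, so that its terms are finite sums. -/
def taylorSeries (p : FormalPoint A D) (Φ : smoothSeries A D) : MvPowerSeries A ℂ := fun m =>
  ∑ k ∈ Finset.range (m.degree + 1),
    (evalAt (p 0) (divPow (incrementDeriv p).toLinearMap k Φ)).coeff m

theorem coeff_taylorSeries (p : FormalPoint A D) (Φ : smoothSeries A D) (m : A →₀ ℕ) :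
    (taylorSeries p Φ).coeff m = ∑ k ∈ Finset.range (m.degree + 1),
      (evalAt (p 0) (divPow (incrementDeriv p).toLinearMap k Φ)).coeff m := rfl

theorem hasSum_coeff_taylorSeries (p : FormalPoint A D) (Φ : smoothSeries A D) (m : A →₀ ℕ) :
    HasSum (fun k => (evalAt (p 0) (divPow (incrementDeriv p).toLinearMap k Φ)).coeff m)
      ((taylorSeries p Φ).coeff m) := by
  rw [coeff_taylorSeries]
  refine hasSum_sum_of_ne_finset_zero fun k hk => ?_
  rw [divPow, LinearMap.smul_apply, map_smul]
  refine MvPowerSeries.coeff_of_lt_order (lt_of_lt_of_le ?_ (MvPowerSeries.le_order_mul))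
  refine lt_of_lt_of_le ?_ ((le_order_incrementDeriv_pow p _ k Φ).trans le_add_self)
  rw [Finset.mem_range, Nat.lt_succ_iff, not_le] at hk
  exact_mod_cast hk

theorem taylorSeries_mul (p : FormalPoint A D) (Φ Ψ : smoothSeries A D) :
    taylorSeries p (Φ * Ψ) = taylorSeries p Φ * taylorSeries p Ψ := by
  classical
  refine MvPowerSeries.ext fun m => ?_
  rw [MvPowerSeries.coeff_mul]
  have hsum := hasSum_coeff_taylorSeries p
  have hmul (n : ℕ) := divPow_bilin_eq_sum
    (μ := LinearMap.mul (MvPowerSeries A ℂ) (smoothSeries A D))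
    (D := (incrementDeriv p).toLinearMap) (D' := (incrementDeriv p).toLinearMap)
    (E := (incrementDeriv p).toLinearMap) (fun Φ Ψ => by
      simp [mul_comm Ψ, add_comm]) n Φ Ψ
  simp only [LinearMap.mul_apply'] at hmul
  refine (hsum _ m).unique ?_
  simp only [hmul, map_sum, map_mul, MvPowerSeries.coeff_mul]
  simp only [Finset.sum_comm (s := antidiagonal (_ : ℕ))]
  refine hasSum_sum fun ab _ => ?_
  have hΦ := (hsum Φ ab.1).summable.norm
  have hΨ := (hsum Ψ ab.2).summable.norm
  rw [← (hsum Φ ab.1).tsum_eq, ← (hsum Ψ ab.2).tsum_eq,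
    tsum_mul_tsum_eq_tsum_sum_antidiagonal_of_summable_norm hΦ hΨ]
  exact (summable_norm_sum_mul_antidiagonal_of_summable_norm hΦ hΨ).of_norm.hasSum

theorem taylorSeries_algebraMap (p : FormalPoint A D) (r : MvPowerSeries A ℂ) :
    taylorSeries p (algebraMap _ _ r) = r := by
  have hpow (k : ℕ) : ((incrementDeriv p).toLinearMap ^ (k + 1)) (algebraMap _ _ r) = 0 := by
    rw [pow_succ, Module.End.mul_apply, Derivation.coeFn_coe, Derivation.map_algebraMap, map_zero]
  refine MvPowerSeries.ext fun m => ?_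
  rw [coeff_taylorSeries, Finset.sum_range_succ']
  simp [divPow, hpow]

/-- The value of a series of smooth functions at a formal point. -/
def evalSeries (p : FormalPoint A D) :
    smoothSeries A D →ₐ[MvPowerSeries A ℂ] MvPowerSeries A ℂ where
  toFun := taylorSeries p
  map_add' Φ Ψ := MvPowerSeries.ext fun m => by
    simp [coeff_taylorSeries, Finset.sum_add_distrib]
  map_mul' := taylorSeries_mul p
  map_zero' := by simpa using taylorSeries_algebraMap p 0
  map_one' := by simpa using taylorSeries_algebraMap p 1
  commutes' := taylorSeries_algebraMap p

theorem evalSeries_coord (p : FormalPoint A D) (i : Fin D) :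
    evalSeries p (coord i) = coordSeries p i := by
  have hpow (k : ℕ) : ((incrementDeriv p).toLinearMap ^ (k + 2)) (coord i) = 0 := by
    simp [pow_succ, incrementDeriv, fieldDeriv_coord]
  refine MvPowerSeries.ext fun m => (hasSum_coeff_taylorSeries p (coord i) m).unique ?_
  have htaylor : coordSeries p i = ∑ k ∈ Finset.range 2,
      evalAt (p 0) (divPow (incrementDeriv p).toLinearMap k (coord i)) := by
    simp [Finset.sum_range_succ, divPow, incrementDeriv, fieldDeriv_coord, increment]
  rw [htaylor, map_sum]
  refine hasSum_sum_of_ne_finset_zero fun k hk => ?_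
  obtain ⟨k, rfl⟩ := Nat.exists_eq_add_of_le' (not_lt.1 (Finset.mem_range.not.1 hk))
  rw [divPow, LinearMap.smul_apply, hpow, smul_zero, map_zero, map_zero]

theorem evalSeries_pointSeries [DecidableEq A] (x : Fin D → ℂ) :
    evalSeries (A := A) (pointSeries x) = evalAt x := algHom_ext_coord fun i => by
  rw [evalSeries_coord, evalAt_coord]
  refine MvPowerSeries.ext fun m => ?_
  rw [coeff_coordSeries, MvPowerSeries.coeff_C, pointSeries]
  split_ifs <;> rfl

end Substitution

section Taylor

variable {A : Type*} {D : ℕ}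

theorem coeff_evalAt_fieldDeriv [DecidableEq A] (V : Fin D → smoothSeries A D)
    (Φ : smoothSeries A D) (x : Fin D → ℂ) (m : A →₀ ℕ) :
    (evalAt x (fieldDeriv V Φ)).coeff m = ∑ ab ∈ antidiagonal m,
      fderiv ℂ (fun y => (evalAt y Φ).coeff ab.1) x fun i => (evalAt x (V i)).coeff ab.2 := by
  simp only [fieldDeriv_apply, map_sum, map_mul, MvPowerSeries.coeff_mul, fderiv_coeff_eq_sum]
  rw [Finset.sum_comm]
  exact Finsupp.sum_antidiagonal_swap m fun a b => ∑ i,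
    (evalAt x (V i)).coeff a * (evalAt x (partialDeriv i Φ)).coeff b

theorem sum_piAntidiag_succ {M N : Type*} [AddCommMonoid M] [DecidableEq M]
    [Finset.HasAntidiagonal M] [AddCommMonoid N] (n : ℕ) (b : M) (G : (Fin (n + 1) → M) → N) :
    ∑ r ∈ Finset.piAntidiag Finset.univ b, G r =
      ∑ ac ∈ antidiagonal b, ∑ r ∈ Finset.piAntidiag Finset.univ ac.2,
        G (Fin.snoc r ac.1) := by
  rw [Finset.sum_sigma']
  refine Finset.sum_bij' (fun r _ => ⟨(r (Fin.last n), ∑ i : Fin n, r i.castSucc), Fin.init r⟩)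
    (fun s _ => Fin.snoc s.2 s.1.1) ?_ ?_ ?_ ?_ ?_
  · intro r hr
    rw [Finset.mem_piAntidiag, Fin.sum_univ_castSucc, add_comm] at hr
    exact Finset.mem_sigma.2 ⟨mem_antidiagonal.2 hr.1, Finset.mem_piAntidiag.2 ⟨rfl, by simp⟩⟩
  · rintro ⟨⟨a, c⟩, r⟩ h
    simp only [Finset.mem_sigma, mem_antidiagonal, Finset.mem_piAntidiag] at h
    simp [Fin.sum_univ_castSucc, h.2.1, ← h.1, add_comm]
  · intro r _
    simp
  · rintro ⟨⟨a, c⟩, r⟩ h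
    simp only [Finset.mem_sigma, mem_antidiagonal, Finset.mem_piAntidiag] at h
    simp [h.2.1]
  · intro r _
    simp

theorem sum_antidiagonal_assoc {M N : Type*} [AddCommMonoid M]
    [Finset.HasAntidiagonal M] [AddCommMonoid N] (m : M) (G : M → M → M → N) :
    ∑ ab ∈ antidiagonal m, ∑ cd ∈ antidiagonal ab.1, G cd.1 cd.2 ab.2 =
      ∑ ab ∈ antidiagonal m, ∑ cd ∈ antidiagonal ab.2, G ab.1 cd.1 cd.2 := by
  rw [Finset.sum_sigma', Finset.sum_sigma']
  refine Finset.sum_bij' (fun s _ => ⟨(s.2.1, s.2.2 + s.1.2), (s.2.2, s.1.2)⟩)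
    (fun s _ => ⟨(s.1.1 + s.2.1, s.2.2), (s.1.1, s.2.1)⟩) ?_ ?_ ?_ ?_ ?_
  · rintro ⟨⟨a, b⟩, c, d⟩ h
    simp_all [← add_assoc]
  · rintro ⟨⟨a, b⟩, c, d⟩ h
    simp_all [add_assoc]
  · rintro ⟨⟨a, b⟩, c, d⟩ h
    simp_all
  · rintro ⟨⟨a, b⟩, c, d⟩ h
    simp_all
  · intro _ _
    rfl

theorem iteratedFDeriv_snoc {F : (Fin D → ℂ) → ℂ} (hF : ContDiff ℂ (⊤ : ℕ∞) F) (k : ℕ)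
    (x u : Fin D → ℂ) (v : Fin k → Fin D → ℂ) :
    iteratedFDeriv ℂ (k + 1) F x (Fin.snoc v u) =
      iteratedFDeriv ℂ k (fun y => fderiv ℂ F y u) x v := by
  rw [iteratedFDeriv_succ_apply_right, Fin.init_snoc, Fin.snoc_last,
    iteratedFDeriv_clm_apply_const_apply (n := (⊤ : ℕ∞)) (hF.fderiv_right (by simp))
      (by exact_mod_cast le_top)]

theorem coeff_evalAt_fieldDeriv_pow [DecidableEq A] (h : Fin D → MvPowerSeries A ℂ) (k : ℕ)
    (Φ : smoothSeries A D) (x : Fin D → ℂ) (m : A →₀ ℕ) :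
    (evalAt x (((fieldDeriv fun i => algebraMap _ _ (h i)).toLinearMap ^ k) Φ)).coeff m =
      ∑ ab ∈ antidiagonal m, ∑ r ∈ Finset.piAntidiag (Finset.univ : Finset (Fin k)) ab.2,
        iteratedFDeriv ℂ k (fun y => (evalAt y Φ).coeff ab.1) x fun j i => (h i).coeff (r j) := by
  induction k generalizing Φ m with
  | zero =>
    rw [Finset.sum_eq_single_of_mem (m, 0) (by simp)]
    · simp
    · rintro ⟨a, b⟩ hab hne
      have hb : b ≠ 0 := by
        rintro rfl
        exact hne (by simpa using hab)
      simp [hb]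
  | succ k ih =>
    rw [pow_succ, Module.End.mul_apply, ih, Derivation.coeFn_coe]
    have hterm (a : A →₀ ℕ) (v : Fin k → Fin D → ℂ) :
        iteratedFDeriv ℂ k (fun y => (evalAt y
          (fieldDeriv (fun i => algebraMap _ _ (h i)) Φ)).coeff a) x v =
        ∑ cd ∈ antidiagonal a, iteratedFDeriv ℂ (k + 1) (fun y => (evalAt y Φ).coeff cd.1) x
          (Fin.snoc v fun i => (h i).coeff cd.2) := by
      simp only [coeff_evalAt_fieldDeriv, AlgHom.commutes, Algebra.algebraMap_self,
        RingHom.id_apply]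
      rw [iteratedFDeriv_fun_sum_apply fun cd _ =>
        (((contDiff_coeff_evalAt Φ cd.1).fderiv_right (m := (⊤ : ℕ∞)) (by simp)).clm_apply
          contDiff_const).contDiffAt.of_le (by exact_mod_cast le_top), sum_apply]
      exact Finset.sum_congr rfl fun cd _ =>
        (iteratedFDeriv_snoc (contDiff_coeff_evalAt Φ cd.1) k x _ v).symm
    simp only [hterm, Finset.sum_comm (t := antidiagonal (Prod.fst (_ : _ × (A →₀ ℕ))))]
    simp only [sum_piAntidiag_succ k]
    rw [sum_antidiagonal_assoc m fun a c b => ∑ r ∈ Finset.piAntidiag Finset.univ b,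
      iteratedFDeriv ℂ (k + 1) (fun y => (evalAt y Φ).coeff a) x
        (Fin.snoc (fun j i => (h i).coeff (r j)) fun i => (h i).coeff c)]
    refine Finset.sum_congr rfl fun ab _ => Finset.sum_congr rfl fun cd _ =>
      Finset.sum_congr rfl fun r _ => congrArg _ (funext fun j => ?_)
    refine Fin.lastCases ?_ (fun j => ?_) j <;> simp

theorem le_degree_of_mem_piAntidiag [DecidableEq A] {k : ℕ} {b : A →₀ ℕ} {r : Fin k → A →₀ ℕ}
    (hr : r ∈ Finset.piAntidiag Finset.univ b) (h0 : ∀ j, r j ≠ 0) : k ≤ b.degree := by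
  rw [← (Finset.mem_piAntidiag.1 hr).1, map_sum]
  simpa using Finset.sum_le_sum fun j (_ : j ∈ Finset.univ) =>
    Nat.one_le_iff_ne_zero.2 ((Finsupp.degree_eq_zero_iff (r j)).not.2 (h0 j))

theorem taylorTerm_apply [DecidableEq A] {F : (Fin D → ℂ) → Fin D → ℂ}
    (hF : ContDiff ℂ (⊤ : ℕ∞) F) (p : FormalPoint A D) {b : A →₀ ℕ} {K : ℕ} (hK : b.degree ≤ K)
    (i : Fin D) :
    taylorTerm F p b i = ∑ k ∈ Finset.range (K + 1), ((k.factorial : ℂ))⁻¹ *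
      ∑ r ∈ Finset.piAntidiag (Finset.univ : Finset (Fin k)) b,
        iteratedFDeriv ℂ k (fun y => F y i) (p 0) fun j l => (increment p l).coeff (r j) := by
  have hincr (c : A →₀ ℕ) (hc : c ≠ 0) : (fun l => (increment p l).coeff c) = p c := by
    funext l
    simp [increment, MvPowerSeries.coeff_C, hc]
  have hterm (k : ℕ) (r : Fin k → A →₀ ℕ) :
      iteratedFDeriv ℂ k (fun y => F y i) (p 0) (fun j l => (increment p l).coeff (r j)) =
        if ∀ j, r j ≠ 0 then iteratedFDeriv ℂ k F (p 0) (fun j => p (r j)) i else 0 := by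
    split_ifs with hr
    · rw [funext fun j => hincr (r j) (hr j)]
      exact DFunLike.congr_fun ((ContinuousLinearMap.proj (R := ℂ) (φ := fun _ : Fin D => ℂ)
        i).iteratedFDeriv_comp_left hF.contDiffAt (by exact_mod_cast le_top)) _
    · push Not at hr
      obtain ⟨j, hj⟩ := hr
      refine ContinuousMultilinearMap.map_coord_zero _ j (funext fun l => ?_)
      rw [hj, MvPowerSeries.coeff_zero_eq_constantCoeff_apply, constantCoeff_increment]
      rfl
  simp only [hterm, ← Finset.sum_filter, taylorTerm, Finset.sum_apply, Pi.smul_apply, smul_eq_mul]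
  refine Finset.sum_subset (Finset.range_mono (by lia)) fun k _ hk => ?_
  rw [Finset.filter_false_of_mem fun r hr h0 => hk
    (Finset.mem_range.2 (Nat.lt_succ_of_le (le_degree_of_mem_piAntidiag hr h0))),
    Finset.sum_empty, mul_zero]

/-- The series formed by the `i`-th coordinates of a formal series of smooth maps. -/
def component (Φ : FormalMap A D) (hΦ : IsSmooth Φ) (i : Fin D) : smoothSeries A D :=
  ofCoeff (fun m x => Φ x m i) fun m => contDiff_pi.1 (hΦ m) i

theorem evalAt_component {Φ : FormalMap A D} (hΦ : IsSmooth Φ) (x : Fin D → ℂ) (i : Fin D) :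
    evalAt x (component Φ hΦ i) = coordSeries (Φ x) i := rfl

theorem coordSeries_subst [DecidableEq A] {Φ : FormalMap A D} (hΦ : IsSmooth Φ)
    (p : FormalPoint A D) (i : Fin D) :
    coordSeries (subst Φ p) i = evalSeries p (component Φ hΦ i) := by
  refine MvPowerSeries.ext fun m => ?_
  calc subst Φ p m i = ∑ ab ∈ antidiagonal m, ∑ k ∈ Finset.range (m.degree + 1),
        ((k.factorial : ℂ))⁻¹ * ∑ r ∈ Finset.piAntidiag (Finset.univ : Finset (Fin k)) ab.2,
          iteratedFDeriv ℂ k (fun y => (evalAt y (component Φ hΦ i)).coeff ab.1) (p 0)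
            fun j l => (increment p l).coeff (r j) := by
        rw [subst, Finset.sum_apply]
        refine Finset.sum_congr rfl fun ab hab => taylorTerm_apply (hΦ _) p ?_ i
        rw [← mem_antidiagonal.1 hab, map_add]
        exact Nat.le_add_left _ _
    _ = (taylorSeries p (component Φ hΦ i)).coeff m := by
        rw [coeff_taylorSeries, Finset.sum_comm]
        refine Finset.sum_congr rfl fun k _ => ?_
        rw [divPow, LinearMap.smul_apply, map_smul, ← Finset.mul_sum,
          ← coeff_evalAt_fieldDeriv_pow (increment p), smul_eq_mul]
        exact (MvPowerSeries.coeff_C_mul ..).symm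

theorem coordSeries_jacobianMul [DecidableEq A] {Φ V : FormalMap A D} (hΦ : IsSmooth Φ)
    (hV : IsSmooth V) (x : Fin D → ℂ) (i : Fin D) :
    coordSeries (jacobianMul Φ V x) i =
      evalAt x (fieldDeriv (component V hV) (component Φ hΦ i)) := by
  refine MvPowerSeries.ext fun m => ?_
  rw [coeff_evalAt_fieldDeriv, coeff_coordSeries, jacobianMul, Finset.sum_apply]
  refine Finset.sum_congr rfl fun ab _ => ?_
  exact (DFunLike.congr_fun (fderiv_apply ((hΦ ab.1).differentiable (by simp) x) i) _).symm

end Taylor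

section Curves

variable {A : Type*} {D : ℕ} {p : ℝ → FormalPoint A D} {t : ℝ}

theorem differentiableAt_coeff_incrementDeriv_pow
    (hp : ∀ m, DifferentiableAt ℝ (fun s => p s m) t) (k : ℕ) (Φ : smoothSeries A D)
    (m : A →₀ ℕ) : DifferentiableAt ℝ (fun s => (evalAt (p s 0)
      (((incrementDeriv (p s)).toLinearMap ^ k) Φ)).coeff m) t := by
  classical
  induction k generalizing Φ m with
  | zero =>
    exact ((differentiableAt_coeff_evalAt Φ m _).restrictScalars ℝ).comp t (hp 0)
  | succ k ih =>
    simp only [incrementDeriv_pow_succ, map_sum, map_smul, smul_eq_mul, MvPowerSeries.coeff_mul]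
    refine DifferentiableAt.fun_sum fun i _ => DifferentiableAt.fun_sum fun ab _ =>
      DifferentiableAt.mul ?_ (ih _ _)
    simp only [increment, map_sub, coeff_coordSeries, MvPowerSeries.coeff_C]
    split_ifs
    · exact (differentiableAt_pi.1 (hp _) i).sub (differentiableAt_pi.1 (hp 0) i)
    · exact (differentiableAt_pi.1 (hp _) i).sub_const 0

theorem differentiableAt_coeff_evalSeries (hp : ∀ m, DifferentiableAt ℝ (fun s => p s m) t)
    (Φ : smoothSeries A D) (m : A →₀ ℕ) :
    DifferentiableAt ℝ (fun s => (evalSeries (p s) Φ).coeff m) t := by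
  refine DifferentiableAt.fun_sum (u := Finset.range (m.degree + 1)) fun k _ => ?_
  simp only [divPow, LinearMap.smul_apply, map_smul, smul_eq_mul, MvPowerSeries.algebraMap_apply,
    Algebra.algebraMap_self, RingHom.id_apply, MvPowerSeries.coeff_C_mul]
  exact (differentiableAt_coeff_incrementDeriv_pow hp k Φ m).const_mul _

/-- The derivative at time `t` of the values of series of smooth functions along a curve. -/
def curveDeriv (hp : ∀ m, DifferentiableAt ℝ (fun s => p s m) t) :
    smoothSeries A D →ₗ[MvPowerSeries A ℂ] MvPowerSeries A ℂ where
  toFun Φ m := deriv (fun s => (evalSeries (p s) Φ).coeff m) t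
  map_add' Φ Ψ := MvPowerSeries.ext fun m => by
    have hΦ := differentiableAt_coeff_evalSeries hp Φ m
    have hΨ := differentiableAt_coeff_evalSeries hp Ψ m
    refine Eq.trans ?_ (deriv_fun_add hΦ hΨ)
    simp only [map_add]
    rfl
  map_smul' r Φ := MvPowerSeries.ext fun m => by
    classical
    have hΦ (b : A →₀ ℕ) := differentiableAt_coeff_evalSeries hp Φ b
    have hderiv := HasDerivAt.fun_sum (u := antidiagonal m) fun ab _ =>
      (hΦ ab.2).hasDerivAt.const_mul (r.coeff ab.1)
    refine Eq.trans ?_ (hderiv.deriv.trans (MvPowerSeries.coeff_mul m r (fun b =>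
      deriv (fun s => (evalSeries (p s) Φ).coeff b) t)).symm)
    simp only [map_smul, smul_eq_mul, MvPowerSeries.coeff_mul]
    rfl

theorem hasDerivAt_coeff_evalSeries {p' : FormalPoint A D}
    (hp : ∀ m, HasDerivAt (fun s => p s m) (p' m) t) (Φ : smoothSeries A D) (m : A →₀ ℕ) :
    HasDerivAt (fun s => (evalSeries (p s) Φ).coeff m)
      ((∑ i, coordSeries p' i * evalSeries (p t) (partialDeriv i Φ)).coeff m) t := by
  classical
  have hdiff (b : A →₀ ℕ) := (hp b).differentiableAt
  have hΦ (Φ : smoothSeries A D) (b : A →₀ ℕ) :=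
    (differentiableAt_coeff_evalSeries hdiff Φ b).hasDerivAt
  have hcoord (i : Fin D) : curveDeriv hdiff (coord i) = coordSeries p' i :=
    MvPowerSeries.ext fun b => by
      refine Eq.trans ?_ (hasDerivAt_pi.1 (hp b) i).deriv
      exact congrArg (deriv · t) (funext fun s => by rw [evalSeries_coord, coeff_coordSeries])
  have hleib (Φ Ψ : smoothSeries A D) : curveDeriv hdiff (Φ * Ψ) =
      evalSeries (p t) Φ * curveDeriv hdiff Ψ + evalSeries (p t) Ψ * curveDeriv hdiff Φ := by
    refine MvPowerSeries.ext fun b => ?_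
    have hderiv := HasDerivAt.fun_sum (u := antidiagonal b) fun ab _ =>
      (hΦ Φ ab.1).fun_mul (hΦ Ψ ab.2)
    simp only [← MvPowerSeries.coeff_mul, ← map_mul] at hderiv
    refine hderiv.deriv.trans ?_
    rw [Finset.sum_add_distrib, add_comm, mul_comm (evalSeries (p t) Ψ), map_add,
      MvPowerSeries.coeff_mul, MvPowerSeries.coeff_mul]
    rfl
  simp only [← hcoord, ← apply_eq_sum_of_leibniz hleib]
  exact hΦ Φ m

end Curves

/-! ### Word series of differential operators -/

section CancelRight

variable {A : Type*}

local notation:70 x:70 " ⧢ " y:71 => shuffleMul x y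

/-- Right cancellation of a letter: `w c ↦ w`, and a word that does not end with `c` is sent
to `0`. -/
def cancelRight (c : A) : WordPoly A →ₗ[ℂ] WordPoly A :=
  Finsupp.lcomapDomain (· ++ [c]) (List.append_left_injective [c])

@[simp] theorem cancelRight_apply (c : A) (x : WordPoly A) (w : List A) :
    cancelRight c x w = x (w ++ [c]) := rfl

theorem cancelLetter_cancelRight (a c : A) (x : WordPoly A) :
    cancelLetter a (cancelRight c x) = cancelRight c (cancelLetter a x) := by
  ext w
  rfl

theorem cancelRight_shuffleMul (c : A) (x y : WordPoly A) :
    cancelRight c (x ⧢ y) = cancelRight c x ⧢ y + x ⧢ cancelRight c y := by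
  suffices shuffleMul.compr₂ (cancelRight c) =
      shuffleMul ∘ₗ cancelRight c + shuffleMul.compl₂ (cancelRight c) from
    LinearMap.congr_fun₂ this x y
  refine IsLeibniz.eq (fun a x y => ?_) (fun a x y => ?_) fun u w => ?_
  · simp only [LinearMap.compr₂_apply, cancelLetter_cancelRight, cancelLetter_shuffleMul, map_add]
  · simp only [LinearMap.add_apply, LinearMap.comp_apply, LinearMap.compl₂_apply,
      cancelLetter_cancelRight, cancelLetter_shuffleMul, map_add]
    abel
  · have h := DFunLike.congr_fun (cancelLetter_shuffleMul c (.single u 1) (.single w 1)) []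
    simp only [Finsupp.add_apply, shuffleMul_apply_nil] at h
    simp only [LinearMap.compr₂_apply, LinearMap.add_apply, LinearMap.comp_apply,
      LinearMap.compl₂_apply, Finsupp.add_apply, shuffleMul_apply_nil]
    exact h

end CancelRight

section WordOperators

variable {A : Type*} {D : ℕ}
  (L : A → Derivation (MvPowerSeries A ℂ) (smoothSeries A D) (smoothSeries A D))

/-- The differential operator `ε_ℓ₁ L_ℓ₁ ∘ ⋯ ∘ ε_ℓₙ L_ℓₙ` attached to the word `ℓ₁ ⋯ ℓₙ`. -/
def wordOp (w : List A) : Module.End (MvPowerSeries A ℂ) (smoothSeries A D) :=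
  (w.map fun ℓ => MvPowerSeries.X (R := ℂ) ℓ • (L ℓ).toLinearMap).prod

theorem wordOp_nil : wordOp L [] = 1 := rfl

theorem wordOp_cons (ℓ : A) (w : List A) (Φ : smoothSeries A D) :
    wordOp L (ℓ :: w) Φ = MvPowerSeries.X (R := ℂ) ℓ • L ℓ (wordOp L w Φ) := rfl

theorem wordOp_append (u w : List A) : wordOp L (u ++ w) = wordOp L u * wordOp L w := by
  rw [wordOp, List.map_append, List.prod_append]
  rfl

variable [DecidableEq A]

/-- The number of occurrences of each letter in a word. -/
def content (w : List A) : A →₀ ℕ := Multiset.toFinsupp (w : Multiset A)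

theorem content_cons (ℓ : A) (w : List A) : content (ℓ :: w) = Finsupp.single ℓ 1 + content w := by
  rw [content, ← Multiset.cons_coe, ← Multiset.singleton_add, map_add, Multiset.toFinsupp_singleton]
  rfl

/-- The words of content at most `m`. -/
def wordsLE (m : A →₀ ℕ) : Finset (List A) :=
  (Finset.Iic m).biUnion fun b => (Multiset.lists (Finsupp.toMultiset b)).toFinset

theorem mem_lists_toMultiset {b : A →₀ ℕ} {w : List A} :
    w ∈ (Multiset.lists (Finsupp.toMultiset b)).toFinset ↔ content w = b := by
  rw [Multiset.mem_toFinset, Multiset.mem_lists_iff, content, Multiset.toFinsupp_eq_iff, eq_comm]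
  rfl

theorem mem_wordsLE {m : A →₀ ℕ} {w : List A} : w ∈ wordsLE m ↔ content w ≤ m := by
  simp only [wordsLE, Finset.mem_biUnion, Finset.mem_Iic, mem_lists_toMultiset, exists_eq_right']

theorem exists_wordOp_eq_smul (w : List A) (Φ : smoothSeries A D) :
    ∃ Ψ, wordOp L w Φ = MvPowerSeries.monomial (content w) (1 : ℂ) • Ψ := by
  induction w with
  | nil => exact ⟨Φ, by simp [wordOp_nil, content]⟩
  | cons ℓ w ih =>
    obtain ⟨Ψ, hΨ⟩ := ih
    refine ⟨L ℓ Ψ, ?_⟩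
    rw [wordOp_cons, hΨ, Derivation.map_smul, smul_smul, MvPowerSeries.X,
      MvPowerSeries.monomial_mul_monomial, mul_one, content_cons]

theorem coeff_map_wordOp_eq_zero (T : smoothSeries A D →ₗ[MvPowerSeries A ℂ] MvPowerSeries A ℂ)
    (Φ : smoothSeries A D) {m : A →₀ ℕ} {w : List A} (h : w ∉ wordsLE m) :
    (T (wordOp L w Φ)).coeff m = 0 := by
  obtain ⟨Ψ, hΨ⟩ := exists_wordOp_eq_smul L w Φ
  rw [hΨ, map_smul, smul_eq_mul, MvPowerSeries.coeff_monomial_mul, if_neg (mem_wordsLE.not.1 h)]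

end WordOperators

section Filtration

variable {A : Type*} {D : ℕ}

/-- The ideal of the series that have no terms of degree at most `m`. -/
def tail (m : A →₀ ℕ) : Ideal (smoothSeries A D) where
  carrier := {Φ | ∀ b ≤ m, ∀ x, (evalAt x Φ).coeff b = 0}
  add_mem' hΦ hΨ b hb x := by rw [map_add, map_add, hΦ b hb, hΨ b hb, add_zero]
  zero_mem' _ _ _ := rfl
  smul_mem' Φ Ψ hΨ b hb x := by
    classical
    rw [smul_eq_mul, map_mul, MvPowerSeries.coeff_mul]
    exact Finset.sum_eq_zero fun ab hab =>
      mul_eq_zero_of_right _ (hΨ _ ((mem_antidiagonal.1 hab ▸ le_add_self).trans hb) x)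

theorem derivation_mem_tail
    (S : Derivation (MvPowerSeries A ℂ) (smoothSeries A D) (smoothSeries A D)) {m : A →₀ ℕ}
    {Φ : smoothSeries A D} (hΦ : Φ ∈ tail m) : S Φ ∈ tail m := by
  have hS : S = fieldDeriv fun i => S (coord i) :=
    derivation_ext_coord fun i => (fieldDeriv_coord (fun i => S (coord i)) i).symm
  rw [hS, fieldDeriv_apply]
  refine sum_mem fun i _ => Ideal.mul_mem_left _ _ fun b hb x => ?_
  rw [coeff_evalAt_partialDeriv, show (fun y => (evalAt y Φ).coeff b) = 0 from funext (hΦ b hb),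
    fderiv_zero]
  rfl

/-- The terms of degree `m` of the values of `T` depend only on the terms of degree at most `m` of
the series to which `T` is applied. -/
def IsFiltered (T : smoothSeries A D →ₗ[MvPowerSeries A ℂ] MvPowerSeries A ℂ) : Prop :=
  ∀ ⦃m Φ⦄, Φ ∈ tail m → (T Φ).coeff m = 0

theorem isFiltered_evalAt (x : Fin D → ℂ) : IsFiltered (evalAt (A := A) x).toLinearMap :=
  fun m _ hΦ => hΦ m le_rfl x

theorem IsFiltered.comp_derivation
    {T : smoothSeries A D →ₗ[MvPowerSeries A ℂ] MvPowerSeries A ℂ} (hT : IsFiltered T)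
    (S : Derivation (MvPowerSeries A ℂ) (smoothSeries A D) (smoothSeries A D)) :
    IsFiltered (T ∘ₗ S.toLinearMap) :=
  fun _ _ hΦ => hT (derivation_mem_tail S hΦ)

theorem isFiltered_evalSeries (p : FormalPoint A D) : IsFiltered (evalSeries p).toLinearMap := by
  intro m Φ hΦ
  have hpow (k : ℕ) : ((incrementDeriv p).toLinearMap ^ k) Φ ∈ tail m := by
    induction k with
    | zero => exact hΦ
    | succ k ih =>
      rw [pow_succ', Module.End.mul_apply]
      exact derivation_mem_tail _ ih
  refine Finset.sum_eq_zero (s := Finset.range (m.degree + 1)) fun k _ => ?_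
  rw [divPow, LinearMap.smul_apply, map_smul, smul_eq_mul, MvPowerSeries.algebraMap_apply,
    MvPowerSeries.coeff_C_mul, hpow k m le_rfl, mul_zero]

end Filtration

section OpSeries

variable {A : Type*} [DecidableEq A] {D : ℕ}
  (L : A → Derivation (MvPowerSeries A ℂ) (smoothSeries A D) (smoothSeries A D))

local notation:70 x:70 " ⧢ " y:71 => shuffleMul x y

/-- The terms of degree `m` of the values of `T` at the series obtained from `Φ` by means of the
word operators, as an element of the shuffle algebra. -/
def wordTerms (T : smoothSeries A D →ₗ[MvPowerSeries A ℂ] MvPowerSeries A ℂ) (m : A →₀ ℕ)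
    (Φ : smoothSeries A D) : WordPoly A :=
  Finsupp.onFinset (wordsLE m) (fun w => (T (wordOp L w Φ)).coeff m) fun _ h =>
    not_imp_comm.1 (coeff_map_wordOp_eq_zero L T Φ) h

variable (T : smoothSeries A D →ₗ[MvPowerSeries A ℂ] MvPowerSeries A ℂ)

@[simp] theorem wordTerms_apply (m : A →₀ ℕ) (Φ : smoothSeries A D) (w : List A) :
    wordTerms L T m Φ w = (T (wordOp L w Φ)).coeff m := rfl

theorem cancelLetter_wordTerms (m : A →₀ ℕ) (Φ : smoothSeries A D) (ℓ : A) :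
    cancelLetter ℓ (wordTerms L T m Φ) =
      wordTerms L (T ∘ₗ (MvPowerSeries.X (R := ℂ) ℓ • L ℓ).toLinearMap) m Φ := by
  ext w
  rw [cancelLetter_apply, wordTerms_apply, wordTerms_apply, wordOp_cons]
  rfl

theorem cancelRight_wordTerms (m : A →₀ ℕ) (Φ : smoothSeries A D) (ℓ : A) :
    cancelRight ℓ (wordTerms L T m Φ) =
      wordTerms L T m (MvPowerSeries.X (R := ℂ) ℓ • L ℓ Φ) := by
  ext w
  rw [cancelRight_apply, wordTerms_apply, wordTerms_apply, wordOp_append]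
  rfl

theorem wordTerms_add (m : A →₀ ℕ) (Φ Ψ : smoothSeries A D) :
    wordTerms L T m (Φ + Ψ) = wordTerms L T m Φ + wordTerms L T m Ψ := by
  ext w
  simp only [wordTerms_apply, map_add, Finsupp.add_apply]

theorem wordTerms_smul (m : A →₀ ℕ) (r : MvPowerSeries A ℂ) (Φ : smoothSeries A D) :
    wordTerms L T m (r • Φ) =
      ∑ ab ∈ antidiagonal m, r.coeff ab.1 • wordTerms L T ab.2 Φ := by
  ext w
  simp only [wordTerms_apply, map_smul, smul_eq_mul, MvPowerSeries.coeff_mul,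
    Finsupp.finsetSum_apply, Finsupp.smul_apply]

theorem wordTerms_one (x : Fin D → ℂ) (m : A →₀ ℕ) :
    wordTerms L (evalAt x).toLinearMap m 1 =
      (1 : MvPowerSeries A ℂ).coeff m • Finsupp.single [] 1 := by
  ext w
  rcases w.eq_nil_or_concat' with rfl | ⟨w, ℓ, rfl⟩
  · rw [Finsupp.smul_apply, Finsupp.single_eq_same, smul_eq_mul, mul_one]
    rfl
  · rw [← cancelRight_apply, cancelRight_wordTerms, Derivation.map_one_eq_zero, smul_zero,
      Finsupp.smul_apply, Finsupp.single_eq_of_ne (by simp), smul_zero, wordTerms_apply,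
      map_zero, map_zero, map_zero]

/-- The word operators satisfy the Leibniz rule of compositions of derivations, which is dual to the
shuffle product. -/
theorem wordTerms_mul (S : smoothSeries A D →ₐ[MvPowerSeries A ℂ] MvPowerSeries A ℂ) (m : A →₀ ℕ)
    (Φ Ψ : smoothSeries A D) :
    wordTerms L S.toLinearMap m (Φ * Ψ) = ∑ ab ∈ antidiagonal m,
      wordTerms L S.toLinearMap ab.1 Φ ⧢ wordTerms L S.toLinearMap ab.2 Ψ := by
  ext w
  induction w using List.reverseRecOn generalizing Φ Ψ with
  | nil =>
    simp only [Finsupp.finsetSum_apply, shuffleMul_apply_nil, wordTerms_apply, wordOp_nil,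
      Module.End.one_apply, AlgHom.toLinearMap_apply, map_mul, MvPowerSeries.coeff_mul]
  | append_singleton w ℓ ih =>
    have hleib : MvPowerSeries.X (R := ℂ) ℓ • L ℓ (Φ * Ψ) =
        (MvPowerSeries.X (R := ℂ) ℓ • L ℓ Φ) * Ψ + Φ * (MvPowerSeries.X (R := ℂ) ℓ • L ℓ Ψ) := by
      rw [Derivation.leibniz, smul_add, smul_eq_mul, smul_eq_mul, mul_comm Ψ, smul_mul_assoc,
        mul_smul_comm, add_comm]
    rw [← cancelRight_apply, ← cancelRight_apply, cancelRight_wordTerms, hleib, wordTerms_add,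
      Finsupp.add_apply, ih, ih, ← Finsupp.add_apply, ← Finset.sum_add_distrib, map_sum]
    simp only [cancelRight_shuffleMul, cancelRight_wordTerms]

theorem pairing_wordTerms (δ : Coeff A) (m : A →₀ ℕ) (Φ : smoothSeries A D) :
    pairing δ (wordTerms L T m Φ) = ∑ w ∈ wordsLE m, δ w * (T (wordOp L w Φ)).coeff m :=
  (Finsupp.sum_of_support_subset _ Finsupp.support_onFinset_subset (fun w c => c • δ w)
    fun _ _ => zero_smul _ _).trans (Finset.sum_congr rfl fun _ _ => mul_comm _ _)

/-- The word series `∑_w δ_w ε_w L_w` of differential operators. -/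
def opSeries (δ : Coeff A) : Module.End (MvPowerSeries A ℂ) (smoothSeries A D) where
  toFun Φ := ofCoeff (fun m x => pairing δ (wordTerms L (evalAt x).toLinearMap m Φ)) fun m => by
    simp only [pairing_wordTerms]
    exact ContDiff.sum fun w _ => contDiff_const.mul (contDiff_coeff_evalAt _ m)
  map_add' Φ Ψ := smoothSeries_ext fun x => MvPowerSeries.ext fun m => by
    simp only [map_add, coeff_evalAt_ofCoeff, wordTerms_add]
  map_smul' r Φ := smoothSeries_ext fun x => MvPowerSeries.ext fun m => by
    simp only [RingHom.id_apply, map_smul, smul_eq_mul, MvPowerSeries.coeff_mul,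
      coeff_evalAt_ofCoeff, wordTerms_smul, map_sum]

theorem coeff_evalAt_opSeries (δ : Coeff A) (x : Fin D → ℂ) (m : A →₀ ℕ)
    (Φ : smoothSeries A D) :
    (evalAt x (opSeries L δ Φ)).coeff m =
      pairing δ (wordTerms L (evalAt x).toLinearMap m Φ) := rfl

variable {L T} in
theorem IsFiltered.coeff_opSeries (hT : IsFiltered T) (δ : Coeff A) (m : A →₀ ℕ)
    (Φ : smoothSeries A D) :
    (T (opSeries L δ Φ)).coeff m = pairing δ (wordTerms L T m Φ) := by
  have hmem : opSeries L δ Φ - ∑ w ∈ wordsLE m, MvPowerSeries.C (σ := A) (δ w) • wordOp L w Φ ∈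
      tail m := by
    intro b hb x
    rw [map_sub, map_sub, coeff_evalAt_opSeries, pairing_wordTerms, map_sum, map_sum, sub_eq_zero]
    simp only [map_smul, smul_eq_mul, MvPowerSeries.coeff_C_mul]
    refine Finset.sum_subset (fun w hw => ?_) fun w _ hw => ?_
    · exact mem_wordsLE.2 ((mem_wordsLE.1 hw).trans hb)
    · exact mul_eq_zero_of_right _ (coeff_map_wordOp_eq_zero L (evalAt x).toLinearMap Φ hw)
  have h := hT hmem
  rw [map_sub, map_sub, sub_eq_zero] at h
  rw [h, map_sum, map_sum, pairing_wordTerms]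
  simp only [map_smul, smul_eq_mul, MvPowerSeries.coeff_C_mul]

variable {T} in
theorem wordTerms_opSeries (hT : IsFiltered T) (δ : Coeff A) (m : A →₀ ℕ)
    (Φ : smoothSeries A D) :
    wordTerms L T m (opSeries L δ Φ) = contraction δ (wordTerms L T m Φ) := by
  ext w
  induction w generalizing T with
  | nil => rw [contraction_apply_nil, ← hT.coeff_opSeries, wordTerms_apply, wordOp_nil,
      Module.End.one_apply]
  | cons ℓ w ih =>
    rw [← cancelLetter_apply, ← cancelLetter_apply, cancelLetter_contraction,
      cancelLetter_wordTerms, cancelLetter_wordTerms, ih (hT.comp_derivation _)]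

theorem opSeries_mul (δ δ' : Coeff A) : opSeries L (δ * δ') = opSeries L δ * opSeries L δ' := by
  refine LinearMap.ext fun Φ => smoothSeries_ext fun x => MvPowerSeries.ext fun m => ?_
  rw [coeff_evalAt_opSeries, ← contraction_apply_nil, contraction_mul, Module.End.mul_apply,
    contraction_apply_nil, ← wordTerms_opSeries L (isFiltered_evalAt x)]
  rfl

theorem opSeries_add (δ δ' : Coeff A) : opSeries L (δ + δ') = opSeries L δ + opSeries L δ' := by
  refine LinearMap.ext fun Φ => smoothSeries_ext fun x => MvPowerSeries.ext fun m => ?_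
  rw [coeff_evalAt_opSeries, ← contraction_apply_nil, contraction_add,
    LinearMap.add_apply, Finsupp.add_apply, contraction_apply_nil, contraction_apply_nil]
  rfl

theorem opSeries_zero : opSeries L 0 = 0 := by
  refine LinearMap.ext fun Φ => smoothSeries_ext fun x => MvPowerSeries.ext fun m => ?_
  rw [coeff_evalAt_opSeries]
  exact Finset.sum_eq_zero fun w _ => mul_zero (wordTerms L (evalAt x).toLinearMap m Φ w)

theorem opSeries_one : opSeries L 1 = 1 := by
  refine LinearMap.ext fun Φ => smoothSeries_ext fun x => MvPowerSeries.ext fun m => ?_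
  rw [coeff_evalAt_opSeries, ← contraction_apply_nil, contraction_one]
  rfl

theorem opSeries_apply_one {γ : Coeff A} (hγ : γ [] = 1) : opSeries L γ 1 = 1 := by
  refine smoothSeries_ext fun x => MvPowerSeries.ext fun m => ?_
  rw [coeff_evalAt_opSeries, wordTerms_one, map_smul, pairing_single, hγ, smul_eq_mul, mul_one,
    map_one (evalAt x)]

theorem opSeries_apply_mul_of_mem_groupG {γ : Coeff A} (hγ : γ ∈ groupG A)
    (Φ Ψ : smoothSeries A D) : opSeries L γ (Φ * Ψ) = opSeries L γ Φ * opSeries L γ Ψ := by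
  refine smoothSeries_ext fun x => MvPowerSeries.ext fun m => ?_
  simp only [map_mul, MvPowerSeries.coeff_mul, coeff_evalAt_opSeries, wordTerms_mul, map_sum,
    ← contraction_apply_nil, (mem_groupG_iff.1 hγ).2, shuffleMul_apply_nil]

theorem opSeries_apply_mul_of_mem_lieG {β : Coeff A} (hβ : β ∈ lieG A)
    (Φ Ψ : smoothSeries A D) :
    opSeries L β (Φ * Ψ) = Φ * opSeries L β Ψ + Ψ * opSeries L β Φ := by
  refine smoothSeries_ext fun x => MvPowerSeries.ext fun m => ?_
  rw [mul_comm Ψ, add_comm]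
  simp only [map_mul, map_add, MvPowerSeries.coeff_mul, coeff_evalAt_opSeries, wordTerms_mul,
    map_sum, ← contraction_apply_nil, mem_lieG_iff.1 hβ, shuffleMul_apply_nil, Finsupp.add_apply,
    Finset.sum_add_distrib]
  rfl

/-- The algebra homomorphism attached to an element of `𝒢`. -/
def opSeriesAlgHom {γ : Coeff A} (hγ : γ ∈ groupG A) :
    smoothSeries A D →ₐ[MvPowerSeries A ℂ] smoothSeries A D :=
  AlgHom.ofLinearMap (opSeries L γ) (opSeries_apply_one L hγ.1)
    (opSeries_apply_mul_of_mem_groupG L hγ)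

/-- The derivation attached to an element of `𝔤`. -/
def opSeriesDeriv {β : Coeff A} (hβ : β ∈ lieG A) :
    Derivation (MvPowerSeries A ℂ) (smoothSeries A D) (smoothSeries A D) :=
  Derivation.mk' (opSeries L β) (opSeries_apply_mul_of_mem_lieG L hβ)

end OpSeries

/-! ### Vector fields and changes of variables -/

section Pullback

variable {A : Type*} {D D' : ℕ}

/-- The composition with a smooth map. -/
def pullback (F : (Fin D → ℂ) → Fin D' → ℂ) (hF : ContDiff ℂ (⊤ : ℕ∞) F) :
    smoothSeries A D' →ₐ[MvPowerSeries A ℂ] smoothSeries A D where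
  toFun Φ := ⟨fun x => Φ.1 (F x), fun m => (Φ.2 m).comp hF⟩
  map_add' _ _ := rfl
  map_mul' _ _ := rfl
  map_zero' := rfl
  map_one' := rfl
  commutes' _ := rfl

@[simp] theorem evalAt_pullback {F : (Fin D → ℂ) → Fin D' → ℂ} (hF : ContDiff ℂ (⊤ : ℕ∞) F)
    (Φ : smoothSeries A D') (x : Fin D → ℂ) : evalAt x (pullback F hF Φ) = evalAt (F x) Φ := rfl

theorem fderiv_coeff_pullback {F : (Fin D → ℂ) → Fin D' → ℂ} (hF : ContDiff ℂ (⊤ : ℕ∞) F)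
    (Φ : smoothSeries A D') (m : A →₀ ℕ) (x u : Fin D → ℂ) :
    fderiv ℂ (fun y => (evalAt y (pullback F hF Φ)).coeff m) x u =
      fderiv ℂ (fun y => (evalAt y Φ).coeff m) (F x) (fderiv ℂ F x u) :=
  DFunLike.congr_fun (fderiv_comp x (differentiableAt_coeff_evalAt Φ m (F x))
    (hF.differentiable (by simp) x)) u

/-- The Lie derivative along a smooth vector field. -/
def lieDeriv (V : (Fin D → ℂ) → Fin D → ℂ) (hV : ContDiff ℂ (⊤ : ℕ∞) V) :
    Derivation (MvPowerSeries A ℂ) (smoothSeries A D) (smoothSeries A D) :=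
  fieldDeriv fun i => ofSmooth (fun x => V x i) (contDiff_pi.1 hV i)

theorem lieDeriv_coord {V : (Fin D → ℂ) → Fin D → ℂ} (hV : ContDiff ℂ (⊤ : ℕ∞) V) (i : Fin D) :
    lieDeriv (A := A) V hV (coord i) = ofSmooth (fun x => V x i) (contDiff_pi.1 hV i) :=
  fieldDeriv_coord _ i

theorem coeff_evalAt_lieDeriv {V : (Fin D → ℂ) → Fin D → ℂ} (hV : ContDiff ℂ (⊤ : ℕ∞) V)
    (Φ : smoothSeries A D) (x : Fin D → ℂ) (m : A →₀ ℕ) :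
    (evalAt x (lieDeriv V hV Φ)).coeff m = fderiv ℂ (fun y => (evalAt y Φ).coeff m) x (V x) := by
  simp only [lieDeriv, fieldDeriv_apply, map_sum, map_mul, evalAt_ofSmooth,
    MvPowerSeries.coeff_C_mul, fderiv_coeff_eq_sum]

theorem evalAt_lieDeriv_ofSmooth {V : (Fin D → ℂ) → Fin D → ℂ} (hV : ContDiff ℂ (⊤ : ℕ∞) V)
    {F : (Fin D → ℂ) → ℂ} (hF : ContDiff ℂ (⊤ : ℕ∞) F) (x : Fin D → ℂ) :
    evalAt (A := A) x (lieDeriv V hV (ofSmooth F hF)) = .C (fderiv ℂ F x (V x)) := by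
  classical
  refine MvPowerSeries.ext fun m => ?_
  simp only [coeff_evalAt_lieDeriv, evalAt_ofSmooth, MvPowerSeries.coeff_C]
  split_ifs
  · rfl
  · exact DFunLike.congr_fun (fderiv_const_apply (0 : ℂ)) _

theorem lieDeriv_pullback {F : (Fin D → ℂ) → Fin D' → ℂ} (hF : ContDiff ℂ (⊤ : ℕ∞) F)
    {V : (Fin D → ℂ) → Fin D → ℂ} (hV : ContDiff ℂ (⊤ : ℕ∞) V)
    {W : (Fin D' → ℂ) → Fin D' → ℂ} (hW : ContDiff ℂ (⊤ : ℕ∞) W) {c : ℂ}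
    (h : ∀ x, fderiv ℂ F x (V x) = c • W (F x)) (Φ : smoothSeries A D') :
    lieDeriv V hV (pullback F hF Φ) =
      MvPowerSeries.C (σ := A) c • pullback F hF (lieDeriv W hW Φ) := by
  refine smoothSeries_ext fun x => MvPowerSeries.ext fun m => ?_
  rw [coeff_evalAt_lieDeriv, fderiv_coeff_pullback, h, map_smul, map_smul, smul_eq_mul, smul_eq_mul,
    MvPowerSeries.coeff_C_mul, evalAt_pullback, coeff_evalAt_lieDeriv]

theorem lieDeriv_lieDeriv_of_lieBracket_eq {V W : (Fin D → ℂ) → Fin D → ℂ}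
    (hV : ContDiff ℂ (⊤ : ℕ∞) V) (hW : ContDiff ℂ (⊤ : ℕ∞) W) {c : ℂ}
    (h : ∀ x, VectorField.lieBracket ℂ V W x = c • W x) (Φ : smoothSeries A D) :
    lieDeriv V hV (lieDeriv W hW Φ) =
      lieDeriv W hW (lieDeriv V hV Φ) + MvPowerSeries.C (σ := A) c • lieDeriv W hW Φ := by
  suffices ⁅lieDeriv (A := A) V hV, lieDeriv W hW⁆ =
      MvPowerSeries.C (σ := A) c • lieDeriv W hW from
    sub_eq_iff_eq_add'.1 ((Derivation.commutator_apply ..).symm.trans (DFunLike.congr_fun this Φ))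
  refine derivation_ext_coord fun i => smoothSeries_ext fun x => ?_
  have hfderiv {U : (Fin D → ℂ) → Fin D → ℂ} (hU : ContDiff ℂ (⊤ : ℕ∞) U) (u : Fin D → ℂ) :
      fderiv ℂ (fun y => U y i) x u = fderiv ℂ U x u i :=
    DFunLike.congr_fun (fderiv_apply (hU.differentiable (by simp) x) i) u
  rw [Derivation.commutator_apply, Derivation.smul_apply, map_smul, map_sub]
  simp only [lieDeriv_coord, evalAt_lieDeriv_ofSmooth, evalAt_ofSmooth, hfderiv hV, hfderiv hW]
  rw [← map_sub, smul_eq_mul, ← map_mul]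
  exact congrArg _ (congrFun (h x) i)

end Pullback

section FormalMaps

variable {A : Type*} {D : ℕ}

theorem coordSeries_injective {p q : FormalPoint A D}
    (h : ∀ i, coordSeries p i = coordSeries q i) : p = q :=
  funext fun m => funext fun i => congrFun (h i) m

variable [DecidableEq A]

theorem isSmooth_mapSeries {F : (Fin D → ℂ) → Fin D → ℂ} (hF : ContDiff ℂ (⊤ : ℕ∞) F) :
    IsSmooth (mapSeries F : FormalMap A D) := fun m => by
  unfold mapSeries pointSeries
  split_ifs
  exacts [hF, contDiff_const]

theorem coordSeries_pointSeries (x : Fin D → ℂ) (i : Fin D) :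
    coordSeries (A := A) (pointSeries x) i = .C (x i) := by
  rw [← evalSeries_coord, evalSeries_pointSeries, evalAt_coord]

theorem component_mapSeries {F : (Fin D → ℂ) → Fin D → ℂ} (hF : ContDiff ℂ (⊤ : ℕ∞) F)
    (i : Fin D) : component (A := A) (mapSeries F) (isSmooth_mapSeries hF) i =
      ofSmooth (fun x => F x i) (contDiff_pi.1 hF i) :=
  smoothSeries_ext fun x => coordSeries_pointSeries (F x) i

theorem fieldDeriv_component_mapSeries {V : (Fin D → ℂ) → Fin D → ℂ}
    (hV : ContDiff ℂ (⊤ : ℕ∞) V) :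
    fieldDeriv (component (A := A) (mapSeries V) (isSmooth_mapSeries hV)) = lieDeriv V hV :=
  congrArg fieldDeriv (funext fun i => component_mapSeries hV i)

theorem coordSeries_subst_mapSeries {F : (Fin D → ℂ) → Fin D → ℂ} (hF : ContDiff ℂ (⊤ : ℕ∞) F)
    (p : FormalPoint A D) (i : Fin D) : coordSeries (subst (mapSeries F) p) i =
      evalSeries p (ofSmooth (fun x => F x i) (contDiff_pi.1 hF i)) := by
  rw [coordSeries_subst (isSmooth_mapSeries hF), component_mapSeries hF]

theorem subst_pointSeries {Φ : FormalMap A D} (hΦ : IsSmooth Φ) (x : Fin D → ℂ) :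
    subst Φ (pointSeries x) = Φ x := coordSeries_injective fun i => by
  rw [coordSeries_subst hΦ, evalSeries_pointSeries, evalAt_component]

theorem evalSeries_subst {Φ : FormalMap A D} (hΦ : IsSmooth Φ)
    {S : smoothSeries A D →ₐ[MvPowerSeries A ℂ] smoothSeries A D}
    (hS : ∀ i, S (coord i) = component Φ hΦ i) (p : FormalPoint A D) :
    evalSeries (subst Φ p) = (evalSeries p).comp S := algHom_ext_coord fun i => by
  rw [evalSeries_coord, coordSeries_subst hΦ, AlgHom.comp_apply, hS]

theorem evalSeries_subst_mapSeries {F : (Fin D → ℂ) → Fin D → ℂ} (hF : ContDiff ℂ (⊤ : ℕ∞) F)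
    (p : FormalPoint A D) :
    evalSeries (subst (mapSeries F) p) = (evalSeries p).comp (pullback F hF) :=
  evalSeries_subst (isSmooth_mapSeries hF) (fun i => (component_mapSeries hF i).symm) p

end FormalMaps

section WordSeriesOperators

variable {A : Type*} {D : ℕ} {f : A → (Fin D → ℂ) → Fin D → ℂ}
  (hf : ∀ ℓ, ContDiff ℂ (⊤ : ℕ∞) (f ℓ))

include hf in
theorem contDiff_wordFun (w : List A) : ContDiff ℂ (⊤ : ℕ∞) (wordFun f w) := by
  induction w with
  | nil => exact contDiff_id
  | cons ℓ w ih => exact (ih.fderiv_right (m := (⊤ : ℕ∞)) (by simp)).clm_apply (hf ℓ)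

/-- The Lie derivatives along the fields `f_ℓ`. -/
def letterDeriv (ℓ : A) :
    Derivation (MvPowerSeries A ℂ) (smoothSeries A D) (smoothSeries A D) :=
  lieDeriv (f ℓ) (hf ℓ)

variable [DecidableEq A]

include hf in
theorem isSmooth_wordSeries (δ : Coeff A) : IsSmooth (wordSeries f δ) := fun _ =>
  ContDiff.sum (𝕜 := ℂ) (f := fun w x => δ w • wordFun f w x) fun w _ =>
    (contDiff_wordFun hf w).const_smul (δ w)

theorem evalAt_wordOp_coord (w : List A) (i : Fin D) (x : Fin D → ℂ) :
    evalAt x (wordOp (letterDeriv hf) w (coord i)) =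
      MvPowerSeries.monomial (content w) (wordFun f w x i) := by
  suffices wordOp (letterDeriv hf) w (coord i) = MvPowerSeries.monomial (content w) (1 : ℂ) •
      ofSmooth (fun x => wordFun f w x i) (contDiff_pi.1 (contDiff_wordFun hf w) i) by
    rw [this, map_smul, evalAt_ofSmooth, smul_eq_mul, ← MvPowerSeries.monomial_zero_eq_C_apply,
      MvPowerSeries.monomial_mul_monomial, add_zero, one_mul]
  induction w with
  | nil => exact (one_smul _ _).symm
  | cons ℓ w ih =>
    have hletter : letterDeriv hf ℓ (ofSmooth (fun x => wordFun f w x i)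
          (contDiff_pi.1 (contDiff_wordFun hf w) i)) =
        ofSmooth (fun x => wordFun f (ℓ :: w) x i)
          (contDiff_pi.1 (contDiff_wordFun hf (ℓ :: w)) i) := smoothSeries_ext fun x => by
      rw [letterDeriv, evalAt_lieDeriv_ofSmooth, evalAt_ofSmooth, fderiv_apply
        ((contDiff_wordFun hf w).differentiable (by simp) x)]
      rfl
    rw [wordOp_cons, ih, Derivation.map_smul, hletter, smul_smul, MvPowerSeries.X,
      MvPowerSeries.monomial_mul_monomial, one_mul, content_cons]

theorem component_wordSeries (δ : Coeff A) (i : Fin D) :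
    component (wordSeries f δ) (isSmooth_wordSeries hf δ) i =
      opSeries (letterDeriv hf) δ (coord i) := by
  refine smoothSeries_ext fun x => MvPowerSeries.ext fun m => ?_
  rw [evalAt_component, coeff_coordSeries, coeff_evalAt_opSeries, pairing_wordTerms, wordSeries,
    Finset.sum_apply]
  refine Finset.sum_subset_zero_on_sdiff (fun w hw => ?_) (fun w hw => ?_) fun w hw => ?_
  · exact mem_wordsLE.2 (mem_lists_toMultiset.1 hw).le
  · rw [Finset.mem_sdiff, mem_lists_toMultiset] at hw
    exact mul_eq_zero_of_right _ ((congrArg _ (evalAt_wordOp_coord hf w i x)).trans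
      (MvPowerSeries.coeff_monomial_ne (Ne.symm hw.2) _))
  · rw [mem_lists_toMultiset] at hw
    subst hw
    exact congrArg (δ w * ·) ((congrArg _ (evalAt_wordOp_coord hf w i x)).trans
      (MvPowerSeries.coeff_monomial_same _ _)).symm

end WordSeriesOperators

section WordSeriesComposition

variable {A : Type*} [DecidableEq A] {D : ℕ} {f : A → (Fin D → ℂ) → Fin D → ℂ}
  (hf : ∀ ℓ, ContDiff ℂ (⊤ : ℕ∞) (f ℓ))

theorem coordSeries_subst_wordSeries (δ : Coeff A) (p : FormalPoint A D) (i : Fin D) :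
    coordSeries (subst (wordSeries f δ) p) i =
      evalSeries p (opSeries (letterDeriv hf) δ (coord i)) := by
  rw [coordSeries_subst (isSmooth_wordSeries hf δ), component_wordSeries]

theorem evalSeries_subst_wordSeries {γ : Coeff A} (hγ : γ ∈ groupG A) (p : FormalPoint A D) :
    evalSeries (subst (wordSeries f γ) p) =
      (evalSeries p).comp (opSeriesAlgHom (letterDeriv hf) hγ) :=
  evalSeries_subst (isSmooth_wordSeries hf γ) (fun i => (component_wordSeries hf γ i).symm) p

theorem evalSeries_wordSeries {γ : Coeff A} (hγ : γ ∈ groupG A) (x : Fin D → ℂ) :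
    evalSeries (wordSeries f γ x) = (evalAt x).comp (opSeriesAlgHom (letterDeriv hf) hγ) := by
  rw [← subst_pointSeries (isSmooth_wordSeries hf γ), evalSeries_subst_wordSeries hf hγ,
    evalSeries_pointSeries]

include hf in
theorem subst_wordSeries_subst_wordSeries (δ : Coeff A) {γ : Coeff A} (hγ : γ ∈ groupG A)
    (p : FormalPoint A D) :
    subst (wordSeries f δ) (subst (wordSeries f γ) p) = subst (wordSeries f (γ * δ)) p :=
  coordSeries_injective fun i => by
    rw [coordSeries_subst_wordSeries hf, coordSeries_subst_wordSeries hf,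
      evalSeries_subst_wordSeries hf hγ, opSeries_mul]
    rfl

include hf in
theorem subst_wordSeries_one (p : FormalPoint A D) : subst (wordSeries f 1) p = p :=
  coordSeries_injective fun i => by
    rw [coordSeries_subst_wordSeries hf, opSeries_one, Module.End.one_apply, evalSeries_coord]

include hf in
theorem isChangeOfVariables_wordSeries {κ : (Coeff A)ˣ} (hκ : (κ : Coeff A) ∈ groupG A) :
    IsChangeOfVariables (wordSeries f (κ : Coeff A)) := by
  refine ⟨isSmooth_wordSeries hf _, wordSeries f ↑κ⁻¹, isSmooth_wordSeries hf _, fun p => ⟨?_, ?_⟩⟩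
  · rw [subst_wordSeries_subst_wordSeries hf _ hκ, Units.mul_inv, subst_wordSeries_one hf]
  · rw [subst_wordSeries_subst_wordSeries hf _ (inv_mem_groupG hκ), Units.inv_mul,
      subst_wordSeries_one hf]

theorem fieldDeriv_component_wordSeries {β : Coeff A} (hβ : β ∈ lieG A) :
    fieldDeriv (component (wordSeries f β) (isSmooth_wordSeries hf β)) =
      opSeriesDeriv (letterDeriv hf) hβ := derivation_ext_coord fun i => by
  rw [fieldDeriv_coord, component_wordSeries]
  rfl

theorem coordSeries_jacobianMul_wordSeries {Φ : FormalMap A D} (hΦ : IsSmooth Φ) {β : Coeff A}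
    (hβ : β ∈ lieG A) (x : Fin D → ℂ) (i : Fin D) :
    coordSeries (jacobianMul Φ (wordSeries f β) x) i =
      evalAt x (opSeries (letterDeriv hf) β (component Φ hΦ i)) := by
  rw [coordSeries_jacobianMul hΦ (isSmooth_wordSeries hf β),
    fieldDeriv_component_wordSeries hf hβ]
  rfl

theorem coordSeries_jacobianMul_mapSeries {Φ : FormalMap A D} (hΦ : IsSmooth Φ)
    {V : (Fin D → ℂ) → Fin D → ℂ} (hV : ContDiff ℂ (⊤ : ℕ∞) V) (x : Fin D → ℂ) (i : Fin D) :
    coordSeries (jacobianMul Φ (mapSeries V) x) i =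
      evalAt x (lieDeriv V hV (component Φ hΦ i)) := by
  rw [coordSeries_jacobianMul hΦ (isSmooth_mapSeries hV), fieldDeriv_component_mapSeries hV]

end WordSeriesComposition

section EigenDerivation

variable {A : Type*} {D D' : ℕ}
  {L : A → Derivation (MvPowerSeries A ℂ) (smoothSeries A D) (smoothSeries A D)}
  {L' : A → Derivation (MvPowerSeries A ℂ) (smoothSeries A D') (smoothSeries A D')}

theorem derivation_wordOp {S : Derivation (MvPowerSeries A ℂ) (smoothSeries A D) (smoothSeries A D)}
    {c : A → ℂ}
    (h : ∀ ℓ Φ, S (L ℓ Φ) = L ℓ (S Φ) + MvPowerSeries.C (σ := A) (c ℓ) • L ℓ Φ) (w : List A)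
    (Φ : smoothSeries A D) : S (wordOp L w Φ) =
      wordOp L w (S Φ) + MvPowerSeries.C (σ := A) (w.map c).sum • wordOp L w Φ := by
  induction w with
  | nil => simp [wordOp_nil]
  | cons ℓ w ih =>
    rw [wordOp_cons, wordOp_cons, S.map_smul, h, ih, map_add, (L ℓ).map_smul, List.map_cons,
      List.sum_cons, map_add]
    simp only [smul_add, add_smul, smul_comm (MvPowerSeries.X (R := ℂ) ℓ)]
    abel

theorem wordOp_pullback {F : (Fin D → ℂ) → Fin D' → ℂ} (hF : ContDiff ℂ (⊤ : ℕ∞) F) {c : A → ℂ}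
    (h : ∀ ℓ Φ, L ℓ (pullback F hF Φ) =
      MvPowerSeries.C (σ := A) (c ℓ) • pullback F hF (L' ℓ Φ)) (w : List A)
    (Φ : smoothSeries A D') : wordOp L w (pullback F hF Φ) =
      MvPowerSeries.C (σ := A) (w.map c).prod • pullback F hF (wordOp L' w Φ) := by
  induction w with
  | nil => simp [wordOp_nil]
  | cons ℓ w ih =>
    rw [wordOp_cons, wordOp_cons, ih, (L ℓ).map_smul, h, map_smul, List.map_cons, List.prod_cons,
      mul_comm, map_mul, mul_smul, smul_comm, smul_comm (MvPowerSeries.X (R := ℂ) ℓ)]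

variable [DecidableEq A]

theorem derivation_opSeries
    {S : Derivation (MvPowerSeries A ℂ) (smoothSeries A D) (smoothSeries A D)} {c : A → ℂ}
    (h : ∀ ℓ Φ, S (L ℓ Φ) = L ℓ (S Φ) + MvPowerSeries.C (σ := A) (c ℓ) • L ℓ Φ)
    {δ δ' : Coeff A} (hδ : ∀ w, δ' w = (w.map c).sum * δ w) (Φ : smoothSeries A D) :
    S (opSeries L δ Φ) = opSeries L δ (S Φ) + opSeries L δ' Φ := by
  refine smoothSeries_ext fun x => MvPowerSeries.ext fun m => ?_
  have hS := ((isFiltered_evalAt x).comp_derivation S).coeff_opSeries (L := L) δ m Φ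
  rw [pairing_wordTerms] at hS
  refine hS.trans ?_
  rw [map_add, map_add, coeff_evalAt_opSeries, coeff_evalAt_opSeries, pairing_wordTerms,
    pairing_wordTerms, ← Finset.sum_add_distrib]
  refine Finset.sum_congr rfl fun w _ => ?_
  simp only [LinearMap.comp_apply, AlgHom.toLinearMap_apply, Derivation.coeFn_coe,
    derivation_wordOp h, hδ, map_add, map_smul, smul_eq_mul, MvPowerSeries.coeff_C_mul]
  ring

theorem opSeries_pullback {F : (Fin D → ℂ) → Fin D' → ℂ} (hF : ContDiff ℂ (⊤ : ℕ∞) F) {c : A → ℂ}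
    (h : ∀ ℓ Φ, L ℓ (pullback F hF Φ) =
      MvPowerSeries.C (σ := A) (c ℓ) • pullback F hF (L' ℓ Φ)) {δ δ' : Coeff A}
    (hδ : ∀ w, δ' w = (w.map c).prod * δ w) (Φ : smoothSeries A D') :
    opSeries L δ (pullback F hF Φ) = pullback F hF (opSeries L' δ' Φ) := by
  refine smoothSeries_ext fun x => MvPowerSeries.ext fun m => ?_
  rw [evalAt_pullback, coeff_evalAt_opSeries, coeff_evalAt_opSeries, pairing_wordTerms,
    pairing_wordTerms]
  refine Finset.sum_congr rfl fun w _ => ?_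
  simp only [AlgHom.toLinearMap_apply, wordOp_pullback hF h, hδ, map_smul, evalAt_pullback,
    smul_eq_mul, MvPowerSeries.coeff_C_mul]
  ring

end EigenDerivation

section NormalForm

variable {A : Type*} {d D : ℕ} {ν : Fin d → A → ℂ} {g : Fin d → (Fin D → ℂ) → Fin D → ℂ}
  {f : A → (Fin D → ℂ) → Fin D → ℂ}

theorem contDiff_gField (hg : ∀ j, ContDiff ℂ (⊤ : ℕ∞) (g j)) (v : Fin d → ℂ) :
    ContDiff ℂ (⊤ : ℕ∞) (gField g v) :=
  ContDiff.sum (f := fun j x => v j • g j x) fun j _ => (hg j).const_smul (v j)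

theorem lieBracket_gField (hg : ∀ j, ContDiff ℂ (⊤ : ℕ∞) (g j))
    (heig : ∀ j ℓ x, VectorField.lieBracket ℂ (g j) (f ℓ) x = ν j ℓ • f ℓ x) (v : Fin d → ℂ)
    (ℓ : A) (x : Fin D → ℂ) :
    VectorField.lieBracket ℂ (gField g v) (f ℓ) x = (∑ j, v j * ν j ℓ) • f ℓ x := by
  have hfderiv : fderiv ℂ (gField g v) x = ∑ j, v j • fderiv ℂ (g j) x :=
    HasFDerivAt.fderiv (HasFDerivAt.fun_sum fun j _ =>
      (((hg j).differentiable (by simp) x).hasFDerivAt.const_smul (v j)))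
  rw [VectorField.lieBracket, hfderiv, gField, map_sum, sum_apply, ← Finset.sum_sub_distrib,
    Finset.sum_smul]
  refine Finset.sum_congr rfl fun j _ => ?_
  rw [map_smul, smul_apply, ← smul_sub, mul_smul, ← heig j ℓ x, VectorField.lieBracket]

theorem lieDeriv_opSeries_letterDeriv [DecidableEq A] (hg : ∀ j, ContDiff ℂ (⊤ : ℕ∞) (g j))
    (hf : ∀ ℓ, ContDiff ℂ (⊤ : ℕ∞) (f ℓ))
    (heig : ∀ j ℓ x, VectorField.lieBracket ℂ (g j) (f ℓ) x = ν j ℓ • f ℓ x) (v : Fin d → ℂ)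
    (δ : Coeff A) (Φ : smoothSeries A D) :
    lieDeriv (gField g v) (contDiff_gField hg v) (opSeries (letterDeriv hf) δ Φ) =
      opSeries (letterDeriv hf) δ (lieDeriv (gField g v) (contDiff_gField hg v) Φ) +
        opSeries (letterDeriv hf) (xi ν v δ) Φ :=
  derivation_opSeries (fun ℓ Φ => lieDeriv_lieDeriv_of_lieBracket_eq (contDiff_gField hg v) (hf ℓ)
    (lieBracket_gField hg heig v ℓ) Φ) (fun _ => rfl) Φ

variable [DecidableEq A]

theorem jacobianMul_add_right (Φ V W : FormalMap A D) :
    jacobianMul Φ (V + W) = jacobianMul Φ V + jacobianMul Φ W := by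
  funext x m
  exact (Finset.sum_congr rfl fun ab _ => (fderiv ℂ (fun y => Φ y ab.1) x).map_add _ _).trans
    Finset.sum_add_distrib

theorem subst_add {Φ Ψ : FormalMap A D} (hΦ : IsSmooth Φ) (hΨ : IsSmooth Ψ)
    (p : FormalPoint A D) : subst (Φ + Ψ) p = subst Φ p + subst Ψ p :=
  coordSeries_injective fun i => by
    have hΦΨ : IsSmooth (Φ + Ψ) := fun m => (hΦ m).add (hΨ m)
    have hcomponent : component (Φ + Ψ) hΦΨ i = component Φ hΦ i + component Ψ hΨ i := rfl
    rw [coordSeries_subst hΦΨ, hcomponent, map_add, ← coordSeries_subst, ← coordSeries_subst]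
    rfl

theorem subst_extField (hg : ∀ j, ContDiff ℂ (⊤ : ℕ∞) (g j))
    (hf : ∀ ℓ, ContDiff ℂ (⊤ : ℕ∞) (f ℓ)) (v : Fin d → ℂ) (β : Coeff A) (p : FormalPoint A D) :
    subst (extField g f (v, β)) p =
      subst (mapSeries (gField g v)) p + subst (wordSeries f β) p :=
  subst_add (isSmooth_mapSeries (contDiff_gField hg v)) (isSmooth_wordSeries hf β) p

theorem formalBracket_gField_wordSeries (hg : ∀ j, ContDiff ℂ (⊤ : ℕ∞) (g j))
    (hf : ∀ ℓ, ContDiff ℂ (⊤ : ℕ∞) (f ℓ))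
    (heig : ∀ j ℓ x, VectorField.lieBracket ℂ (g j) (f ℓ) x = ν j ℓ • f ℓ x) (v : Fin d → ℂ)
    {β : Coeff A} (hβ : β ∈ lieG A) :
    formalBracket (mapSeries (gField g v)) (wordSeries f β) = wordSeries f (xi ν v β) := by
  refine funext fun x => coordSeries_injective fun i => ?_
  have hG := contDiff_gField hg v
  change coordSeries (jacobianMul (wordSeries f β) (mapSeries (gField g v)) x) i -
    coordSeries (jacobianMul (mapSeries (gField g v)) (wordSeries f β) x) i = _
  rw [coordSeries_jacobianMul_mapSeries (isSmooth_wordSeries hf β) hG,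
    coordSeries_jacobianMul_wordSeries hf (isSmooth_mapSeries hG) hβ, component_mapSeries hG,
    component_wordSeries hf, lieDeriv_opSeries_letterDeriv hg hf heig, map_add, lieDeriv_coord,
    add_sub_cancel_left, ← component_wordSeries, evalAt_component]

theorem transformsInto_of_gauge (hg : ∀ j, ContDiff ℂ (⊤ : ℕ∞) (g j))
    (hf : ∀ ℓ, ContDiff ℂ (⊤ : ℕ∞) (f ℓ))
    (heig : ∀ j ℓ x, VectorField.lieBracket ℂ (g j) (f ℓ) x = ν j ℓ • f ℓ x) (v : Fin d → ℂ)
    {κ : (Coeff A)ˣ} (hκ : (κ : Coeff A) ∈ groupG A) {β : Coeff A} (hβ : β ∈ lieG A) :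
    TransformsInto (wordSeries f (κ : Coeff A)) (extField g f (v, β))
      (extField g f (v, gaugeAction ν v κ β)) := by
  have hG := contDiff_gField hg v
  refine ⟨isChangeOfVariables_wordSeries hf hκ, fun x => coordSeries_injective fun i => ?_⟩
  rw [subst_extField hg hf, extField, jacobianMul_add_right]
  change coordSeries (jacobianMul (wordSeries f κ) (mapSeries (gField g v)) x) i +
      coordSeries (jacobianMul (wordSeries f κ) (wordSeries f (gaugeAction ν v κ β)) x) i =
    coordSeries (subst (mapSeries (gField g v)) (wordSeries f κ x)) i +
      coordSeries (subst (wordSeries f β) (wordSeries f κ x)) i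
  rw [coordSeries_jacobianMul_mapSeries (isSmooth_wordSeries hf _) hG,
    coordSeries_jacobianMul_wordSeries hf (isSmooth_wordSeries hf _)
      (gaugeAction_mem_lieG ν v hκ hβ),
    component_wordSeries hf, lieDeriv_opSeries_letterDeriv hg hf heig,
    coordSeries_subst_mapSeries hG, coordSeries_subst_wordSeries hf, evalSeries_wordSeries hf hκ,
    ← lieDeriv_coord hG, map_add, add_assoc, ← map_add]
  have hgauge : opSeries (letterDeriv hf) (xi ν v κ) +
        opSeries (letterDeriv hf) (gaugeAction ν v κ β) * opSeries (letterDeriv hf) κ =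
      opSeries (letterDeriv hf) κ * opSeries (letterDeriv hf) β := by
    rw [← opSeries_mul, ← opSeries_mul, gaugeAction_mul_self, ← opSeries_add, add_sub_cancel]
  exact congrArg (_ + evalAt x ·) (LinearMap.congr_fun hgauge (coord i))

end NormalForm

/-! ### Flows -/

section Flows

theorem eq_of_hasDerivAt_real {E : Type*} [NormedAddCommGroup E] [NormedSpace ℝ E] {G : E → E}
    (hG : LocallyLipschitz G) {a b : ℝ → E} (ha : ∀ t, HasDerivAt a (G (a t)) t)
    (hb : ∀ t, HasDerivAt b (G (b t)) t) (h0 : a 0 = b 0) : a = b := by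
  funext t
  have hac : Continuous a := continuous_iff_continuousAt.2 fun t => (ha t).continuousAt
  have hbc : Continuous b := continuous_iff_continuousAt.2 fun t => (hb t).continuousAt
  set I := Set.Icc (-(|t| + 1)) (|t| + 1)
  obtain ⟨C, hC⟩ := hG.locallyLipschitzOn.exists_lipschitzOnWith_of_compact
    ((isCompact_Icc.image hac).union (isCompact_Icc.image hbc) : IsCompact (a '' I ∪ b '' I))
  have hsub : Set.Ioo (-(|t| + 1)) (|t| + 1) ⊆ I := Set.Ioo_subset_Icc_self
  have hpos : (0 : ℝ) < |t| + 1 := by positivity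
  exact ODE_solution_unique_of_mem_Ioo (v := fun _ => G) (s := fun _ => a '' I ∪ b '' I)
    (t₀ := 0) (fun _ _ => hC) ⟨neg_neg_of_pos hpos, hpos⟩
    (fun s hs => ⟨ha s, Or.inl ⟨s, hsub hs, rfl⟩⟩) (fun s hs => ⟨hb s, Or.inr ⟨s, hsub hs, rfl⟩⟩)
    h0 ⟨by linarith [neg_abs_le t], by linarith [le_abs_self t]⟩

variable {E : Type*} [NormedAddCommGroup E] [NormedSpace ℂ E]

theorem eq_of_hasDerivAt {G : E → E} (hG : ContDiff ℂ (⊤ : ℕ∞) G) {a b : ℂ → E}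
    (ha : ∀ t, HasDerivAt a (G (a t)) t) (hb : ∀ t, HasDerivAt b (G (b t)) t)
    (h0 : a 0 = b 0) : a = b := by
  funext z
  have hray {c : ℂ → E} (hc : ∀ t, HasDerivAt c (G (c t)) t) (r : ℝ) :
      HasDerivAt (fun r : ℝ => c (r * z)) (z • G (c (r * z))) r :=
    (hc (r * z)).scomp r (by simpa using (Complex.ofRealCLM.hasDerivAt (x := r)).mul_const z)
  have hlip : LocallyLipschitz fun x => z • G x :=
    ((hG.of_le (by exact_mod_cast le_top)).const_smul z).locallyLipschitz
  simpa using congrFun (eq_of_hasDerivAt_real hlip (hray ha) (hray hb) (by simpa using h0)) 1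

/-- The complex-time flow `P` of the vector field `V`, globally defined and smooth. -/
structure IsComplexFlow (V : E → E) (P : ℂ → E → E) : Prop where
  smooth : ContDiff ℂ (⊤ : ℕ∞) fun z : ℂ × E => P z.1 z.2
  zero : ∀ x, P 0 x = x
  deriv : ∀ x t, HasDerivAt (fun s => P s x) (V (P t x)) t

namespace IsComplexFlow

variable {V : E → E} {P : ℂ → E → E}

theorem contDiff (hP : IsComplexFlow V P) (t : ℂ) : ContDiff ℂ (⊤ : ℕ∞) (P t) :=
  hP.smooth.comp (contDiff_const.prodMk contDiff_id)

theorem fderiv_uncurry (hP : IsComplexFlow V P) (t τ : ℂ) (x u : E) :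
    fderiv ℂ (fun z : ℂ × E => P z.1 z.2) (t, x) (τ, u) = τ • V (P t x) + fderiv ℂ (P t) x u := by
  have hK := (hP.smooth.differentiable (by simp) (t, x)).hasFDerivAt
  have htime : HasDerivAt (fun s => P s x)
      (fderiv ℂ (fun z : ℂ × E => P z.1 z.2) (t, x) (1, 0)) t :=
    HasFDerivAt.comp_hasDerivAt (f := fun s => (s, x)) t hK
      ((hasDerivAt_id t).prodMk (hasDerivAt_const t x))
  have hspace : HasFDerivAt (P t) ((fderiv ℂ (fun z : ℂ × E => P z.1 z.2) (t, x)).comp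
      ((0 : E →L[ℂ] ℂ).prod (.id ℂ E))) x :=
    hK.comp x ((hasFDerivAt_const t x).prodMk (hasFDerivAt_id x))
  have hsplit : ((τ, u) : ℂ × E) = τ • (1, 0) + (0, u) := by simp
  rw [hsplit, map_add, map_smul, htime.unique (hP.deriv x t), hspace.fderiv]
  rfl

theorem hasDerivAt_fderiv (hV : ContDiff ℂ (⊤ : ℕ∞) V) (hP : IsComplexFlow V P) (x u : E) (t : ℂ) :
    HasDerivAt (fun s => fderiv ℂ (P s) x u) (fderiv ℂ V (P t x) (fderiv ℂ (P t) x u)) t := by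
  let K' := fderiv ℂ fun z : ℂ × E => P z.1 z.2
  have hK' : HasFDerivAt K' (fderiv ℂ K' (t, x)) (t, x) :=
    ((hP.smooth.fderiv_right (m := (⊤ : ℕ∞)) (by simp)).differentiable (by simp) _).hasFDerivAt
  have hsymm : fderiv ℂ K' (t, x) (1, 0) (0, u) = fderiv ℂ K' (t, x) (0, u) (1, 0) :=
    hP.smooth.contDiffAt.isSymmSndFDerivAt
      (by simpa using WithTop.coe_le_coe.2 (le_top (a := (2 : ℕ∞)))) _ _
  have htime : HasDerivAt (fun s => K' (s, x) (0, u)) (fderiv ℂ K' (t, x) (1, 0) (0, u)) t := by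
    have h := hK'.comp_hasDerivAt t ((hasDerivAt_id t).prodMk (hasDerivAt_const t x))
    simpa using h.clm_apply (hasDerivAt_const t ((0, u) : ℂ × E))
  have hspace : HasDerivAt (fun s : ℂ => K' (t, x + s • u) (1, 0))
      (fderiv ℂ K' (t, x) (0, u) (1, 0)) 0 := by
    have hline : HasDerivAt (fun s : ℂ => (t, x + s • u)) (0, u) 0 := by
      simpa using (hasDerivAt_const (0 : ℂ) t).prodMk
        (((hasDerivAt_id (0 : ℂ)).smul_const u).const_add x)
    have h := HasFDerivAt.comp_hasDerivAt (0 : ℂ) (by simpa using hK') hline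
    simpa using h.clm_apply (hasDerivAt_const (0 : ℂ) ((1, 0) : ℂ × E))
  have hflow : HasDerivAt (fun s : ℂ => V (P t (x + s • u)))
      (fderiv ℂ V (P t x) (fderiv ℂ (P t) x u)) 0 := by
    have hline : HasDerivAt (fun s : ℂ => x + s • u) u 0 := by
      simpa using ((hasDerivAt_id (0 : ℂ)).smul_const u).const_add x
    have hVP : HasFDerivAt (V ∘ P t) ((fderiv ℂ V (P t x)).comp (fderiv ℂ (P t) x))
        (x + (0 : ℂ) • u) := by
      rw [zero_smul, add_zero]
      exact (hV.differentiable (by simp) (P t x)).hasFDerivAt.comp x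
        ((hP.contDiff t).differentiable (by simp) x).hasFDerivAt
    exact HasFDerivAt.comp_hasDerivAt (f := fun s : ℂ => x + s • u) 0 hVP hline
  have htransport (y : E) : K' (t, y) (1, 0) = V (P t y) := by
    simp [K', hP.fderiv_uncurry]
  simp only [htransport] at hspace
  rw [hsymm, hspace.unique hflow] at htime
  simpa [K', hP.fderiv_uncurry] using htime

theorem fderiv_eigenfield (hV : ContDiff ℂ (⊤ : ℕ∞) V) (hP : IsComplexFlow V P) {f : E → E}
    (hf : ContDiff ℂ (⊤ : ℕ∞) f) {c : ℂ}
    (h : ∀ x, VectorField.lieBracket ℂ V f x = c • f x) (t : ℂ) (x : E) :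
    fderiv ℂ (P t) x (f x) = Complex.exp (-(c * t)) • f (P t x) := by
  have hG : ContDiff ℂ (⊤ : ℕ∞) fun z : E × E => (V z.1, fderiv ℂ V z.1 z.2) :=
    (hV.comp contDiff_fst).prodMk
      (((hV.fderiv_right (m := (⊤ : ℕ∞)) (by simp)).comp contDiff_fst).clm_apply contDiff_snd)
  have hright (t : ℂ) : HasDerivAt (fun s => Complex.exp (-(c * s)) • f (P s x))
      (fderiv ℂ V (P t x) (Complex.exp (-(c * t)) • f (P t x))) t := by
    have hexp : HasDerivAt (fun s => Complex.exp (-(c * s))) (Complex.exp (-(c * t)) * -c) t := by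
      simpa using (((hasDerivAt_id t).const_mul c).neg).cexp
    have hfP : HasDerivAt (fun s => f (P s x)) (fderiv ℂ f (P t x) (V (P t x))) t :=
      ((hf.differentiable (by simp) _).hasFDerivAt.comp_hasDerivAt t (hP.deriv x t))
    refine (hexp.smul hfP).congr_deriv ?_
    rw [sub_eq_iff_eq_add.1 (h (P t x)), map_smul]
    module
  have h0 : fderiv ℂ (P 0) x = .id ℂ E := by
    rw [show P 0 = id from funext hP.zero, fderiv_id]
  exact congrArg Prod.snd (congrFun (eq_of_hasDerivAt hG
    (fun t => (hP.deriv x t).prodMk (hP.hasDerivAt_fderiv hV x (f x) t))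
    (fun t => (hP.deriv x t).prodMk (hright t)) (by simp [h0, hP.zero])) t)

theorem fderiv_self (hV : ContDiff ℂ (⊤ : ℕ∞) V) (hP : IsComplexFlow V P) (t : ℂ) (x : E) :
    fderiv ℂ (P t) x (V x) = V (P t x) := by
  simpa using hP.fderiv_eigenfield hV hV (c := 0) (fun x => by simp [VectorField.lieBracket]) t x

end IsComplexFlow

/-- The differential equation extends from real to complex times by the identity theorem. -/
theorem IsFlow.isComplexFlow {d D : ℕ} {g : Fin d → (Fin D → ℂ) → Fin D → ℂ}
    {φ : (Fin d → ℂ) → (Fin D → ℂ) → Fin D → ℂ} (hg : ∀ j, ContDiff ℂ (⊤ : ℕ∞) (g j))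
    (hφ : IsFlow g φ) (v : Fin d → ℂ) : IsComplexFlow (gField g v) fun t => φ (t • v) where
  smooth := hφ.smooth.comp ((contDiff_fst.smul contDiff_const).prodMk contDiff_snd)
  zero x := by rw [zero_smul, hφ.zero]
  deriv x := by
    have hsmooth : ContDiff ℂ (⊤ : ℕ∞) fun t : ℂ => φ (t • v) x :=
      hφ.smooth.comp ((contDiff_id.smul contDiff_const).prodMk contDiff_const)
    have hfield : ContDiff ℂ (⊤ : ℕ∞) fun t : ℂ => gField g v (φ (t • v) x) :=
      (contDiff_gField hg v).comp hsmooth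
    have hderiv (t : ℂ) := (hsmooth.differentiable (by simp) t).hasDerivAt
    have hreal (t : ℝ) :
        _root_.deriv (fun t : ℂ => φ (t • v) x) t = gField g v (φ ((t : ℂ) • v) x) :=
      (((hderiv t).scomp t Complex.ofRealCLM.hasDerivAt).congr_deriv (by simp)).unique
        (hφ.deriv v x t)
    have hfrequently : ∃ᶠ t : ℂ in nhdsWithin 0 {0}ᶜ,
        _root_.deriv (fun t : ℂ => φ (t • v) x) t = gField g v (φ (t • v) x) := by
      have htendsto : Filter.Tendsto (fun t : ℝ => (t : ℂ)) (nhdsWithin 0 {0}ᶜ)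
          (nhdsWithin 0 {0}ᶜ) :=
        tendsto_nhdsWithin_iff.2 ⟨(Complex.continuous_ofReal.tendsto' 0 0 (by simp)).mono_left
          nhdsWithin_le_nhds, by
            filter_upwards [self_mem_nhdsWithin] with t ht using by simpa using ht⟩
      exact htendsto.frequently (Filter.Frequently.of_forall hreal)
    have hentire := (hsmooth.differentiable (by simp)).differentiableOn.analyticOnNhd isOpen_univ
    have heq := hentire.deriv.eq_of_frequently_eq
      ((hfield.differentiable (by simp)).differentiableOn.analyticOnNhd isOpen_univ) hfrequently
    exact fun t => (hderiv t).congr_deriv (congrFun heq t)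

end Flows

/-! ### Curves of formal points -/

section MovesAlong

variable {A : Type*} {D : ℕ}
  {S : Derivation (MvPowerSeries A ℂ) (smoothSeries A D) (smoothSeries A D)}
  {p q : ℝ → FormalPoint A D} {t : ℝ}

/-- At the time `t`, the velocity of the curve `p` of formal points is that of the formal vector
field with the Lie derivative `S`. -/
def MovesAlong (S : Derivation (MvPowerSeries A ℂ) (smoothSeries A D) (smoothSeries A D))
    (p : ℝ → FormalPoint A D) (t : ℝ) : Prop :=
  ∀ i m, HasDerivAt (fun s => p s m i) ((evalSeries (p t) (S (coord i))).coeff m) t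

theorem MovesAlong.hasDerivAt (hp : MovesAlong S p t) (Φ : smoothSeries A D) (m : A →₀ ℕ) :
    HasDerivAt (fun s => (evalSeries (p s) Φ).coeff m) ((evalSeries (p t) (S Φ)).coeff m) t := by
  have hleib (Φ Ψ : smoothSeries A D) : evalSeries (p t) (S (Φ * Ψ)) =
      evalSeries (p t) Φ * evalSeries (p t) (S Ψ) +
        evalSeries (p t) Ψ * evalSeries (p t) (S Φ) := by
    simp only [S.leibniz, map_add, smul_eq_mul, map_mul]
  have hsum := apply_eq_sum_of_leibniz
    (T := (evalSeries (p t)).toLinearMap ∘ₗ S.toLinearMap) hleib Φ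
  have hderiv := hasDerivAt_coeff_evalSeries
    (p' := fun m i => (evalSeries (p t) (S (coord i))).coeff m)
    (fun m => hasDerivAt_pi.2 fun i => hp i m) Φ m
  exact hderiv.congr_deriv (congrArg (MvPowerSeries.coeff m) hsum.symm)

theorem MovesAlong.congr_of_eventuallyEq (hp : MovesAlong S p t) (h : q =ᶠ[nhds t] p) :
    MovesAlong S q t := fun i m => by
  rw [h.eq_of_nhds]
  exact (hp i m).congr_of_eventuallyEq (h.mono fun _ hs => congrFun (congrFun hs m) i)

theorem movesAlong_zero_const (x : FormalPoint A D) (t : ℝ) :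
    MovesAlong 0 (fun _ => x) t := fun i m => by
  simpa using hasDerivAt_const t (x m i)

theorem eq_of_movesAlong_zero {J : Set ℝ} (hJo : IsOpen J) (hJc : J.OrdConnected)
    (hp : ∀ t ∈ J, MovesAlong 0 p t) {s : ℝ} (hs : s ∈ J) (ht : t ∈ J) : p s = p t := by
  have hderiv (m : A →₀ ℕ) (i : Fin D) (r : ℝ) (hr : r ∈ J) :
      HasDerivAt (fun s => p s m i) 0 r := by
    simpa using hp r hr i m
  funext m i
  exact hJo.is_const_of_deriv_eq_zero hJc.isPreconnected
    (fun r hr => (hderiv m i r hr).differentiableAt.differentiableWithinAt)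
    (fun r hr => (hderiv m i r hr).deriv) hs ht

variable [DecidableEq A]

theorem isFormalSolution_iff_movesAlong {F : FormalMap A D} (hF : IsSmooth F) {J : Set ℝ} :
    IsFormalSolution F J p ↔ ∀ t ∈ J, MovesAlong (fieldDeriv (component F hF)) p t := by
  refine forall₂_congr fun t _ => ?_
  have hvelocity (i : Fin D) (m : A →₀ ℕ) :
      (evalSeries (p t) (fieldDeriv (component F hF) (coord i))).coeff m =
        subst F (p t) m i := by
    rw [fieldDeriv_coord, ← coordSeries_subst, coeff_coordSeries]
  simp only [MovesAlong, hvelocity, hasDerivAt_pi]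
  exact forall_comm

theorem MovesAlong.hasDerivAt_opSeries
    {L : A → Derivation (MvPowerSeries A ℂ) (smoothSeries A D) (smoothSeries A D)}
    (hp : MovesAlong S p t) {δ : ℝ → Coeff A} {δ' : Coeff A}
    (hδ : ∀ w, HasDerivAt (fun s => δ s w) (δ' w) t) (Φ : smoothSeries A D) (m : A →₀ ℕ) :
    HasDerivAt (fun s => (evalSeries (p s) (opSeries L (δ s) Φ)).coeff m)
      ((evalSeries (p t) (S (opSeries L (δ t) Φ) + opSeries L δ' Φ)).coeff m) t := by
  have hsum := HasDerivAt.fun_sum (u := wordsLE m) fun w _ =>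
    (hδ w).fun_mul (hp.hasDerivAt (wordOp L w Φ) m)
  have hvalue (s : ℝ) : ∑ w ∈ wordsLE m, δ s w * (evalSeries (p s) (wordOp L w Φ)).coeff m =
      (evalSeries (p s) (opSeries L (δ s) Φ)).coeff m := by
    refine Eq.trans ?_ ((isFiltered_evalSeries (p s)).coeff_opSeries (L := L) (δ s) m Φ).symm
    rw [pairing_wordTerms]
    rfl
  simp only [hvalue] at hsum
  refine hsum.congr_deriv ?_
  have hS := ((isFiltered_evalSeries (p t)).comp_derivation S).coeff_opSeries (L := L) (δ t) m Φ
  have hδ' := (isFiltered_evalSeries (p t)).coeff_opSeries (L := L) δ' m Φ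
  rw [pairing_wordTerms] at hS hδ'
  rw [map_add, map_add, Finset.sum_add_distrib, add_comm]
  exact congrArg₂ (· + ·) hS.symm hδ'.symm

end MovesAlong

section TimeExtension

variable {A : Type*} {D : ℕ} {V : (Fin D → ℂ) → Fin D → ℂ} {P : ℂ → (Fin D → ℂ) → Fin D → ℂ}

theorem contDiff_cons (τ : ℂ) :
    ContDiff ℂ (⊤ : ℕ∞) fun x : Fin D → ℂ => (Fin.cons τ x : Fin (D + 1) → ℂ) :=
  contDiff_pi.2 (Fin.cases contDiff_const fun i => contDiff_apply ℂ ℂ i)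

theorem contDiff_tail : ContDiff ℂ (⊤ : ℕ∞) fun z : Fin (D + 1) → ℂ => (Fin.tail z : Fin D → ℂ) :=
  contDiff_pi.2 fun i => contDiff_apply ℂ ℂ i.succ

/-- The flow `P`, with the time as an additional coordinate in position `0`. -/
def suspension (P : ℂ → (Fin D → ℂ) → Fin D → ℂ) (z : Fin (D + 1) → ℂ) : Fin D → ℂ :=
  P (z 0) (Fin.tail z)

/-- The vector field which moves the time with velocity `c` and the point along `a • V`. -/
def suspensionField (V : (Fin D → ℂ) → Fin D → ℂ) (c a : ℂ) (z : Fin (D + 1) → ℂ) :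
    Fin (D + 1) → ℂ :=
  Fin.cons c (a • V (Fin.tail z))

theorem contDiff_suspensionField (hV : ContDiff ℂ (⊤ : ℕ∞) V) (c a : ℂ) :
    ContDiff ℂ (⊤ : ℕ∞) (suspensionField V c a) :=
  (contDiff_cons c).comp ((hV.comp contDiff_tail).const_smul a)

namespace IsComplexFlow

theorem contDiff_suspension (hP : IsComplexFlow V P) : ContDiff ℂ (⊤ : ℕ∞) (suspension P) :=
  hP.smooth.comp ((contDiff_apply ℂ ℂ 0).prodMk contDiff_tail)

theorem fderiv_suspension (hV : ContDiff ℂ (⊤ : ℕ∞) V) (hP : IsComplexFlow V P) (c a : ℂ)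
    (z : Fin (D + 1) → ℂ) :
    fderiv ℂ (suspension P) z (suspensionField V c a z) = (c + a) • V (suspension P z) := by
  let L : (Fin (D + 1) → ℂ) →L[ℂ] ℂ × (Fin D → ℂ) :=
    (ContinuousLinearMap.proj 0).prod (.pi fun i => .proj i.succ)
  have hK := (hP.smooth.differentiable (by simp) (L z)).hasFDerivAt.comp z L.hasFDerivAt
  change fderiv ℂ ((fun y : ℂ × (Fin D → ℂ) => P y.1 y.2) ∘ L) z _ = _
  rw [hK.fderiv]
  change fderiv ℂ (fun y : ℂ × (Fin D → ℂ) => P y.1 y.2) (z 0, Fin.tail z)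
    (c, a • V (Fin.tail z)) = (c + a) • V (P (z 0) (Fin.tail z))
  rw [hP.fderiv_uncurry, map_smul, hP.fderiv_self hV, add_smul]

end IsComplexFlow

theorem evalSeries_ofSmooth_const (p : FormalPoint A D) (c : ℂ) :
    evalSeries p (ofSmooth (fun _ => c) contDiff_const) = .C c := by
  have hconst : ofSmooth (fun _ => c) contDiff_const =
      algebraMap _ (smoothSeries A D) (MvPowerSeries.C (σ := A) c) := smoothSeries_ext fun x => by
    rw [evalAt_ofSmooth, AlgHom.commutes]
    rfl
  rw [hconst, AlgHom.commutes]
  rfl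

variable [DecidableEq A]

/-- The formal point `p`, with the time `τ` as an additional coordinate in position `0`. -/
def consTime (τ : ℂ) (p : FormalPoint A D) : FormalPoint A (D + 1) :=
  fun m => Fin.cons (if m = 0 then τ else 0) (p m)

theorem evalSeries_consTime (τ : ℂ) (p : FormalPoint A D) :
    evalSeries (consTime τ p) =
      (evalSeries p).comp (pullback (fun x => Fin.cons τ x) (contDiff_cons τ)) := by
  refine algHom_ext_coord (Fin.cases ?_ fun i => ?_)
  · rw [evalSeries_coord]
    refine Eq.trans ?_ (evalSeries_ofSmooth_const p τ).symm
    exact MvPowerSeries.ext fun m => (MvPowerSeries.coeff_C m τ).symm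
  · rw [evalSeries_coord]
    exact (evalSeries_coord p i).symm

variable {S S' : Derivation (MvPowerSeries A ℂ) (smoothSeries A D) (smoothSeries A D)} {c a τ : ℂ}
  {p : ℝ → FormalPoint A D} {t : ℝ}

theorem movesAlong_consTime (hV : ContDiff ℂ (⊤ : ℕ∞) V)
    (hS : ∀ i, S (coord i) = MvPowerSeries.C (σ := A) a • lieDeriv V hV (coord i))
    (hp : MovesAlong S p t) :
    MovesAlong (lieDeriv (suspensionField V c a) (contDiff_suspensionField hV c a))
      (fun s => consTime (τ + s * c) (p s)) t := by
  refine Fin.cases (fun m => ?_) fun i m => ?_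
  · rw [lieDeriv_coord, evalSeries_consTime]
    change HasDerivAt (fun s : ℝ => if m = 0 then τ + s * c else 0)
      ((evalSeries (p t) (ofSmooth (fun _ => c) contDiff_const)).coeff m) t
    rw [evalSeries_ofSmooth_const, MvPowerSeries.coeff_C]
    split_ifs
    · simpa using (Complex.ofRealCLM.hasDerivAt.mul_const c).const_add τ
    · exact hasDerivAt_const t 0
  · rw [lieDeriv_coord, evalSeries_consTime]
    refine (hp i m).congr_deriv ?_
    rw [hS, lieDeriv_coord]
    refine congrArg (fun Φ => (evalSeries (p t) Φ).coeff m) (smoothSeries_ext fun x => ?_)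
    rw [map_smul, evalAt_ofSmooth, smul_eq_mul, ← map_mul]
    rfl

theorem MovesAlong.subst_flow (hV : ContDiff ℂ (⊤ : ℕ∞) V) (hP : IsComplexFlow V P)
    (hS : ∀ i, S (coord i) = MvPowerSeries.C (σ := A) a • lieDeriv V hV (coord i))
    (hS' : ∀ i, S' (coord i) = MvPowerSeries.C (σ := A) (c + a) • lieDeriv V hV (coord i))
    (hp : MovesAlong S p t) :
    MovesAlong S' (fun s => subst (mapSeries (P (τ + s * c))) (p s)) t := by
  have heval (τ : ℂ) (p : FormalPoint A D) (Φ : smoothSeries A D) :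
      evalSeries (subst (mapSeries (P τ)) p) Φ =
        evalSeries (consTime τ p) (pullback (suspension P) hP.contDiff_suspension Φ) := by
    rw [evalSeries_subst_mapSeries (hP.contDiff τ), evalSeries_consTime]
    rfl
  intro i m
  have hderiv := (movesAlong_consTime hV (c := c) (τ := τ) hS hp).hasDerivAt
    (pullback (suspension P) hP.contDiff_suspension (coord i)) m
  rw [lieDeriv_pullback _ _ hV (hP.fderiv_suspension hV c a), map_smul] at hderiv
  simp only [← heval, evalSeries_coord, coeff_coordSeries] at hderiv
  simpa [hS'] using hderiv

end TimeExtension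

section Solutions

variable {A : Type*} [DecidableEq A] {D : ℕ}

theorem subst_mapSeries_id (p : FormalPoint A D) : subst (mapSeries fun x => x) p = p :=
  coordSeries_injective fun i =>
    (coordSeries_subst_mapSeries (F := fun x => x) contDiff_fun_id p i).trans (evalSeries_coord p i)

namespace IsComplexFlow

variable {V : (Fin D → ℂ) → Fin D → ℂ} {P : ℂ → (Fin D → ℂ) → Fin D → ℂ}

theorem movesAlong_subst (hV : ContDiff ℂ (⊤ : ℕ∞) V) (hP : IsComplexFlow V P)
    (x : FormalPoint A D) (t : ℝ) :
    MovesAlong (lieDeriv V hV) (fun s => subst (mapSeries (P s)) x) t := by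
  have h := (movesAlong_zero_const x t).subst_flow hV hP (S' := lieDeriv V hV) (c := 1) (a := 0)
    (τ := 0) (fun i => by rw [map_zero, zero_smul, Derivation.zero_apply])
    (fun i => by rw [add_zero, map_one, one_smul])
  simpa only [zero_add, mul_one] using h

theorem eq_subst_of_movesAlong (hV : ContDiff ℂ (⊤ : ℕ∞) V) (hP : IsComplexFlow V P) {J : Set ℝ}
    (hJo : IsOpen J) (hJc : J.OrdConnected) (h0 : (0 : ℝ) ∈ J) {p : ℝ → FormalPoint A D}
    (hp : ∀ t ∈ J, MovesAlong (lieDeriv V hV) p t) {t : ℝ} (ht : t ∈ J) :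
    p t = subst (mapSeries (P t)) (p 0) := by
  have hconst (s : ℝ) (hs : s ∈ J) :
      MovesAlong 0 (fun s : ℝ => subst (mapSeries (P (t + s * -1))) (p s)) s :=
    (hp s hs).subst_flow hV hP (c := -1) (a := 1) (τ := t)
      (fun i => by rw [map_one, one_smul])
      (fun i => by rw [neg_add_cancel, map_zero, zero_smul, Derivation.zero_apply])
  have h := eq_of_movesAlong_zero hJo hJc hconst ht h0
  have hP0 : P 0 = fun x => x := funext hP.zero
  simpa [hP0, subst_mapSeries_id] using h

end IsComplexFlow

variable {f : A → (Fin D → ℂ) → Fin D → ℂ} (hf : ∀ ℓ, ContDiff ℂ (⊤ : ℕ∞) (f ℓ))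
  {S S' : Derivation (MvPowerSeries A ℂ) (smoothSeries A D) (smoothSeries A D)}
  {β : Coeff A} {p : ℝ → FormalPoint A D} {t : ℝ}

theorem MovesAlong.subst_wordSeries (hp : MovesAlong S p t) {δ : ℝ → Coeff A} {δ' : Coeff A}
    (hδ : ∀ w, HasDerivAt (fun s => δ s w) (δ' w) t) (hδt : δ t ∈ groupG A)
    (h : ∀ i, S (opSeries (letterDeriv hf) (δ t) (coord i)) +
      opSeries (letterDeriv hf) δ' (coord i) = opSeries (letterDeriv hf) (δ t) (S' (coord i))) :
    MovesAlong S' (fun s => subst (wordSeries f (δ s)) (p s)) t := fun i m => by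
  have hderiv := hp.hasDerivAt_opSeries (L := letterDeriv hf) hδ (coord i) m
  simp only [← coordSeries_subst_wordSeries, coeff_coordSeries, h i] at hderiv
  rwa [evalSeries_subst_wordSeries hf hδt]

theorem MovesAlong.subst_expStar (hβ : β ∈ lieG A)
    (hS : ∀ Φ, S (opSeries (letterDeriv hf) (expStar ((t : ℂ) • β)) Φ) =
      opSeries (letterDeriv hf) (expStar ((t : ℂ) • β)) (S Φ))
    (hp : MovesAlong S p t) : MovesAlong (S + opSeriesDeriv (letterDeriv hf) hβ)
      (fun s => subst (wordSeries f (expStar ((s : ℂ) • β))) (p s)) t := by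
  refine hp.subst_wordSeries hf (fun w => (hasDerivAt_expStar_smul hβ.1 w t).comp_ofReal)
    (expStar_mem_groupG (smul_mem_lieG _ hβ)) fun i => ?_
  rw [(commute_expStar_smul hβ.1 t).eq, opSeries_mul, hS, Derivation.add_apply, map_add]
  rfl

theorem MovesAlong.subst_expStar_neg (hβ : β ∈ lieG A)
    (hS : ∀ Φ, S (opSeries (letterDeriv hf) (expStar (-(t : ℂ) • β)) Φ) =
      opSeries (letterDeriv hf) (expStar (-(t : ℂ) • β)) (S Φ))
    (hp : MovesAlong (S + opSeriesDeriv (letterDeriv hf) hβ) p t) :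
    MovesAlong S (fun s => subst (wordSeries f (expStar (-(s : ℂ) • β))) (p s)) t := by
  have hneg : -β ∈ lieG A := by simpa using smul_mem_lieG (-1) hβ
  have hsmul (s : ℝ) : (s : ℂ) • -β = -(s : ℂ) • β := by rw [smul_neg, neg_smul]
  have hcancel :
      S + opSeriesDeriv (letterDeriv hf) hβ + opSeriesDeriv (letterDeriv hf) hneg = S := by
    refine Derivation.ext fun Φ => ?_
    have h : opSeries (letterDeriv hf) β Φ + opSeries (letterDeriv hf) (-β) Φ = 0 := by
      rw [← LinearMap.add_apply, ← opSeries_add, add_neg_cancel, opSeries_zero,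
        LinearMap.zero_apply]
    rw [add_assoc, Derivation.add_apply]
    exact (congrArg (S Φ + ·) h).trans (add_zero _)
  have hcomm : opSeries (letterDeriv hf) β * opSeries (letterDeriv hf) (expStar (-(t : ℂ) • β)) =
      opSeries (letterDeriv hf) (expStar (-(t : ℂ) • β)) * opSeries (letterDeriv hf) β := by
    rw [← opSeries_mul, (commute_expStar_smul hβ.1 _).eq, opSeries_mul]
  have hSβ (Φ : smoothSeries A D) :
      (S + opSeriesDeriv (letterDeriv hf) hβ)
          (opSeries (letterDeriv hf) (expStar ((t : ℂ) • -β)) Φ) =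
        opSeries (letterDeriv hf) (expStar ((t : ℂ) • -β))
          ((S + opSeriesDeriv (letterDeriv hf) hβ) Φ) := by
    rw [hsmul, Derivation.add_apply, Derivation.add_apply, map_add, hS]
    exact congrArg _ (LinearMap.congr_fun hcomm Φ)
  simpa only [hcancel, hsmul] using hp.subst_expStar hf hneg hSβ

/-- Variation of constants: `q` is the curve `p` pulled back by the flow of `W_β`. -/
theorem exists_movesAlong_eq_subst_expStar (hβ : β ∈ lieG A)
    (hS : ∀ (c : ℂ) Φ, S (opSeries (letterDeriv hf) (expStar (c • β)) Φ) =
      opSeries (letterDeriv hf) (expStar (c • β)) (S Φ)) {J : Set ℝ}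
    (hp : ∀ t ∈ J, MovesAlong (S + opSeriesDeriv (letterDeriv hf) hβ) p t) :
    ∃ q : ℝ → FormalPoint A D, q 0 = p 0 ∧ (∀ t ∈ J, MovesAlong S q t) ∧
      ∀ t : ℝ, p t = subst (wordSeries f (expStar ((t : ℂ) • β))) (q t) := by
  refine ⟨_, ?_, fun t ht => (hp t ht).subst_expStar_neg hf hβ (hS _), fun t => ?_⟩
  · rw [Complex.ofReal_zero, neg_zero, zero_smul, expStar_zero, subst_wordSeries_one hf]
  · rw [subst_wordSeries_subst_wordSeries hf _ (expStar_mem_groupG (smul_mem_lieG _ hβ)),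
      expStar_neg_smul_mul hβ.1, subst_wordSeries_one hf]

include hf in
theorem isFormalFlow_expStar (hβ : β ∈ lieG A) :
    IsFormalFlow (wordSeries f β) fun t => wordSeries f (expStar ((t : ℂ) • β)) := by
  refine ⟨fun t => isSmooth_wordSeries hf _, fun x => ?_, fun x => ?_⟩
  · beta_reduce
    rw [← subst_pointSeries (isSmooth_wordSeries hf _), Complex.ofReal_zero, zero_smul,
      expStar_zero, subst_wordSeries_one hf]
  · rw [isFormalSolution_iff_movesAlong (isSmooth_wordSeries hf β),
      fieldDeriv_component_wordSeries hf hβ]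
    intro t _
    have h := (movesAlong_zero_const (pointSeries x) t).subst_expStar hf hβ (by simp)
    simpa only [zero_add, subst_pointSeries (isSmooth_wordSeries hf _)] using h

include hf in
theorem IsFormalFlow.eq_wordSeries (hβ : β ∈ lieG A) {Φ : ℝ → FormalMap A D}
    (hΦ : IsFormalFlow (wordSeries f β) Φ) (t : ℝ) :
    Φ t = wordSeries f (expStar ((t : ℂ) • β)) := by
  funext x
  have hmoves := (isFormalSolution_iff_movesAlong (isSmooth_wordSeries hf β)).1 (hΦ.2.2 x)
  rw [fieldDeriv_component_wordSeries hf hβ,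
    ← zero_add (opSeriesDeriv (letterDeriv hf) hβ)] at hmoves
  obtain ⟨q, hq0, hq, hΦq⟩ := exists_movesAlong_eq_subst_expStar hf hβ (by simp) hmoves
  have hconst : q t = q 0 :=
    eq_of_movesAlong_zero isOpen_univ Set.ordConnected_univ hq trivial trivial
  rw [hΦq t, hconst, hq0, hΦ.2.1, subst_pointSeries (isSmooth_wordSeries hf _)]

end Solutions

/-! ### The normal form -/

section NormalForm

variable {A : Type*} {d D : ℕ} {ν : Fin d → A → ℂ} {u v : Fin d → ℂ} {β γ : Coeff A}

theorem nuWord_smul (c : ℂ) (v : Fin d → ℂ) (w : List A) :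
    nuWord ν (c • v) w = c * nuWord ν v w := by
  rw [nuWord, nuWord, ← List.sum_map_mul_left]
  refine congrArg List.sum (List.map_congr_left fun ℓ _ => ?_)
  simp [Finset.mul_sum, mul_assoc]

theorem xi_zero_right (v : Fin d → ℂ) : xi ν v (0 : Coeff A) = 0 :=
  funext fun _ => mul_zero _

theorem xi_zero_left (β : Coeff A) : xi ν 0 β = 0 :=
  funext fun w => by simp [xi, nuWord]

theorem xi_eq_zero_iff : xi ν v β = 0 ↔ ∀ w, nuWord ν v w = 0 ∨ β w = 0 :=
  funext_iff.trans (forall_congr' fun _ => mul_eq_zero)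

theorem xi_eq_zero_of_mem_resonanceSpace (hu : u ∈ resonanceSpace ν v) (h : xi ν v β = 0) :
    xi ν u β = 0 :=
  xi_eq_zero_iff.2 fun w => (xi_eq_zero_iff.1 h w).imp_left (hu w)

theorem xi_expStar_smul_eq_zero (h : xi ν v β = 0) (c : ℂ) : xi ν v (expStar (c • β)) = 0 :=
  xi_expStar_eq_zero (xi_eq_zero_iff.2 fun w =>
    (xi_eq_zero_iff.1 h w).imp_right fun hw => mul_eq_zero_of_right c hw)

theorem bigXi_smul_of_xi_eq_zero (h : xi ν v β = 0) (c : ℂ) : bigXi ν (c • v) β = β :=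
  funext fun w => by
    rw [bigXi, nuWord_smul]
    rcases xi_eq_zero_iff.1 h w with hw | hw <;> simp [hw]

theorem bigXi_zero_left (β : Coeff A) : bigXi ν 0 β = β :=
  funext fun w => by simp [bigXi, nuWord]

theorem extBracket_left_zero (v : Fin d → ℂ) (β : Coeff A) :
    extBracket ν (v, 0) (0, β) = (0, xi ν v β) := by
  simp [extBracket, xi_zero_left]

theorem extBracket_right_zero (u : Fin d → ℂ) (β : Coeff A) :
    extBracket ν (0, β) (u, 0) = (0, -xi ν u β) := by
  simp [extBracket, xi_zero_right]

theorem bigStar_zero_left (v : Fin d → ℂ) (γ : Coeff A) :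
    bigStar ν (0, γ) (v, 1) = (v, γ) := by
  simp [bigStar, bigXi_zero_left]

theorem bigStar_one_left (v : Fin d → ℂ) (hγ : γ [] = 1) :
    bigStar ν (v, 1) (0, γ) = (v, bigXi ν v γ) := by
  simp [bigStar, hγ]

theorem prod_map_exp_neg_mul (v : Fin d → ℂ) (t : ℂ) (w : List A) :
    (w.map fun ℓ => Complex.exp (-((∑ j, v j * ν j ℓ) * t))).prod =
      Complex.exp (-(nuWord ν v w * t)) := by
  induction w with
  | nil => simp [nuWord]
  | cons ℓ w ih =>
    rw [List.map_cons, List.prod_cons, ih, ← Complex.exp_add, ← neg_add, ← add_mul]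
    rfl

variable {g : Fin d → (Fin D → ℂ) → Fin D → ℂ} {f : A → (Fin D → ℂ) → Fin D → ℂ}
  {φ : (Fin d → ℂ) → (Fin D → ℂ) → Fin D → ℂ} (hg : ∀ j, ContDiff ℂ (⊤ : ℕ∞) (g j))
  (hf : ∀ ℓ, ContDiff ℂ (⊤ : ℕ∞) (f ℓ))
  (heig : ∀ j ℓ x, VectorField.lieBracket ℂ (g j) (f ℓ) x = ν j ℓ • f ℓ x) (hφ : IsFlow g φ)

variable [DecidableEq A]

include hg heig hφ

theorem opSeries_pullback_flow (t : ℂ) (h : xi ν v γ = 0)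
    (hP : ContDiff ℂ (⊤ : ℕ∞) (φ (t • v))) (Φ : smoothSeries A D) :
    opSeries (letterDeriv hf) γ (pullback (φ (t • v)) hP Φ) =
      pullback (φ (t • v)) hP (opSeries (letterDeriv hf) γ Φ) := by
  refine opSeries_pullback hP (fun ℓ Φ => lieDeriv_pullback hP (hf ℓ) (hf ℓ)
    ((hφ.isComplexFlow hg v).fderiv_eigenfield (contDiff_gField hg v) (hf ℓ)
      (lieBracket_gField hg heig v ℓ) t) Φ) (fun w => ?_) Φ
  rw [prod_map_exp_neg_mul]
  rcases xi_eq_zero_iff.1 h w with hw | hw <;> simp [hw]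

include hf

theorem subst_wordSeries_subst_flow (t : ℂ) (hγ : γ ∈ groupG A) (h : xi ν v γ = 0)
    (p : FormalPoint A D) :
    subst (wordSeries f γ) (subst (mapSeries (φ (t • v))) p) =
      subst (mapSeries (φ (t • v))) (subst (wordSeries f γ) p) := by
  have hP := (hφ.isComplexFlow hg v).contDiff t
  refine coordSeries_injective fun i => ?_
  rw [coordSeries_subst_wordSeries hf, evalSeries_subst_mapSeries hP, ← evalSeries_coord,
    evalSeries_subst_mapSeries hP, evalSeries_subst_wordSeries hf hγ]
  exact congrArg (evalSeries p) (opSeries_pullback_flow hg hf heig hφ t h hP (coord i)).symm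

omit hg hf heig hφ in
theorem wordSeries_zero : wordSeries f (0 : Coeff A) = 0 :=
  funext fun _ => funext fun _ => Finset.sum_eq_zero fun _ _ => zero_smul ℂ _

omit hg heig hφ in
theorem fieldDeriv_component_extField (hG : ContDiff ℂ (⊤ : ℕ∞) (gField g v)) (hβ : β ∈ lieG A)
    (h : IsSmooth (extField g f (v, β))) :
    fieldDeriv (component (extField g f (v, β)) h) =
      lieDeriv (gField g v) hG + opSeriesDeriv (letterDeriv hf) hβ := by
  refine derivation_ext_coord fun i => ?_
  rw [Derivation.add_apply, ← fieldDeriv_component_mapSeries,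
    ← fieldDeriv_component_wordSeries hf hβ, fieldDeriv_coord, fieldDeriv_coord, fieldDeriv_coord]
  rfl

theorem isFormalSolution_extField_iff (hβ : β ∈ lieG A) (h : xi ν v β = 0) {J : Set ℝ}
    (hJo : IsOpen J) (hJc : J.OrdConnected) (h0 : (0 : ℝ) ∈ J) {X : ℝ → FormalPoint A D} :
    IsFormalSolution (extField g f (v, β)) J X ↔ ∀ t ∈ J, X t =
      subst (wordSeries f (expStar ((t : ℂ) • β)))
        (subst (mapSeries (φ ((t : ℂ) • v))) (X 0)) := by
  have hG := contDiff_gField hg v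
  have hP := hφ.isComplexFlow hg v
  have hsmooth : IsSmooth (extField g f (v, β)) := fun m =>
    (isSmooth_mapSeries hG m).add (isSmooth_wordSeries hf β m)
  have hcomm (c : ℂ) (Φ : smoothSeries A D) :
      lieDeriv (gField g v) hG (opSeries (letterDeriv hf) (expStar (c • β)) Φ) =
        opSeries (letterDeriv hf) (expStar (c • β)) (lieDeriv (gField g v) hG Φ) := by
    rw [lieDeriv_opSeries_letterDeriv hg hf heig, xi_expStar_smul_eq_zero h, opSeries_zero,
      LinearMap.zero_apply, add_zero]
  rw [isFormalSolution_iff_movesAlong hsmooth, fieldDeriv_component_extField hf hG hβ]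
  constructor
  · intro hX t ht
    obtain ⟨q, hq0, hq, hXq⟩ := exists_movesAlong_eq_subst_expStar hf hβ hcomm hX
    rw [hXq t, hP.eq_subst_of_movesAlong hG hJo hJc h0 hq ht, hq0]
  · intro hX t ht
    refine ((hP.movesAlong_subst hG (X 0) t).subst_expStar hf hβ (hcomm t)).congr_of_eventuallyEq ?_
    filter_upwards [hJo.mem_nhds ht] with s hs using hX s hs

omit hg heig in
theorem subst_extWordSeries (u : Fin d → ℂ) (hγ : γ ∈ groupG A) (p : FormalPoint A D) :
    subst (extWordSeries f φ (u, γ)) p = subst (mapSeries (φ u)) (subst (wordSeries f γ) p) := by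
  have hP : ContDiff ℂ (⊤ : ℕ∞) (φ u) := hφ.smooth.comp (contDiff_prodMk_right u)
  have hcoord (x : Fin D → ℂ) (i : Fin D) : coordSeries (extWordSeries f φ (u, γ) x) i =
      evalAt x (opSeries (letterDeriv hf) γ (pullback (φ u) hP (coord i))) := by
    rw [extWordSeries, ← evalSeries_coord, evalSeries_subst_mapSeries hP,
      evalSeries_wordSeries hf hγ]
    rfl
  have hsmooth : IsSmooth (extWordSeries f φ (u, γ)) := fun m => contDiff_pi.2 fun i => by
    have h := contDiff_coeff_evalAt (opSeries (letterDeriv hf) γ (pullback (φ u) hP (coord i))) m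
    simp only [← hcoord] at h
    exact h
  refine coordSeries_injective fun i => ?_
  rw [coordSeries_subst hsmooth, ← evalSeries_coord, evalSeries_subst_mapSeries hP,
    evalSeries_subst_wordSeries hf hγ]
  exact congrArg (evalSeries p) (smoothSeries_ext fun x => hcoord x i)

end NormalForm

end WordSeries

end

open WordSeries in
theorem theorem1_general {A : Type*} [DecidableEq A] {d : ℕ} (ν : Fin d → A → ℂ)
    (v : Fin d → ℂ) (β : Coeff A) (hβ : β ∈ lieG A) :
    ∃ (κ : (Coeff A)ˣ) (βh : Coeff A),
      (κ : Coeff A) ∈ groupG A ∧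
      βh = κ * β * (κ⁻¹ : (Coeff A)ˣ) - xi ν v κ * (κ⁻¹ : (Coeff A)ˣ) ∧
      βh ∈ lieG A ∧
      extBracket ν (v, 0) (0, βh) = (0, xi ν v βh) ∧
      xi ν v βh = 0 ∧
      (∀ u ∈ resonanceSpace ν v, extBracket ν (0, βh) (u, 0) = 0) ∧
      (∀ t : ℝ,
        expStar ((t : ℂ) • βh) ∈ groupG A ∧
        ((t : ℂ) • v, expStar ((t : ℂ) • βh)) =
          bigStar ν (0, expStar ((t : ℂ) • βh)) ((t : ℂ) • v, 1) ∧
        ((t : ℂ) • v, expStar ((t : ℂ) • βh)) =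
          bigStar ν ((t : ℂ) • v, 1) (0, expStar ((t : ℂ) • βh))) ∧
      ∀ (D : ℕ) (g : Fin d → (Fin D → ℂ) → (Fin D → ℂ)) (f : A → (Fin D → ℂ) → (Fin D → ℂ))
        (φ : (Fin d → ℂ) → (Fin D → ℂ) → (Fin D → ℂ)),
        (∀ j, ContDiff ℂ (⊤ : ℕ∞) (g j)) → (∀ ℓ, ContDiff ℂ (⊤ : ℕ∞) (f ℓ)) →
        (∀ j ℓ x, VectorField.lieBracket ℂ (g j) (f ℓ) x = ν j ℓ • f ℓ x) → IsFlow g φ →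
        TransformsInto (wordSeries f κ) (extField g f (v, β)) (extField g f (v, βh)) ∧
        formalBracket (mapSeries (gField g v)) (wordSeries f βh) = 0 ∧
        (∀ u ∈ resonanceSpace ν v,
          formalBracket (mapSeries (gField g u)) (wordSeries f βh) = 0) ∧
        (∃ φh : ℝ → FormalMap A D, IsFormalFlow (wordSeries f βh) φh) ∧
        (∀ φh : ℝ → FormalMap A D, IsFormalFlow (wordSeries f βh) φh →
          ∀ (J : Set ℝ) (X : ℝ → FormalPoint A D), IsOpen J → J.OrdConnected → (0 : ℝ) ∈ J →
            IsFormalSolution (extField g f (v, βh)) J X →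
            ∀ t ∈ J,
              X t = subst (mapSeries (φ ((t : ℂ) • v))) (subst (φh t) (X 0)) ∧
              X t = subst (φh t) (subst (mapSeries (φ ((t : ℂ) • v))) (X 0))) ∧
        (∀ (J : Set ℝ) (X : ℝ → FormalPoint A D), IsOpen J → J.OrdConnected → (0 : ℝ) ∈ J →
          (IsFormalSolution (extField g f (v, βh)) J X ↔
            ∀ t ∈ J, X t =
              subst (extWordSeries f φ ((t : ℂ) • v, expStar ((t : ℂ) • βh))) (X 0))) := by
  obtain ⟨κ, hκ, hxi⟩ := exists_gauge ν v hβ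
  set βh := gaugeAction ν v κ β
  have hβh : βh ∈ lieG A := gaugeAction_mem_lieG ν v hκ hβ
  have hexp (t : ℝ) : expStar ((t : ℂ) • βh) ∈ groupG A := expStar_mem_groupG (smul_mem_lieG _ hβh)
  have hxiexp (t : ℝ) : xi ν v (expStar ((t : ℂ) • βh)) = 0 := xi_expStar_smul_eq_zero hxi t
  have hres (u) (hu : u ∈ resonanceSpace ν v) : xi ν u βh = 0 :=
    xi_eq_zero_of_mem_resonanceSpace hu hxi
  refine ⟨κ, βh, hκ, rfl, hβh, extBracket_left_zero v βh, hxi, fun u hu => ?_, fun t =>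
    ⟨hexp t, (bigStar_zero_left _ _).symm, ?_⟩, fun D g f φ hg hf heig hφ => ?_⟩
  · rw [extBracket_right_zero, hres u hu, neg_zero, Prod.mk_zero_zero]
  · rw [bigStar_one_left _ (hexp t).1, bigXi_smul_of_xi_eq_zero (hxiexp t)]
  have hcomm (t : ℝ) := subst_wordSeries_subst_flow hg hf heig hφ t (hexp t) (hxiexp t)
  have hbracket (u) (hu : xi ν u βh = 0) :
      formalBracket (mapSeries (gField g u)) (wordSeries f βh) = 0 := by
    rw [formalBracket_gField_wordSeries hg hf heig u hβh, hu, wordSeries_zero]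
  refine ⟨transformsInto_of_gauge hg hf heig v hκ hβ, hbracket v hxi,
    fun u hu => hbracket u (hres u hu), ⟨_, isFormalFlow_expStar hf hβh⟩,
    fun φh hφh J X hJo hJc h0 hX t ht => ?_, fun J X hJo hJc h0 => ?_⟩
  · rw [hφh.eq_wordSeries hf hβh, ← hcomm, and_self]
    exact (isFormalSolution_extField_iff hg hf heig hφ hβh hxi hJo hJc h0).1 hX t ht
  · simp only [isFormalSolution_extField_iff hg hf heig hφ hβh hxi hJo hJc h0,
      subst_extWordSeries hf hφ _ (hexp _), hcomm]

open WordSeries in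
theorem theorem1 {A : Type*} [DecidableEq A] {d : ℕ} (ν : Fin d → A → ℂ)
    (v : Fin d → ℂ) (β : Coeff A) (hβ : β ∈ lieG A) :
    ∃ (κ : (Coeff A)ˣ) (βh : Coeff A),
      (κ : Coeff A) ∈ groupG A ∧
      βh = κ * β * (κ⁻¹ : (Coeff A)ˣ) - xi ν v κ * (κ⁻¹ : (Coeff A)ˣ) ∧
      βh ∈ lieG A ∧
      extBracket ν (v, 0) (0, βh) = (0, xi ν v βh) ∧
      xi ν v βh = 0 ∧
      (∀ u ∈ resonanceSpace ν v, extBracket ν (0, βh) (u, 0) = 0) ∧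
      (∀ t : ℝ,
        expStar ((t : ℂ) • βh) ∈ groupG A ∧
        ((t : ℂ) • v, expStar ((t : ℂ) • βh)) =
          bigStar ν (0, expStar ((t : ℂ) • βh)) ((t : ℂ) • v, 1) ∧
        ((t : ℂ) • v, expStar ((t : ℂ) • βh)) =
          bigStar ν ((t : ℂ) • v, 1) (0, expStar ((t : ℂ) • βh))) ∧
      ∀ (D : ℕ) (g : Fin d → (Fin D → ℂ) → (Fin D → ℂ)) (f : A → (Fin D → ℂ) → (Fin D → ℂ))
        (φ : (Fin d → ℂ) → (Fin D → ℂ) → (Fin D → ℂ)),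
        IsPerturbedSystem ν g f → IsFlow g φ →
        -- the change of variables gives the normal form
        TransformsInto (wordSeries f κ) (extField g f (v, β)) (extField g f (v, βh)) ∧
        -- commutation of the vector fields
        formalBracket (mapSeries (gField g v)) (wordSeries f βh) = 0 ∧
        (∀ u ∈ resonanceSpace ν v,
          formalBracket (mapSeries (gField g u)) (wordSeries f βh) = 0) ∧
        -- decomposition of the solutions of the normal form by means of the two flows
        (∃ φh : ℝ → FormalMap A D, IsFormalFlow (wordSeries f βh) φh) ∧
        (∀ φh : ℝ → FormalMap A D, IsFormalFlow (wordSeries f βh) φh →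
          ∀ (J : Set ℝ) (X : ℝ → FormalPoint A D), IsOpen J → J.OrdConnected → (0 : ℝ) ∈ J →
            IsFormalSolution (extField g f (v, βh)) J X →
            ∀ t ∈ J,
              X t = subst (mapSeries (φ ((t : ℂ) • v))) (subst (φh t) (X 0)) ∧
              X t = subst (φh t) (subst (mapSeries (φ ((t : ℂ) • v))) (X 0))) ∧
        -- the solutions of the normal form are the curves given by the extended word series
        (∀ (J : Set ℝ) (X : ℝ → FormalPoint A D), IsOpen J → J.OrdConnected → (0 : ℝ) ∈ J →
          (IsFormalSolution (extField g f (v, βh)) J X ↔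
            ∀ t ∈ J, X t =
              subst (extWordSeries f φ ((t : ℂ) • v, expStar ((t : ℂ) • βh))) (X 0))) := by
  obtain ⟨κ, βh, hκ, hβh, hL, hv, hxi, hu, hexp, hsys⟩ := theorem1_general ν v β hβ
  exact ⟨κ, βh, hκ, hβh, hL, hv, hxi, hu, hexp, fun D g f φ h hφ =>
    hsys D g f φ h.smooth_g h.smooth_f h.eigen hφ⟩
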